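/- Let $p,q\ge 0$, $r\ge 1$, and let $M$ be a smooth manifold of dimension $p+q$. For $k\ge1$ let $T^k_pM$ be the bundle of $p$-velocities of order $k$ (the $k$-jets at $0$ of smooth maps $\mathbb R^p\to M$), let $C^k(p,M)$ be the space of $k$-th order contact elements of $p$-dimensional submanifolds, i.e. the quotient of the regular (immersive) velocities by the right action of the group of invertible $k$-jets $(\mathbb R^p,0)\to(\mathbb R^p,0)$, and let $\wp$ be the quotient projection. Let $\phi=(t^1,\dots,t^p,x^1,\dots,x^q)$ be a chart of $M$. It induces coordinates $u^\alpha_N$, $|N|\le k$, on $T^k_pM$ over its domain (partial derivatives at $0$ of the coordinate components; $\alpha$ runs over the $t$- and $x$-components), and a chart $\phi_C$ of $C^k(p,M)$ with values in $J^k(\mathbb R^p,\mathbb R^q)$: the coordinates $(t^w,v^i_N)$ of a contact element are $(u^w_0,u^i_N)$ of its unique representative with $u^w_N=\delta^{1_w}_N$ for all $|N|\ge1$. Put $\wp_\phi=\phi_C\circ\wp$; it is defined where $\det\mathbf U\neq0$, $\mathbf U=(u^w_n)$. For a smooth map $\sigma$ from an open subset of $\mathbb R^p$ to $M$ let $\partial_k\sigma(\tau)\in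 T^k_pM$ be the jet at $0$ of $s\mapsto\sigma(\tau+s)$. For a Lagrange function $F$ of order $r$ let $\delta F$ denote its Euler–Lagrange expressions $\sum_{|N|\le r}(-1)^{|N|}D_N\bigl(\partial F/\partial u^\alpha_N\bigr)$, a function of jets of order $2r$, with $D_N$ the iterated total derivatives (for functions on $J^r(\mathbb R^p,\mathbb R^q)$ the index runs over the $x^i$ only, with coordinates $v^i_N$). Let $L$ be a smooth function on an open subset $O$ of $J^r(\mathbb R^p,\mathbb R^q)$, so that $L\,d^pt$ represents a Lagrangian on $C^r(p,M)$ in the chart $\phi_C$, and put $\mathcal L=(L\circ\wp_\phi)\cdot\det\mathbf U$ on $T^r_pM$. Let $\sigma:W\to M$ be a smooth map on an open set $W\subseteq\mathbb R^p$ with values in the domain of $\phi$, such that $\det\mathbf U\ne0$ and $\wp_\phi\circ\partial_r\sigma\in O$ on $W$ (in particular $\sigma$ is an immersion). Then the equations $$(\delta L)\circ\wp_\phi\circ\partial_{2r}\sigma=0\qquad\text{and}\qquad \delta\mathcal L\circ\partial_{2r}\sigma=0$$ are equivalent: at every $\tau\in W$ one of them holds if and only if the other does. -/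

import Mathlib

open scoped Manifold ContDiff

/-! ## Multi-indices and iterated derivations -/

/-- Multi-indices `N : Fin p → ℕ` of length `|N| = ∑ n, N n` at most `k`. -/
abbrev MIdx (p k : ℕ) : Type := {N : Fin p → ℕ // ∑ n, N n ≤ k}

instance MIdx.instFinite (p k : ℕ) : Finite (MIdx p k) := by
  have h : {N : Fin p → ℕ | ∑ n, N n ≤ k} ⊆ Set.Iic (fun _ => k) := by
    intro N hN n
    exact (Finset.single_le_sum (f := N) (fun _ _ => Nat.zero_le _) (Finset.mem_univ n)).trans hN
  exact ((Set.finite_Iic _).subset h).to_subtype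

noncomputable instance MIdx.instFintype (p k : ℕ) : Fintype (MIdx p k) := Fintype.ofFinite _

/-- `D ^ N = D₁ ^ N₁ ∘ ⋯ ∘ D_p ^ N_p` for a family of operators `D₁, …, D_p`. -/
def multiPow {X : Type*} {p : ℕ} (D : Fin p → X → X) (N : Fin p → ℕ) (g : X) : X :=
  (List.finRange p).foldr (fun n h => (D n)^[N n] h) g

/-- The partial derivative `∂g/∂τⁿ` of a function on `ℝᵖ`. -/
noncomputable def pderivAlong {p : ℕ} (n : Fin p) (g : (Fin p → ℝ) → ℝ) : (Fin p → ℝ) → ℝ :=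
  fun τ => lineDeriv ℝ g τ (Pi.single n 1)

/-- The partial derivative `∂^|N| g / ∂τ^N` of a function on `ℝᵖ`. -/
noncomputable def multiDeriv {p : ℕ} (N : Fin p → ℕ) (g : (Fin p → ℝ) → ℝ) : (Fin p → ℝ) → ℝ :=
  multiPow pderivAlong N g

/-! ## Jets in coordinates, total derivatives and Euler–Lagrange expressions -/

/-- Jet coordinates `u^α_N`, `|N| ≤ k`, with `α` in the index type `ι`. -/
abbrev JetCoord (p : ℕ) (ι : Type) (k : ℕ) : Type := ι → MIdx p k → ℝ

/-- The jet space `J^k(ℝᵖ, ℝ^ι)`, in its canonical coordinates `(t^w, u^α_N)`. -/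
abbrev JetSpace (p : ℕ) (ι : Type) (k : ℕ) : Type := (Fin p → ℝ) × JetCoord p ι k

/-- The space of infinite jets, on which the total derivatives act. -/
abbrev InfJet (p : ℕ) (ι : Type) : Type := (Fin p → ℝ) × (ι → (Fin p → ℕ) → ℝ)

/-- The projection of infinite jets to jets of order `k`. -/
def InfJet.trunc {p : ℕ} {ι : Type} (k : ℕ) (z : InfJet p ι) : JetSpace p ι k :=
  (z.1, fun α N => z.2 α N.1)

/-- A jet of order `k` seen as an infinite jet whose coordinates of order above `k` vanish. -/
def JetSpace.toInf {p : ℕ} {ι : Type} {k : ℕ} (z : JetSpace p ι k) : InfJet p ι :=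
  (z.1, fun α N => if h : ∑ n, N n ≤ k then z.2 α ⟨N, h⟩ else 0)

/-- The total derivative `D_n = ∂/∂tⁿ + ∑ u^α_{N+1_n} ∂/∂u^α_N`, as the derivative in the
direction with components `1` along `tⁿ` and `u^α_{N+1_n}` along `u^α_N`. -/
noncomputable def totalDeriv {p : ℕ} {ι : Type} (n : Fin p) (F : InfJet p ι → ℝ) :
    InfJet p ι → ℝ :=
  fun z => lineDeriv ℝ F z (Pi.single n 1, fun α N => z.2 α (N + Pi.single n 1))

/-- The coordinate derivative `∂F/∂u^α_N`. -/
noncomputable def jetPartial {p : ℕ} {ι : Type} [DecidableEq ι] {k : ℕ} (α : ι) (N : MIdx p k)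
    (F : JetSpace p ι k → ℝ) : JetSpace p ι k → ℝ :=
  fun z => lineDeriv ℝ F z (0, Pi.single α (Pi.single N 1))

/-- The Euler–Lagrange expressions
`(δF)_α = ∑_{|N| ≤ r} (-1)^|N| D_N (∂F/∂u^α_N)` of a Lagrange function `F` of order `r`, as
functions of jets of order `2r`; the sum involves no coordinate of order above `2r`. -/
noncomputable def eulerLagrange {p : ℕ} {ι : Type} [DecidableEq ι] {r : ℕ}
    (F : JetSpace p ι r → ℝ) (z : JetSpace p ι (2 * r)) : ι → ℝ :=
  fun α => ∑ N : MIdx p r, (-1 : ℝ) ^ (∑ n, N.1 n) *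
    multiPow totalDeriv N.1 (fun y : InfJet p ι => jetPartial α N F (y.trunc r)) z.toInf

/-! ## Velocities -/

/-- The model space `ℝ^(p+q)`, with coordinates split as `(t^w, x^i)`. -/
abbrev ModelPQ (p q : ℕ) : Type := Fin p ⊕ Fin q → ℝ

section Manifold

variable (p q : ℕ) (M : Type*) [TopologicalSpace M] [ChartedSpace (ModelPQ p q) M]

/-- Maps from `ℝᵖ` to `M` that are smooth at `0`. -/
abbrev GermRep : Type _ :=
  {σ : (Fin p → ℝ) → M // ContMDiffAt 𝓘(ℝ, Fin p → ℝ) 𝓘(ℝ, ModelPQ p q) ∞ σ 0}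

/-- Equality of `k`-jets at `0`: same value, and the same partial derivatives up to order `k`
after composition with any function on `M` that is smooth at that value. -/
def velocitySetoid (k : ℕ) : Setoid (GermRep p q M) where
  r σ σ' := σ.1 0 = σ'.1 0 ∧
    ∀ f : M → ℝ, ContMDiffAt 𝓘(ℝ, ModelPQ p q) 𝓘(ℝ, ℝ) ∞ f (σ.1 0) →
      ∀ N : MIdx p k, multiDeriv N.1 (fun τ => f (σ.1 τ)) 0 = multiDeriv N.1 (fun τ => f (σ'.1 τ)) 0
  iseqv :=
    { refl := fun _ => ⟨rfl, fun _ _ _ => rfl⟩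
      symm := fun h => ⟨h.1.symm, fun f hf N => (h.2 f (h.1 ▸ hf) N).symm⟩
      trans := fun h h' =>
        ⟨h.1.trans h'.1, fun f hf N => (h.2 f hf N).trans (h'.2 f (h.1 ▸ hf) N)⟩ }

/-- The space `T^k_p M` of `p`-velocities of order `k`: jets at `0` of maps from `ℝᵖ` to `M`. -/
def Velocity (k : ℕ) : Type _ := Quotient (velocitySetoid p q M k)

variable {p q M} {k : ℕ}

/-- The jet at `0` of a map that is smooth at `0`. -/
def velocityMk (k : ℕ) (σ : GermRep p q M) : Velocity p q M k :=
  Quotient.mk (velocitySetoid p q M k) σ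

/-- The projection `T^k_p M → M`. -/
def Velocity.base (ξ : Velocity p q M k) : M :=
  Quotient.lift (s := velocitySetoid p q M k) (fun σ => σ.1 0) (fun _ _ h => h.1) ξ

/-- The coordinates `u^α_N` of a velocity over the domain of the chart `φ` of `M`: the partial
derivatives at `0` of the components of any representative. -/
noncomputable def Velocity.coord (φ : OpenPartialHomeomorph M (ModelPQ p q))
    (ξ : Velocity p q M k) : JetCoord p (Fin p ⊕ Fin q) k :=
  fun α N => multiDeriv N.1
    (fun τ => φ ((Quotient.out (s := velocitySetoid p q M k) ξ).1 τ) α) 0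

/-- The multi-index `0`. -/
def MIdx.zero (p k : ℕ) : MIdx p k := ⟨0, by simp⟩

/-- The multi-index `1_n`. -/
def MIdx.one {p k : ℕ} (hk : 1 ≤ k) (n : Fin p) : MIdx p k := ⟨Pi.single n 1, by simpa using hk⟩

/-- The determinant of the matrix `U = (u^w_n)`. -/
noncomputable def Velocity.detU (hk : 1 ≤ k) (φ : OpenPartialHomeomorph M (ModelPQ p q))
    (ξ : Velocity p q M k) : ℝ :=
  (Matrix.of fun w n : Fin p => ξ.coord φ (Sum.inl w) (MIdx.one hk n)).det

/-- The jet `∂_k σ (τ)` at `0` of the map `s ↦ σ (τ + s)`. -/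
def velocityAt (k : ℕ) (σ : (Fin p → ℝ) → M) (τ : Fin p → ℝ)
    (hσ : ContMDiffAt 𝓘(ℝ, Fin p → ℝ) 𝓘(ℝ, ModelPQ p q) ∞ σ τ) : Velocity p q M k :=
  velocityMk k ⟨fun s => σ (τ + s), by
    have h : ContMDiffAt 𝓘(ℝ, Fin p → ℝ) 𝓘(ℝ, Fin p → ℝ) ∞ (fun s : Fin p → ℝ => τ + s) 0 :=
      (contDiff_const.add contDiff_id).contMDiff.contMDiffAt
    exact ContMDiffAt.comp (0 : Fin p → ℝ) (by simpa using hσ) h⟩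

/-! ## Contact elements -/

/-- Regular velocities: jets of maps that are immersive at `0`. -/
def Velocity.IsRegular (ξ : Velocity p q M k) : Prop :=
  ∃ σ : GermRep p q M, velocityMk k σ = ξ ∧
    Function.Injective (mfderiv 𝓘(ℝ, Fin p → ℝ) 𝓘(ℝ, ModelPQ p q) σ.1 0)

variable (p q M k) in
/-- Regular velocities of order `k`. -/
abbrev RegularVelocity : Type _ := {ξ : Velocity p q M k // ξ.IsRegular}

/-- `ξ'` is the image of `ξ` under the right action, by composition of jets, of an invertible
`k`-jet `f` from `ℝᵖ` to `ℝᵖ` with source and target `0`. -/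
def SameOrbit (ξ ξ' : RegularVelocity p q M k) : Prop :=
  ∃ (σ σ' : GermRep p q M) (f : (Fin p → ℝ) → (Fin p → ℝ)),
    ContDiffAt ℝ ∞ f 0 ∧ f 0 = 0 ∧ Function.Bijective (fderiv ℝ f 0) ∧
    (∀ τ, σ'.1 τ = σ.1 (f τ)) ∧ velocityMk k σ = ξ.1 ∧ velocityMk k σ' = ξ'.1

variable (p q M k) in
/-- The space `C^k(p, M)` of contact elements of order `k` of `p`-dimensional submanifolds:
the quotient of the regular velocities by the action of the group of invertible jets. -/
def ContactElement : Type _ := Quot (SameOrbit (p := p) (q := q) (M := M) (k := k))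

/-- The quotient projection from regular velocities to contact elements. -/
def contactProj (ξ : RegularVelocity p q M k) : ContactElement p q M k := Quot.mk _ ξ

/-- Velocities over the domain of `φ` with `u^w_N = 1` if `N = 1_w` and `u^w_N = 0` for all other
`N` with `|N| ≥ 1`: they are the jets of graphs `t ↦ (t, x(t))`, up to a translation of `t`. -/
def Velocity.IsNormalized (φ : OpenPartialHomeomorph M (ModelPQ p q))
    (ξ : Velocity p q M k) : Prop :=
  ξ.base ∈ φ.source ∧ ∀ (w : Fin p) (N : MIdx p k), N.1 ≠ 0 →
    ξ.coord φ (Sum.inl w) N = if N.1 = Pi.single w 1 then 1 else 0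

/-- The chart `φ_C` of `C^k(p, M)` induced by the chart `φ = (t^w, x^i)` of `M`, with values in
`J^k(ℝᵖ, ℝ^q)`: the coordinates `(t^w, v^i_N)` of a contact element are the coordinates
`(u^w_0, u^i_N)` of its normalized representative. Its domain consists of the contact elements
that have one (which is then unique); outside the value is `0`. -/
noncomputable def contactChart (φ : OpenPartialHomeomorph M (ModelPQ p q)) :
    ContactElement p q M k → JetSpace p (Fin q) k :=
  Function.extend
    (fun ξ : {ξ : RegularVelocity p q M k // ξ.1.IsNormalized φ} => contactProj ξ.1)
    (fun ξ => (fun w => ξ.1.1.coord φ (Sum.inl w) (MIdx.zero p k),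
      fun i N => ξ.1.1.coord φ (Sum.inr i) N))
    (fun _ => 0)

open Classical in
/-- The map `℘_φ = φ_C ∘ ℘` from velocities to `J^k(ℝᵖ, ℝ^q)` (`0` where it is not defined). -/
noncomputable def wpChart (φ : OpenPartialHomeomorph M (ModelPQ p q)) (ξ : Velocity p q M k) :
    JetSpace p (Fin q) k :=
  if h : ξ.IsRegular then contactChart φ (contactProj ⟨ξ, h⟩) else 0

/-! ## The parameter-homogeneous Lagrange function -/

/-- The function `(L ∘ ℘_φ) · det U` on `T^r_p M`. -/
noncomputable def homogLagrange {r : ℕ} (hr : 1 ≤ r) (φ : OpenPartialHomeomorph M (ModelPQ p q))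
    (L : JetSpace p (Fin q) r → ℝ) (ξ : Velocity p q M r) : ℝ :=
  L (wpChart φ ξ) * ξ.detU hr φ

/-- The expression in the coordinates `u^α_N` of a function `G` on `T^k_p M`. -/
noncomputable def localExpr (φ : OpenPartialHomeomorph M (ModelPQ p q))
    (G : Velocity p q M k → ℝ) : JetCoord p (Fin p ⊕ Fin q) k → ℝ :=
  Function.extend (fun ξ : {ξ : Velocity p q M k // ξ.base ∈ φ.source} => ξ.1.coord φ)
    (fun ξ => G ξ.1) (fun _ => 0)

/-- The components, in the coordinates `x^α = (t^w, x^i)` of the chart `φ`, of the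
Euler–Lagrange covector of a Lagrange function `G` on `T^r_p M` at an element of `T^{2r}_p M`.
As `G` does not depend on the parameter `τ`, neither do they: they are evaluated at `τ = 0`. -/
noncomputable def velocityEulerLagrange {r : ℕ} (φ : OpenPartialHomeomorph M (ModelPQ p q))
    (G : Velocity p q M r → ℝ) (ξ : Velocity p q M (2 * r)) : Fin p ⊕ Fin q → ℝ :=
  eulerLagrange (fun z : JetSpace p (Fin p ⊕ Fin q) r => localExpr φ G z.2) (0, ξ.coord φ)

end Manifold

/-! ## Iterated families of operators -/

/-! Write s = (t, x) for the components of σ in φ. Since det U ≠ 0, the functions t^w(τ) are local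
coordinates on W, with derivations ∇_w = Σ_n (U⁻¹)^n_w ∂_n. These are compatible with
reparametrization (`nabla_comp`), and for a graph they are the ordinary partial derivatives. Hence
℘_φ ∘ ∂σ is the jet of x as a function of t, that is v^i_N = ∇^N x^i (`wpChart_eq`,
`wpChart_velocityAt`).

Vary s by η and put Q^i = η^i − Σ_a η^a ∇_a x^i. Then v^i_N varies by ∇^N Q^i + Σ_a η^a ∇_a v^i_N
(`charVar_contactCoord`), so 𝓛 varies by det U · (Σ ∂L/∂v^i_N · ∇^N Q^i + Σ_a ∇_a(η^a L))
(`linVar_homogLift`). By the Piola identity, det U times a ∇-derivative is a divergence in τ. For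
compactly supported η the last sum therefore integrates to zero, and the ∇^N can be moved off Q^i by
parts. Comparison with the integration by parts in τ, together with the fundamental lemma, gives on
W (δ𝓛)_α = det U · Σ_i (δL)_i c^i_α, with c^i = δ^i_j for α = x^j and c^i = −∇_w x^i for α = t^w
(`eulerLagrange_homogLift`). So δL = 0 makes every component vanish, and the x-components alone give
δL = 0 back.

Two technical devices recur. Identities on ℝᵖ are equalities of germs, so that they can be
differentiated again. Functions of infinite jets are handled through smooth functions of finite
truncations (`CylAt`), as the space of infinite jets is not normed. -/

section MultiPow

open Topology Filter

variable {X Y : Type*} {p : ℕ}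

/-- Statements about D^N are proved by carrying a relation through one operator at a time. The grade
counts the operators applied; it later becomes the order of a function of jets. -/
theorem multiPow_simulation (D : Fin p → X → X) (D' : Fin p → Y → Y) (H : ℕ → X → Y → Prop)
    (hH : ∀ k n g h, H k g h → H (k + 1) (D n g) (D' n h)) (N : Fin p → ℕ) {k : ℕ} {g : X} {h : Y}
    (hgh : H k g h) : H (k + ∑ n, N n) (multiPow D N g) (multiPow D' N h) := by
  have key : ∀ l : List (Fin p),
      H (k + (l.map N).sum) (l.foldr (fun n h => (D n)^[N n] h) g)
        (l.foldr (fun n h => (D' n)^[N n] h) h) := by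
    intro l
    induction l with
    | nil => simpa using hgh
    | cons a l ih =>
      have it : ∀ (j m : ℕ) (g : X) (h : Y), H m g h → H (m + j) ((D a)^[j] g) ((D' a)^[j] h) := by
        intro j
        induction j with
        | zero => intro m g h hh; simp [hh]
        | succ j ihj =>
          intro m g h hh
          rw [Function.iterate_succ_apply, Function.iterate_succ_apply]
          have := ihj (m + 1) _ _ (hH _ a _ _ hh)
          rwa [show m + (j + 1) = m + 1 + j by ring]
      have := it (N a) _ _ _ ih
      simp only [List.map_cons, List.sum_cons, List.foldr_cons]
      rwa [show k + (N a + (l.map N).sum) = k + (l.map N).sum + N a by ring]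
  have := key (List.finRange p)
  rwa [show ((List.finRange p).map N).sum = ∑ n, N n from (Fin.sum_univ_def N).symm] at this

theorem multiPow_simulation' (D : Fin p → X → X) (D' : Fin p → Y → Y) (H : X → Y → Prop)
    (hH : ∀ n g h, H g h → H (D n g) (D' n h)) (N : Fin p → ℕ) {g : X} {h : Y}
    (hgh : H g h) : H (multiPow D N g) (multiPow D' N h) :=
  multiPow_simulation D D' (fun _ => H) (fun _ => hH) N (k := 0) hgh

@[simp] theorem multiPow_zero (D : Fin p → X → X) (g : X) : multiPow D 0 g = g := by
  have : ∀ l : List (Fin p), l.foldr (fun n h => (D n)^[(0 : Fin p → ℕ) n] h) g = g := by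
    intro l
    induction l with
    | nil => rfl
    | cons a l ih => simp
  exact this _

/-- For operators that commute modulo an equivalence relation, on a stable class of elements,
`D ^ (N + 1_n)` is `D ^ N ∘ D_n` and `D_n ∘ D ^ N` modulo that relation. -/
theorem multiPow_add_single (D : Fin p → X → X) (R : X → X → Prop) (hR : Equivalence R)
    (hD : ∀ n g h, R g h → R (D n g) (D n h)) (P : X → Prop) (hP : ∀ n g, P g → P (D n g))
    (hcomm : ∀ m n g, P g → R (D m (D n g)) (D n (D m g))) (N : Fin p → ℕ) (n : Fin p) {g : X}
    (hg : P g) :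
    R (multiPow D (N + Pi.single n 1) g) (multiPow D N (D n g)) ∧
      R (multiPow D (N + Pi.single n 1) g) (D n (multiPow D N g)) := by
  have itR : ∀ (m : Fin p) (j : ℕ) (g h : X), R g h → R ((D m)^[j] g) ((D m)^[j] h) := by
    intro m j
    induction j with
    | zero => intro g h hh; exact hh
    | succ j ih =>
      intro g h hh
      simpa only [Function.iterate_succ_apply] using ih _ _ (hD m _ _ hh)
  have itP : ∀ (m : Fin p) (j : ℕ) (g : X), P g → P ((D m)^[j] g) := by
    intro m j
    induction j with
    | zero => intro g hh; simpa using hh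
    | succ j ih =>
      intro g hh
      simpa only [Function.iterate_succ_apply] using ih _ (hP m _ hh)
  have itC : ∀ (m : Fin p) (j : ℕ) (g : X), P g → R ((D m)^[j] (D n g)) (D n ((D m)^[j] g)) := by
    intro m j
    induction j with
    | zero => intro g _; exact hR.refl _
    | succ j ih =>
      intro g hh
      simp only [Function.iterate_succ_apply]
      exact hR.trans (itR m j _ _ (hcomm m n g hh)) (ih _ (hP m _ hh))
  have lP : ∀ (N : Fin p → ℕ) (l : List (Fin p)), P (l.foldr (fun n h => (D n)^[N n] h) g) := by
    intro N l
    induction l with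
    | nil => exact hg
    | cons a l ih => exact itP _ _ _ ih
  have lC : ∀ l : List (Fin p), R (l.foldr (fun n h => (D n)^[N n] h) (D n g))
      (D n (l.foldr (fun n h => (D n)^[N n] h) g)) := by
    intro l
    induction l with
    | nil => exact hR.refl _
    | cons a l ih => exact hR.trans (itR _ _ _ _ ih) (itC _ _ _ (lP N l))
  have lE : ∀ l : List (Fin p), n ∉ l →
      l.foldr (fun m h => (D m)^[(N + Pi.single n 1 : Fin p → ℕ) m] h) g
        = l.foldr (fun n h => (D n)^[N n] h) g := by
    intro l
    induction l with
    | nil => intro _; rfl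
    | cons a l ih =>
      intro hn
      rw [List.mem_cons, not_or] at hn
      simp only [List.foldr_cons]
      rw [ih hn.2, Pi.add_apply, Pi.single_eq_of_ne (Ne.symm hn.1), add_zero]
  -- The additional operator occurs when the fold reaches n, which happens exactly once because the
  -- list has no duplicates; `lC` then moves it to the inside.
  have lA : ∀ l : List (Fin p), l.Nodup → n ∈ l →
      R (l.foldr (fun m h => (D m)^[(N + Pi.single n 1 : Fin p → ℕ) m] h) g)
        (l.foldr (fun n h => (D n)^[N n] h) (D n g)) := by
    intro l
    induction l with
    | nil => intro _ h; simp at h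
    | cons a l ih =>
      intro hnd hn
      rw [List.nodup_cons] at hnd
      simp only [List.foldr_cons]
      by_cases hna : n = a
      · subst hna
        rw [lE l hnd.1, Pi.add_apply, Pi.single_eq_same, Function.iterate_succ_apply]
        exact itR _ _ _ _ (hR.symm (lC l))
      · rw [Pi.add_apply, Pi.single_eq_of_ne (Ne.symm hna), add_zero]
        exact itR _ _ _ _ (ih hnd.2 ((List.mem_cons.1 hn).resolve_left hna))
  have h1 := lA _ (List.nodup_finRange p) (List.mem_finRange n)
  exact ⟨h1, hR.trans h1 (lC _)⟩

/-- Induction on multi-indices by adding unit vectors. -/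
theorem multiIndex_induction {P : (Fin p → ℕ) → Prop} (h0 : P 0)
    (hs : ∀ N n, P N → P (N + Pi.single n 1)) (N : Fin p → ℕ) : P N := by
  induction hk : ∑ n, N n generalizing N with
  | zero =>
    have : N = 0 := by
      funext n
      exact Finset.sum_eq_zero_iff.1 hk n (Finset.mem_univ n)
    rwa [this]
  | succ k ih =>
    obtain ⟨n, hn⟩ : ∃ n, N n ≠ 0 := by
      by_contra! h
      simp [h] at hk
    have hN : N = (fun m => N m - (Pi.single n 1 : Fin p → ℕ) m) + Pi.single n 1 := by
      funext m
      by_cases hm : m = n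
      · subst hm; simp; omega
      · simp [hm]
    rw [hN]
    apply hs
    apply ih
    have := congrArg (fun N : Fin p → ℕ => ∑ n, N n) hN
    simp only [Pi.add_apply, Finset.sum_add_distrib, Finset.sum_pi_single', Finset.mem_univ,
      if_true, hk] at this
    omega

end MultiPow

/-! ## Germs of partial derivatives -/

section Germs

open Topology Filter

variable {p : ℕ} {g h : (Fin p → ℝ) → ℝ} {x : Fin p → ℝ}

theorem pderivAlong_eq_fderiv (n : Fin p) (hg : DifferentiableAt ℝ g x) :
    pderivAlong n g x = fderiv ℝ g x (Pi.single n 1) :=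
  hg.lineDeriv_eq_fderiv

theorem ContDiffAt.eventually_differentiableAt {E F : Type*} [NormedAddCommGroup E]
    [NormedSpace ℝ E] [NormedAddCommGroup F] [NormedSpace ℝ F] {f : E → F} {x : E}
    (hf : ContDiffAt ℝ ∞ f x) : ∀ᶠ y in 𝓝 x, DifferentiableAt ℝ f y := by
  have h1 : ContDiffAt ℝ 1 f x := hf.of_le (by exact_mod_cast le_top)
  filter_upwards [h1.eventually (by simp)] with y hy
  exact hy.differentiableAt one_ne_zero

theorem ContDiffAt.smooth_differentiableAt {E F : Type*} [NormedAddCommGroup E]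
    [NormedSpace ℝ E] [NormedAddCommGroup F] [NormedSpace ℝ F] {f : E → F} {x : E}
    (hf : ContDiffAt ℝ ∞ f x) : DifferentiableAt ℝ f x :=
  hf.differentiableAt (by simp)

/-- Both hypothesis and conclusion concern germs, which is what allows iteration. -/
theorem Filter.EventuallyEq.pderivAlong (n : Fin p) (hgh : g =ᶠ[𝓝 x] h) :
    pderivAlong n g =ᶠ[𝓝 x] pderivAlong n h := by
  filter_upwards [hgh.eventuallyEq_nhds] with y hy
  exact hy.lineDeriv_eq

theorem ContDiffAt.pderivAlong_eventuallyEq (n : Fin p) (hg : ContDiffAt ℝ ∞ g x) :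
    pderivAlong n g =ᶠ[𝓝 x] fun y => fderiv ℝ g y (Pi.single n 1) := by
  filter_upwards [hg.eventually_differentiableAt] with y hy
  exact pderivAlong_eq_fderiv n hy

theorem ContDiffAt.smooth_fderiv {E F : Type*} [NormedAddCommGroup E]
    [NormedSpace ℝ E] [NormedAddCommGroup F] [NormedSpace ℝ F] {f : E → F} {x : E}
    (hf : ContDiffAt ℝ ∞ f x) : ContDiffAt ℝ ∞ (fderiv ℝ f) x :=
  hf.fderiv_right (by exact_mod_cast le_top)

theorem ContDiffAt.pderivAlong (n : Fin p) (hg : ContDiffAt ℝ ∞ g x) :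
    ContDiffAt ℝ ∞ (pderivAlong n g) x :=
  (hg.smooth_fderiv.clm_apply contDiffAt_const).congr_of_eventuallyEq
    (hg.pderivAlong_eventuallyEq n)

theorem pderivAlong_mul (n : Fin p) (hg : DifferentiableAt ℝ g x) (hh : DifferentiableAt ℝ h x) :
    pderivAlong n (fun y => g y * h y) x = pderivAlong n g x * h x + g x * pderivAlong n h x := by
  rw [pderivAlong_eq_fderiv n (hg.fun_mul hh), pderivAlong_eq_fderiv n hg, pderivAlong_eq_fderiv n hh,
    fderiv_fun_mul hg hh]
  simp
  ring

theorem pderivAlong_sub (n : Fin p) (hg : DifferentiableAt ℝ g x) (hh : DifferentiableAt ℝ h x) :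
    pderivAlong n (fun y => g y - h y) x = pderivAlong n g x - pderivAlong n h x := by
  rw [pderivAlong_eq_fderiv n (hg.fun_sub hh), pderivAlong_eq_fderiv n hg, pderivAlong_eq_fderiv n hh,
    fderiv_fun_sub hg hh]
  simp

theorem pderivAlong_sum {κ : Type*} (s : Finset κ) (n : Fin p) {g : κ → (Fin p → ℝ) → ℝ}
    (hg : ∀ i ∈ s, DifferentiableAt ℝ (g i) x) :
    pderivAlong n (fun y => ∑ i ∈ s, g i y) x = ∑ i ∈ s, pderivAlong n (g i) x := by
  rw [pderivAlong_eq_fderiv n (DifferentiableAt.fun_sum hg), fderiv_fun_sum hg,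
    sum_apply]
  exact Finset.sum_congr rfl fun i hi => (pderivAlong_eq_fderiv n (hg i hi)).symm

@[simp] theorem pderivAlong_const (n : Fin p) (c : ℝ) :
    pderivAlong n (fun _ : Fin p → ℝ => c) = fun _ => 0 := by
  funext y
  rw [pderivAlong_eq_fderiv n (differentiableAt_const c)]
  simp

/-- Near x both sides are values of the second derivative of g, which is symmetric. Being C² is an
open condition, so the equality holds for germs. -/
theorem pderivAlong_comm (m n : Fin p) (hg : ContDiffAt ℝ ∞ g x) :
    pderivAlong m (pderivAlong n g) =ᶠ[𝓝 x] pderivAlong n (pderivAlong m g) := by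
  have h2 : ContDiffAt ℝ 2 g x := hg.of_le (by simpa using (WithTop.coe_le_coe.2 (le_top : (2 : ℕ∞) ≤ ⊤)))
  have key : ∀ y, ContDiffAt ℝ 2 g y → ∀ m n : Fin p, pderivAlong m (pderivAlong n g) y
      = fderiv ℝ (fderiv ℝ g) y (Pi.single m 1) (Pi.single n 1) := by
    intro y hy m n
    have e : pderivAlong n g =ᶠ[𝓝 y] fun y => fderiv ℝ g y (Pi.single n 1) := by
      filter_upwards [hy.eventually (by simp)] with z hz
      exact pderivAlong_eq_fderiv n (hz.differentiableAt two_ne_zero)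
    have hd : DifferentiableAt ℝ (fderiv ℝ g) y :=
      (hy.fderiv_right (m := 1) (by norm_num)).differentiableAt one_ne_zero
    rw [(e.pderivAlong m).eq_of_nhds,
      pderivAlong_eq_fderiv m (hd.clm_apply (differentiableAt_const _)),
      fderiv_clm_apply hd (differentiableAt_const _)]
    simp
  filter_upwards [h2.eventually (by simp)] with y hy
  rw [key y hy, key y hy]
  exact hy.isSymmSndFDerivAt (by simp) _ _

theorem map_eq_sum_single {κ F : Type*} [Fintype κ] [DecidableEq κ] [AddCommGroup F] [Module ℝ F]
    (f : (κ → ℝ) →ₗ[ℝ] F) (v : κ → ℝ) : f v = ∑ m, v m • f (Pi.single m 1) := by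
  conv_lhs => rw [← Finset.univ_sum_single v, map_sum]
  refine Finset.sum_congr rfl fun m _ => ?_
  rw [← map_smul, ← Pi.single_smul, smul_eq_mul, mul_one]

/-- The chain rule in partial derivatives. -/
theorem pderivAlong_comp {q : ℕ} {g : (Fin q → ℝ) → ℝ} {f : (Fin p → ℝ) → Fin q → ℝ} (n : Fin p)
    (hg : DifferentiableAt ℝ g (f x)) (hf : DifferentiableAt ℝ f x) :
    pderivAlong n (fun y => g (f y)) x
      = ∑ m, pderivAlong m g (f x) * pderivAlong n (fun y => f y m) x := by
  have hfm : ∀ m, DifferentiableAt ℝ (fun y => f y m) x := differentiableAt_pi.1 hf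
  rw [pderivAlong_eq_fderiv n (g := fun y => g (f y)) (hg.comp x hf),
    show (fun y => g (f y)) = g ∘ f from rfl, fderiv_comp x hg hf,
    ContinuousLinearMap.comp_apply]
  have := map_eq_sum_single (fderiv ℝ g (f x)).toLinearMap (fderiv ℝ f x (Pi.single n 1))
  rw [ContinuousLinearMap.coe_coe] at this
  rw [this]
  refine Finset.sum_congr rfl fun m _ => ?_
  rw [pderivAlong_eq_fderiv m hg, pderivAlong_eq_fderiv n (hfm m), fderiv_pi hfm]
  simp [mul_comm]

end Germs

/-! ## Partial derivatives with respect to a coordinate system -/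

/-! ### Smoothness of determinants and inverse matrices. -/

section MatrixSmooth

variable {E : Type*} [NormedAddCommGroup E] [NormedSpace ℝ E] {κ : Type*} [Fintype κ]
  [DecidableEq κ] {n : ℕ∞ω} {A : E → Matrix κ κ ℝ} {x : E}

theorem contDiffAt_matrix_det (hA : ∀ i j, ContDiffAt ℝ n (fun y => A y i j) x) :
    ContDiffAt ℝ n (fun y => (A y).det) x := by
  simp only [Matrix.det_apply]
  refine ContDiffAt.sum fun σ _ => ?_
  exact (contDiffAt_prod fun i _ => hA _ _).const_smul _

/-- Cramer's rule: an entry of the inverse is a determinant, with one row replaced by a constant,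
divided by the full determinant. -/
theorem contDiffAt_matrix_inv (hA : ∀ i j, ContDiffAt ℝ n (fun y => A y i j) x)
    (hdet : (A x).det ≠ 0) (i j : κ) : ContDiffAt ℝ n (fun y => (A y)⁻¹ i j) x := by
  simp only [Matrix.inv_def, Matrix.smul_apply, Ring.inverse_eq_inv', smul_eq_mul]
  refine ((contDiffAt_matrix_det hA).inv hdet).mul ?_
  simp only [Matrix.adjugate_apply]
  refine contDiffAt_matrix_det fun a b => ?_
  by_cases h : a = j
  · subst h
    simp only [Matrix.updateRow_self]
    exact contDiffAt_const
  · simp only [Matrix.updateRow_ne h]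
    exact hA a b

end MatrixSmooth

/-! ### The derivations ∂/∂T^w of a coordinate system T. -/

section Nabla

open Topology Filter

variable {p : ℕ}

/-- The Jacobian matrix of a system of functions. -/
noncomputable def jacobian (T : Fin p → (Fin p → ℝ) → ℝ) (x : Fin p → ℝ) :
    Matrix (Fin p) (Fin p) ℝ :=
  Matrix.of fun w n => pderivAlong n (T w) x

/-- The partial derivative with respect to the `w`-th function of a coordinate system. -/
noncomputable def nabla (T : Fin p → (Fin p → ℝ) → ℝ) (w : Fin p) (g : (Fin p → ℝ) → ℝ) :
    (Fin p → ℝ) → ℝ :=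
  fun x => ∑ n, (jacobian T x)⁻¹ n w * pderivAlong n g x

/-- The functions `T` form a smooth coordinate system at `x`. -/
structure IsCoordAt (T : Fin p → (Fin p → ℝ) → ℝ) (x : Fin p → ℝ) : Prop where
  smooth : ∀ w, ContDiffAt ℝ ∞ (T w) x
  det_ne : (jacobian T x).det ≠ 0

variable {T T' : Fin p → (Fin p → ℝ) → ℝ} {g h : (Fin p → ℝ) → ℝ} {x : Fin p → ℝ}

theorem IsCoordAt.contDiffAt_jacobian (hT : IsCoordAt T x) (w n : Fin p) :
    ContDiffAt ℝ ∞ (fun y => jacobian T y w n) x :=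
  (hT.smooth w).pderivAlong n

theorem IsCoordAt.contDiffAt_det (hT : IsCoordAt T x) :
    ContDiffAt ℝ ∞ (fun y => (jacobian T y).det) x :=
  contDiffAt_matrix_det hT.contDiffAt_jacobian

theorem IsCoordAt.contDiffAt_inv (hT : IsCoordAt T x) (n w : Fin p) :
    ContDiffAt ℝ ∞ (fun y => (jacobian T y)⁻¹ n w) x :=
  contDiffAt_matrix_inv hT.contDiffAt_jacobian hT.det_ne n w

theorem IsCoordAt.eventually_det_ne (hT : IsCoordAt T x) :
    ∀ᶠ y in 𝓝 x, (jacobian T y).det ≠ 0 :=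
  hT.contDiffAt_det.continuousAt.eventually_ne hT.det_ne

theorem IsCoordAt.contDiffAt_nabla (hT : IsCoordAt T x) (w : Fin p) (hg : ContDiffAt ℝ ∞ g x) :
    ContDiffAt ℝ ∞ (nabla T w g) x :=
  ContDiffAt.sum fun n _ => (hT.contDiffAt_inv n w).mul (hg.pderivAlong n)

theorem jacobian_congr (h : ∀ w, T w =ᶠ[𝓝 x] T' w) : jacobian T =ᶠ[𝓝 x] jacobian T' := by
  have : ∀ᶠ y in 𝓝 x, ∀ w n, pderivAlong n (T w) y = pderivAlong n (T' w) y :=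
    eventually_all.2 fun w => eventually_all.2 fun n => (h w).pderivAlong n
  filter_upwards [this] with y hy
  ext w n
  exact hy w n

theorem nabla_congr (hT : ∀ w, T w =ᶠ[𝓝 x] T' w) (w : Fin p) (hgh : g =ᶠ[𝓝 x] h) :
    nabla T w g =ᶠ[𝓝 x] nabla T' w h := by
  have : ∀ᶠ y in 𝓝 x, ∀ n, pderivAlong n g y = pderivAlong n h y :=
    eventually_all.2 fun n => hgh.pderivAlong n
  filter_upwards [this, jacobian_congr hT] with y hy hj
  simp only [nabla, hj, hy]

theorem Filter.EventuallyEq.nabla (T : Fin p → (Fin p → ℝ) → ℝ) (w : Fin p)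
    (hgh : g =ᶠ[𝓝 x] h) : nabla T w g =ᶠ[𝓝 x] nabla T w h :=
  nabla_congr (fun _ => EventuallyEq.rfl) w hgh

theorem nabla_sub (w : Fin p) (hg : DifferentiableAt ℝ g x) (hh : DifferentiableAt ℝ h x) :
    nabla T w (fun y => g y - h y) x = nabla T w g x - nabla T w h x := by
  simp only [nabla, pderivAlong_sub _ hg hh, mul_sub, Finset.sum_sub_distrib]

theorem nabla_mul (w : Fin p) (hg : DifferentiableAt ℝ g x) (hh : DifferentiableAt ℝ h x) :
    nabla T w (fun y => g y * h y) x = nabla T w g x * h x + g x * nabla T w h x := by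
  simp only [nabla, pderivAlong_mul _ hg hh, Finset.mul_sum, Finset.sum_mul,
    ← Finset.sum_add_distrib]
  exact Finset.sum_congr rfl fun n _ => by ring

theorem nabla_sum {κ : Type*} (s : Finset κ) (w : Fin p) {g : κ → (Fin p → ℝ) → ℝ}
    (hg : ∀ i ∈ s, DifferentiableAt ℝ (g i) x) :
    nabla T w (fun y => ∑ i ∈ s, g i y) x = ∑ i ∈ s, nabla T w (g i) x := by
  simp only [nabla, pderivAlong_sum s _ hg, Finset.mul_sum]
  exact Finset.sum_comm

theorem nabla_coord (hdet : (jacobian T x).det ≠ 0) (w w' : Fin p) :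
    nabla T w (T w') x = if w' = w then 1 else 0 := by
  have h := congrFun (congrFun (Matrix.mul_nonsing_inv (jacobian T x) hdet.isUnit) w') w
  rw [Matrix.mul_apply, Matrix.one_apply] at h
  rw [← h]
  exact Finset.sum_congr rfl fun n _ => mul_comm _ _

theorem pderivAlong_translate (b : Fin p → ℝ) (w n : Fin p) :
    pderivAlong n (fun y => b w + y w) = fun _ => if w = n then (1 : ℝ) else 0 := by
  funext y
  have hd : HasFDerivAt (fun y : Fin p → ℝ => b w + y w)
      (ContinuousLinearMap.proj (R := ℝ) (φ := fun _ : Fin p => ℝ) w) y :=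
    (ContinuousLinearMap.proj (R := ℝ) (φ := fun _ : Fin p => ℝ) w).hasFDerivAt.const_add _
  rw [pderivAlong_eq_fderiv n hd.differentiableAt, hd.fderiv]
  simp [Pi.single_apply]

theorem jacobian_translate (b : Fin p → ℝ) (x : Fin p → ℝ) :
    jacobian (fun w y => b w + y w) x = 1 := by
  ext w n
  simp [jacobian, pderivAlong_translate, Matrix.one_apply]

/-- Ordinary partial derivatives become an instance of `nabla`, so each lemma on `nabla` serves both
for τ and for t. The translation b is free so that the base coordinates of a jet can be adjusted at
will. -/
theorem nabla_translate (b : Fin p → ℝ) : nabla (fun w y => b w + y w) = pderivAlong := by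
  funext w g x
  simp [nabla, jacobian_translate, Matrix.one_apply]

theorem isCoordAt_translate (b x : Fin p → ℝ) : IsCoordAt (fun w y => b w + y w) x where
  smooth w := contDiffAt_const.add (contDiffAt_apply ℝ ℝ w x)
  det_ne := by simp [jacobian_translate]

/-- The operators `nabla` are compatible with reparametrizations. -/
theorem nabla_comp {f : (Fin p → ℝ) → Fin p → ℝ} (hT : IsCoordAt T (f x))
    (hf : ContDiffAt ℝ ∞ f x) (hdet : (jacobian (fun w y => T w (f y)) x).det ≠ 0) (w : Fin p)
    (hg : ContDiffAt ℝ ∞ g (f x)) :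
    nabla (fun w y => T w (f y)) w (fun y => g (f y)) =ᶠ[𝓝 x] fun y => nabla T w g (f y) := by
  have hTf : IsCoordAt (fun w y => T w (f y)) x := ⟨fun w => (hT.smooth w).comp x hf, hdet⟩
  have hfc := hf.continuousAt.tendsto
  filter_upwards [hTf.eventually_det_ne, hf.eventually_differentiableAt,
    hfc.eventually hg.eventually_differentiableAt,
    hfc.eventually (eventually_all.2 fun w => (hT.smooth w).eventually_differentiableAt)]
    with y hy hfy hgy hTy
  set J : Matrix (Fin p) (Fin p) ℝ := Matrix.of fun m n => pderivAlong n (fun z => f z m) y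
  have hmul : jacobian (fun w y => T w (f y)) y = jacobian T (f y) * J := by
    ext w n
    rw [Matrix.mul_apply]
    exact pderivAlong_comp n (hTy w) hfy
  have hJ : IsUnit J.det := by
    rw [hmul, Matrix.det_mul] at hy
    exact (right_ne_zero_of_mul hy).isUnit
  -- The factor J produced by the chain rule on g cancels the one in the Jacobian of T ∘ f.
  have hJi : J * (jacobian (fun w y => T w (f y)) y)⁻¹ = (jacobian T (f y))⁻¹ := by
    rw [hmul, Matrix.mul_inv_rev, ← mul_assoc, Matrix.mul_nonsing_inv J hJ, one_mul]
  simp only [nabla, ← hJi, Matrix.mul_apply, Finset.sum_mul, pderivAlong_comp _ hgy hfy,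
    Finset.mul_sum]
  rw [Finset.sum_comm]
  exact Finset.sum_congr rfl fun m _ => Finset.sum_congr rfl fun n _ => by
    simp only [J, Matrix.of_apply]; ring

/-- A coordinate system has a smooth local inverse. -/
theorem IsCoordAt.exists_inverse (hT : IsCoordAt T x) :
    ∃ S : (Fin p → ℝ) → Fin p → ℝ, ContDiffAt ℝ ∞ S (fun w => T w x) ∧ S (fun w => T w x) = x ∧
      (∀ᶠ t in 𝓝 (fun w => T w x), (fun w => T w (S t)) = t) ∧
      ∀ᶠ y in 𝓝 x, S (fun w => T w y) = y := by
  set f : (Fin p → ℝ) → Fin p → ℝ := fun y w => T w y with hfdef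
  have hf : ContDiffAt ℝ ∞ f x := contDiffAt_pi.2 hT.smooth
  have hfm := fun w => (hT.smooth w).smooth_differentiableAt
  have hL : ∀ v, fderiv ℝ f x v = (jacobian T x).mulVec v := by
    intro v
    have := map_eq_sum_single (fderiv ℝ f x).toLinearMap v
    rw [ContinuousLinearMap.coe_coe] at this
    rw [this]
    ext w
    simp only [Finset.sum_apply, Pi.smul_apply, smul_eq_mul, Matrix.mulVec, dotProduct]
    refine Finset.sum_congr rfl fun n _ => ?_
    rw [fderiv_pi hfm, ContinuousLinearMap.coe_pi']
    simp [jacobian, pderivAlong_eq_fderiv n (hfm w), mul_comm]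
  have hinj : Function.Injective (fderiv ℝ f x) := by
    intro v v' hv
    rw [hL, hL] at hv
    exact Matrix.mulVec_injective_of_isUnit
      ((Matrix.isUnit_iff_isUnit_det _).2 hT.det_ne.isUnit) hv
  let e : (Fin p → ℝ) ≃L[ℝ] (Fin p → ℝ) :=
    (LinearEquiv.ofInjectiveEndo (fderiv ℝ f x).toLinearMap hinj).toContinuousLinearEquiv
  have he : HasFDerivAt f (e : (Fin p → ℝ) →L[ℝ] (Fin p → ℝ)) x := by
    have : (e : (Fin p → ℝ) →L[ℝ] (Fin p → ℝ)) = fderiv ℝ f x := by ext v; rfl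
    rw [this]
    exact hf.smooth_differentiableAt.hasFDerivAt
  have hn : (∞ : ℕ∞ω) ≠ 0 := by simp
  have hs : HasStrictFDerivAt f (e : (Fin p → ℝ) →L[ℝ] (Fin p → ℝ)) x :=
    hf.hasStrictFDerivAt' he hn
  exact ⟨hf.localInverse he hn, hf.to_localInverse he hn, hf.localInverse_apply_image he hn,
    hs.eventually_right_inverse, hs.eventually_left_inverse⟩

/-- Composition with a local inverse S of T turns each `nabla T c` into the partial derivative along
the c-th axis. Those commute, and S ∘ T = id near x brings the identity back. -/
theorem nabla_comm (hT : IsCoordAt T x) (a b : Fin p) (hg : ContDiffAt ℝ ∞ g x) :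
    nabla T a (nabla T b g) =ᶠ[𝓝 x] nabla T b (nabla T a g) := by
  obtain ⟨S, hS, hSx, hTS, hST⟩ := hT.exists_inverse
  set t := fun w => T w x
  have hTt : ∀ w, (fun y => T w (S y)) =ᶠ[𝓝 t] fun y => (0 : Fin p → ℝ) w + y w := fun w => by
    filter_upwards [hTS] with y hy
    simpa using congrFun hy w
  have hj := (jacobian_congr hTt).eq_of_nhds
  rw [jacobian_translate] at hj
  have hdet : (jacobian (fun w y => T w (S y)) t).det ≠ 0 := by rw [hj]; simp
  have key : ∀ (c : Fin p) {g : (Fin p → ℝ) → ℝ}, ContDiffAt ℝ ∞ g x →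
      (fun y => nabla T c g (S y)) =ᶠ[𝓝 t] pderivAlong c fun y => g (S y) := by
    intro c g hg
    rw [← nabla_translate 0]
    exact (nabla_comp (hSx ▸ hT) hS hdet c (hSx ▸ hg)).symm.trans
      (nabla_congr hTt c EventuallyEq.rfl)
  have h2 : ∀ c d : Fin p, (fun y => nabla T c (nabla T d g) (S y)) =ᶠ[𝓝 t]
      pderivAlong c (pderivAlong d fun y => g (S y)) := fun c d =>
    (key c (hT.contDiffAt_nabla d hg)).trans ((key d hg).pderivAlong c)
  have h3 : (fun y => nabla T a (nabla T b g) (S y)) =ᶠ[𝓝 t]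
      fun y => nabla T b (nabla T a g) (S y) :=
    (h2 a b).trans ((pderivAlong_comm a b ((hSx ▸ hg : ContDiffAt ℝ ∞ g (S t)).comp t hS)).trans
      (h2 b a).symm)
  have hTc : Tendsto (fun y => fun w => T w y) (𝓝 x) (𝓝 t) :=
    (contDiffAt_pi.2 hT.smooth).continuousAt.tendsto
  filter_upwards [hTc.eventually h3, hST] with y hy hy'
  rwa [hy'] at hy

/-! ## Iterated derivatives with respect to a coordinate system -/

theorem IsCoordAt.contDiffAt_multiPow (hT : IsCoordAt T x) (N : Fin p → ℕ)
    (hg : ContDiffAt ℝ ∞ g x) : ContDiffAt ℝ ∞ (multiPow (nabla T) N g) x :=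
  multiPow_simulation' (nabla T) (nabla T) (fun g _ => ContDiffAt ℝ ∞ g x)
    (fun n _ _ h => hT.contDiffAt_nabla n h) N (h := g) hg

theorem Filter.EventuallyEq.multiPow_nabla (T : Fin p → (Fin p → ℝ) → ℝ) (N : Fin p → ℕ)
    (hgh : g =ᶠ[𝓝 x] h) : multiPow (_root_.nabla T) N g =ᶠ[𝓝 x] multiPow (_root_.nabla T) N h :=
  multiPow_simulation' _ _ (fun g h => g =ᶠ[𝓝 x] h) (fun n _ _ h => h.nabla T n) N hgh

theorem multiPow_nabla_add_single (hT : IsCoordAt T x) (N : Fin p → ℕ) (n : Fin p)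
    (hg : ContDiffAt ℝ ∞ g x) :
    multiPow (nabla T) (N + Pi.single n 1) g =ᶠ[𝓝 x] multiPow (nabla T) N (nabla T n g) ∧
      multiPow (nabla T) (N + Pi.single n 1) g =ᶠ[𝓝 x] nabla T n (multiPow (nabla T) N g) :=
  multiPow_add_single (nabla T) (fun g h => g =ᶠ[𝓝 x] h)
    ⟨fun _ => EventuallyEq.rfl, EventuallyEq.symm, EventuallyEq.trans⟩
    (fun n _ _ h => h.nabla T n) (fun g => ContDiffAt ℝ ∞ g x)
    (fun n _ h => hT.contDiffAt_nabla n h) (fun m n _ h => nabla_comm hT m n h) N n hg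

theorem multiPow_nabla_comp {f : (Fin p → ℝ) → Fin p → ℝ} (hT : IsCoordAt T (f x))
    (hf : ContDiffAt ℝ ∞ f x) (hdet : (jacobian (fun w y => T w (f y)) x).det ≠ 0)
    (N : Fin p → ℕ) (hg : ContDiffAt ℝ ∞ g (f x)) :
    multiPow (nabla fun w y => T w (f y)) N (fun y => g (f y)) =ᶠ[𝓝 x]
      fun y => multiPow (nabla T) N g (f y) := by
  refine (multiPow_simulation' (nabla fun w y => T w (f y)) (nabla T)
    (fun k h => ContDiffAt ℝ ∞ h (f x) ∧ k =ᶠ[𝓝 x] fun y => h (f y)) ?_ N ⟨hg, EventuallyEq.rfl⟩).2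
  rintro n k h ⟨hh, hkh⟩
  exact ⟨hT.contDiffAt_nabla n hh, (hkh.nabla _ n).trans (nabla_comp hT hf hdet n hh)⟩

theorem multiDeriv_eq_multiPow_nabla (b : Fin p → ℝ) :
    multiDeriv = multiPow (nabla fun w (y : Fin p → ℝ) => b w + y w) := by
  rw [nabla_translate]; rfl

theorem Filter.EventuallyEq.multiDeriv (N : Fin p → ℕ) (hgh : g =ᶠ[𝓝 x] h) :
    multiDeriv N g =ᶠ[𝓝 x] multiDeriv N h := by
  rw [multiDeriv_eq_multiPow_nabla 0]
  exact hgh.multiPow_nabla _ N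

theorem multiDeriv_add_single (N : Fin p → ℕ) (n : Fin p) (hg : ContDiffAt ℝ ∞ g x) :
    multiDeriv (N + Pi.single n 1) g =ᶠ[𝓝 x] multiDeriv N (pderivAlong n g) ∧
      multiDeriv (N + Pi.single n 1) g =ᶠ[𝓝 x] pderivAlong n (multiDeriv N g) := by
  rw [multiDeriv_eq_multiPow_nabla 0, ← nabla_translate 0]
  exact multiPow_nabla_add_single (isCoordAt_translate 0 x) N n hg

theorem multiDeriv_translate (N : Fin p → ℕ) (b : Fin p → ℝ) (g : (Fin p → ℝ) → ℝ) :
    multiDeriv N (fun y => g (b + y)) = fun y => multiDeriv N g (b + y) := by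
  refine multiPow_simulation' pderivAlong pderivAlong (fun k h => k = fun y => h (b + y)) ?_ N rfl
  rintro n k h rfl
  funext y
  simp only [pderivAlong, lineDeriv, add_assoc]

theorem multiDeriv_const (N : Fin p → ℕ) (c : ℝ) :
    multiDeriv N (fun _ : Fin p → ℝ => c) = fun _ => if N = 0 then c else 0 := by
  have hz : ∀ N : Fin p → ℕ, multiDeriv N (fun _ : Fin p → ℝ => (0 : ℝ)) = fun _ => 0 := fun N =>
    multiPow_simulation' pderivAlong pderivAlong (fun g _ => g = fun _ => 0)
      (fun n g _ h => by rw [h]; exact pderivAlong_const n 0) N (h := fun _ => 0) rfl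
  induction N using multiIndex_induction with
  | h0 => simp [multiDeriv]
  | hs N n _ =>
    funext y
    have h := (multiDeriv_add_single N n
      (contDiffAt_const : ContDiffAt ℝ ∞ (fun _ : Fin p → ℝ => c) y)).1.eq_of_nhds
    rw [h, pderivAlong_const, hz, if_neg]
    intro h0
    simpa using congrFun h0 n

theorem multiDeriv_coord (N : Fin p → ℕ) (b : Fin p → ℝ) (w : Fin p) (hN : N ≠ 0)
    (x : Fin p → ℝ) :
    multiDeriv N (fun y => b w + y w) x = if N = Pi.single w 1 then 1 else 0 := by
  induction N using multiIndex_induction with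
  | h0 => exact absurd rfl hN
  | hs N n _ =>
    rw [(multiDeriv_add_single N n ((isCoordAt_translate b x).smooth w)).1.eq_of_nhds,
      pderivAlong_translate, multiDeriv_const]
    by_cases h : N = 0
    · subst h
      by_cases hw : w = n
      · subst hw; simp
      · have : (Pi.single n 1 : Fin p → ℕ) ≠ Pi.single w 1 := fun h' => by
          have := congrFun h' n
          rw [Pi.single_eq_same, Pi.single_eq_of_ne (Ne.symm hw)] at this
          exact one_ne_zero this
        simp [hw, this]
    · rw [if_neg h, if_neg]
      intro h'
      apply h
      have hs : ∑ m, (N + Pi.single n 1 : Fin p → ℕ) m = 1 := by rw [h']; simp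
      simp only [Pi.add_apply, Finset.sum_add_distrib, Finset.sum_pi_single', Finset.mem_univ,
        if_true] at hs
      funext m
      have : ∑ m, N m = 0 := by omega
      exact Finset.sum_eq_zero_iff.1 this m (Finset.mem_univ m)

theorem multiDeriv_sum {κ : Type*} (s : Finset κ) (N : Fin p → ℕ) {g : κ → (Fin p → ℝ) → ℝ}
    (hg : ∀ i ∈ s, ContDiffAt ℝ ∞ (g i) x) :
    multiDeriv N (fun y => ∑ i ∈ s, g i y) =ᶠ[𝓝 x] fun y => ∑ i ∈ s, multiDeriv N (g i) y := by
  -- The second system acts on whole families, componentwise; a second simulation then reads off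
  -- each component.
  refine (multiPow_simulation' (pderivAlong) (fun n (f : κ → (Fin p → ℝ) → ℝ) i =>
    pderivAlong n (f i)) (fun k f => (∀ i ∈ s, ContDiffAt ℝ ∞ (f i) x) ∧
      k =ᶠ[𝓝 x] fun y => ∑ i ∈ s, f i y) ?_ N ⟨hg, EventuallyEq.rfl⟩).2.trans ?_
  · rintro n k f ⟨hf, hkf⟩
    refine ⟨fun i hi => (hf i hi).pderivAlong n, (hkf.pderivAlong n).trans ?_⟩
    have : ∀ᶠ y in 𝓝 x, ∀ i ∈ s, DifferentiableAt ℝ (f i) y :=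
      (eventually_all_finset s).2 fun i hi => (hf i hi).eventually_differentiableAt
    filter_upwards [this] with y hy
    exact pderivAlong_sum s n hy
  · refine Eventually.of_forall fun y => Finset.sum_congr rfl fun i _ => ?_
    exact congrFun (multiPow_simulation' (fun n (f : κ → (Fin p → ℝ) → ℝ) i =>
      pderivAlong n (f i)) pderivAlong (fun f k => f i = k) (fun n f k h => by rw [← h]) N rfl) y

theorem multiDeriv_const_mul (N : Fin p → ℕ) (c : ℝ) (hg : ContDiffAt ℝ ∞ g x) :
    multiDeriv N (fun y => c * g y) =ᶠ[𝓝 x] fun y => c * multiDeriv N g y := by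
  refine (multiPow_simulation' pderivAlong pderivAlong (fun k h => ContDiffAt ℝ ∞ h x ∧
      k =ᶠ[𝓝 x] fun y => c * h y) ?_ N ⟨hg, EventuallyEq.rfl⟩).2
  rintro n k h ⟨hh, hkh⟩
  refine ⟨hh.pderivAlong n, (hkh.pderivAlong n).trans ?_⟩
  filter_upwards [hh.eventually_differentiableAt] with y hy
  rw [pderivAlong_mul n (differentiableAt_const c) hy]
  simp

end Nabla

/-! ## Functions of finite order on infinite jets -/

section Cylinder

open Topology Filter

variable {p : ℕ} {ι : Type}

/-- The direction of the total derivative `D_n`. -/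
def InfJet.totalDir (n : Fin p) (z : InfJet p ι) : InfJet p ι :=
  (Pi.single n 1, fun α N => z.2 α (N + Pi.single n 1))

theorem totalDeriv_eq (n : Fin p) (F : InfJet p ι → ℝ) (z : InfJet p ι) :
    totalDeriv n F z = lineDeriv ℝ F z (z.totalDir n) := rfl

theorem InfJet.toInf_trunc {k k' : ℕ} (h : k ≤ k') (z : InfJet p ι) :
    (z.trunc k').toInf.trunc k = z.trunc k := by
  refine Prod.ext rfl ?_
  funext α N
  simp [InfJet.trunc, JetSpace.toInf, N.2.trans h]

theorem InfJet.trunc_toInf {k : ℕ} (y : JetSpace p ι k) : y.toInf.trunc k = y := by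
  refine Prod.ext rfl ?_
  funext α N
  simp [InfJet.trunc, JetSpace.toInf, N.2]

variable [Fintype ι]
  {V : Type*} [NormedAddCommGroup V] [NormedSpace ℝ V]
  {V' : Type*} [NormedAddCommGroup V'] [NormedSpace ℝ V']

/-- Near the jet of order `k` of `z`, the function `F` is a smooth function of that jet. -/
def CylAt (k : ℕ) (F : InfJet p ι → V) (z : InfJet p ι) : Prop :=
  ∃ G : JetSpace p ι k → V, ContDiffAt ℝ ∞ G (z.trunc k) ∧
    ∀ᶠ y in 𝓝 (z.trunc k), ∀ z' : InfJet p ι, z'.trunc k = y → F z' = G y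

/-- The projection of jets of order `k'` to jets of order `k ≤ k'`. -/
noncomputable def JetSpace.res {k k' : ℕ} (h : k ≤ k') : JetSpace p ι k' →L[ℝ] JetSpace p ι k :=
  LinearMap.toContinuousLinearMap
    { toFun := fun y => (y.1, fun α N => y.2 α ⟨N.1, N.2.trans h⟩)
      map_add' := fun _ _ => rfl
      map_smul' := fun _ _ => rfl }

/-- The jet with components `u^α_{N+1_n}`. -/
noncomputable def JetSpace.shift {k : ℕ} (n : Fin p) :
    JetSpace p ι (k + 1) →L[ℝ] JetSpace p ι k :=
  LinearMap.toContinuousLinearMap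
    { toFun := fun y => (0, fun α N => y.2 α ⟨N.1 + Pi.single n 1, by
        simpa [Finset.sum_add_distrib] using N.2⟩)
      map_add' := fun _ _ => by ext <;> simp
      map_smul' := fun _ _ => by ext <;> simp }

theorem JetSpace.res_trunc {k k' : ℕ} (h : k ≤ k') (z : InfJet p ι) :
    JetSpace.res h (z.trunc k') = z.trunc k := rfl

theorem JetSpace.shift_trunc {k : ℕ} (n : Fin p) (z : InfJet p ι) :
    (z.totalDir n).trunc k = (Pi.single n 1, 0) + JetSpace.shift n (z.trunc (k + 1)) := by
  refine Prod.ext ?_ ?_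
  · exact (add_zero _).symm
  · exact (zero_add _).symm

/-- A line in the space of infinite jets truncates to a line in a finite-dimensional space, where G
has a Fréchet derivative. -/
theorem hasLineDerivAt_of_cyl {k : ℕ} {F : InfJet p ι → V} {G : JetSpace p ι k → V}
    {z : InfJet p ι} (v : InfJet p ι)
    (h : ∀ᶠ y in 𝓝 (z.trunc k), ∀ z' : InfJet p ι, z'.trunc k = y → F z' = G y)
    (hG : DifferentiableAt ℝ G (z.trunc k)) :
    HasLineDerivAt ℝ F (fderiv ℝ G (z.trunc k) (v.trunc k)) z v := by
  have h1 : HasDerivAt (fun t : ℝ => G (z.trunc k + t • v.trunc k))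
      (fderiv ℝ G (z.trunc k) (v.trunc k)) 0 := hG.hasFDerivAt.hasLineDerivAt (v.trunc k)
  have hc : Tendsto (fun t : ℝ => z.trunc k + t • v.trunc k) (𝓝 0) (𝓝 (z.trunc k)) := by
    have : Continuous fun t : ℝ => z.trunc k + t • v.trunc k := by fun_prop
    simpa using this.tendsto 0
  refine h1.congr_of_eventuallyEq ?_
  filter_upwards [hc.eventually h] with t ht
  exact ht (z + t • v) rfl

namespace CylAt

variable {k k' : ℕ} {z z' : InfJet p ι}

theorem mono {F : InfJet p ι → V} (hF : CylAt k F z) (h : k ≤ k') : CylAt k' F z := by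
  obtain ⟨G, hG, hFG⟩ := hF
  refine ⟨fun y => G (JetSpace.res h y), ?_, ?_⟩
  · exact ContDiffAt.comp (z.trunc k') (show ContDiffAt ℝ ∞ G (JetSpace.res h (z.trunc k')) from hG)
      (JetSpace.res (p := p) (ι := ι) h).contDiff.contDiffAt
  · have : Tendsto (JetSpace.res (p := p) (ι := ι) h) (𝓝 (z.trunc k')) (𝓝 (z.trunc k)) :=
      (JetSpace.res h).continuous.tendsto _
    filter_upwards [this.eventually hFG] with y hy z' hz'
    exact hy z' (by rw [← hz', JetSpace.res_trunc])

/-- `CylAt` controls the whole fibre of the truncation, so z' need not be near z. This permits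
replacing the coordinates of high order by zeros. -/
theorem apply_eq {F : InfJet p ι → V} (hF : CylAt k F z) (h : z.trunc k = z'.trunc k) :
    F z = F z' := by
  obtain ⟨G, -, hFG⟩ := hF
  rw [hFG.self_of_nhds z rfl, hFG.self_of_nhds z' h.symm]

theorem comp {F : InfJet p ι → V} {H : V → V'} (hH : ContDiffAt ℝ ∞ H (F z)) (hF : CylAt k F z) :
    CylAt k (fun z => H (F z)) z := by
  obtain ⟨G, hG, hFG⟩ := hF
  refine ⟨fun y => H (G y), ?_, ?_⟩
  · rw [hFG.self_of_nhds z rfl] at hH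
    exact hH.comp (z.trunc k) hG
  · filter_upwards [hFG] with y hy z' hz'
    rw [hy z' hz']

theorem pi {κ : Type*} [Fintype κ] {W : κ → Type*} [∀ i, NormedAddCommGroup (W i)]
    [∀ i, NormedSpace ℝ (W i)] {F : InfJet p ι → ∀ i, W i} (hF : ∀ i, CylAt k (fun z => F z i) z) :
    CylAt k F z := by
  choose G hG hFG using hF
  refine ⟨fun y i => G i y, contDiffAt_pi.2 hG, ?_⟩
  filter_upwards [eventually_all.2 hFG] with y hy z' hz'
  funext i
  exact hy i z' hz'

theorem prodMk {F : InfJet p ι → V} {F' : InfJet p ι → V'} (hF : CylAt k F z)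
    (hF' : CylAt k F' z) : CylAt k (fun z => (F z, F' z)) z := by
  obtain ⟨G, hG, hFG⟩ := hF
  obtain ⟨G', hG', hFG'⟩ := hF'
  refine ⟨fun y => (G y, G' y), hG.prodMk hG', ?_⟩
  filter_upwards [hFG, hFG'] with y hy hy' z' hz'
  rw [hy z' hz', hy' z' hz']

theorem comp_trunc {G : JetSpace p ι k → V} (hG : ContDiffAt ℝ ∞ G (z.trunc k)) :
    CylAt k (fun z => G (z.trunc k)) z :=
  ⟨G, hG, Eventually.of_forall fun _ _ h => congrArg G h⟩

theorem coord (α : ι) (N : Fin p → ℕ) (hN : ∑ n, N n ≤ k) :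
    CylAt k (fun z : InfJet p ι => z.2 α N) z :=
  comp_trunc (G := fun y : JetSpace p ι k => y.2 α ⟨N, hN⟩) (z := z) <| by
    have h : ContDiffAt ℝ ∞ (fun y : JetSpace p ι k => y.2) (z.trunc k) := contDiffAt_snd
    exact contDiffAt_pi.1 (contDiffAt_pi.1 h α) ⟨N, hN⟩

theorem mul {F F' : InfJet p ι → ℝ} (hF : CylAt k F z) (hF' : CylAt k F' z) :
    CylAt k (fun z => F z * F' z) z :=
  (hF.prodMk hF').comp (H := fun v : ℝ × ℝ => v.1 * v.2) (contDiffAt_fst.mul contDiffAt_snd)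

theorem sum {κ : Type*} [Fintype κ] {F : κ → InfJet p ι → ℝ} (hF : ∀ i, CylAt k (F i) z) :
    CylAt k (fun z => ∑ i, F i z) z :=
  (CylAt.pi (F := fun z i => F i z) hF).comp (H := fun v : κ → ℝ => ∑ i, v i)
    (ContDiffAt.sum fun i _ => contDiffAt_apply ℝ ℝ i _)

theorem matrix_inv {κ : Type*} [Fintype κ] [DecidableEq κ] {A : InfJet p ι → Matrix κ κ ℝ}
    (hA : ∀ i j, CylAt k (fun z => A z i j) z) (hdet : (A z).det ≠ 0) (i j : κ) :
    CylAt k (fun z => (A z)⁻¹ i j) z :=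
  (CylAt.pi (F := fun z (i : κ) (j : κ) => A z i j) fun i => CylAt.pi (hA i)).comp
    (H := fun v : κ → κ → ℝ => (Matrix.of v)⁻¹ i j)
    (contDiffAt_matrix_inv (A := fun v : κ → κ → ℝ => Matrix.of v)
      (fun a b => (contDiff_apply_apply ℝ ℝ a b).contDiffAt) hdet i j)

theorem matrix_det {κ : Type*} [Fintype κ] [DecidableEq κ] {A : InfJet p ι → Matrix κ κ ℝ}
    (hA : ∀ i j, CylAt k (fun z => A z i j) z) : CylAt k (fun z => (A z).det) z :=
  (CylAt.pi (F := fun z (i : κ) (j : κ) => A z i j) fun i => CylAt.pi (hA i)).comp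
    (H := fun v : κ → κ → ℝ => (Matrix.of v).det)
    (contDiffAt_matrix_det (A := fun v : κ → κ → ℝ => Matrix.of v)
      (fun a b => (contDiff_apply_apply ℝ ℝ a b).contDiffAt))

/-- The total derivative of a function of order `k`, as a function of order `k + 1`. -/
theorem totalDeriv_eventually {F : InfJet p ι → ℝ} {G : JetSpace p ι k → ℝ}
    (hG : ContDiffAt ℝ ∞ G (z.trunc k))
    (hFG : ∀ᶠ y in 𝓝 (z.trunc k), ∀ z' : InfJet p ι, z'.trunc k = y → F z' = G y) (n : Fin p) :
    ∀ᶠ y in 𝓝 (z.trunc (k + 1)), ∀ z' : InfJet p ι, z'.trunc (k + 1) = y →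
      totalDeriv n F z' = fderiv ℝ G (JetSpace.res k.le_succ y)
        ((Pi.single n 1, 0) + JetSpace.shift n y) := by
  have : Tendsto (JetSpace.res (p := p) (ι := ι) k.le_succ) (𝓝 (z.trunc (k + 1)))
      (𝓝 (z.trunc k)) := (JetSpace.res k.le_succ).continuous.tendsto _
  filter_upwards [this.eventually hFG.eventually_nhds,
    this.eventually hG.eventually_differentiableAt] with y hy hy' z' hz'
  have e : JetSpace.res k.le_succ y = z'.trunc k := by rw [← hz', JetSpace.res_trunc]
  rw [e] at hy hy' ⊢
  rw [totalDeriv_eq, (hasLineDerivAt_of_cyl (z'.totalDir n) hy hy').lineDeriv,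
    JetSpace.shift_trunc, hz']

theorem contDiffAt_totalDeriv {G : JetSpace p ι k → ℝ} (hG : ContDiffAt ℝ ∞ G (z.trunc k))
    (n : Fin p) : ContDiffAt ℝ ∞ (fun y : JetSpace p ι (k + 1) =>
      fderiv ℝ G (JetSpace.res k.le_succ y) ((Pi.single n 1, 0) + JetSpace.shift n y))
      (z.trunc (k + 1)) := by
  refine ContDiffAt.clm_apply ?_ ?_
  · exact ContDiffAt.comp (z.trunc (k + 1))
      (show ContDiffAt ℝ ∞ (fderiv ℝ G) (JetSpace.res k.le_succ (z.trunc (k + 1))) from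
        hG.smooth_fderiv) (JetSpace.res (p := p) (ι := ι) k.le_succ).contDiff.contDiffAt
  · exact contDiffAt_const.add (JetSpace.shift (p := p) (ι := ι) n).contDiff.contDiffAt

theorem totalDeriv {F : InfJet p ι → ℝ} (hF : CylAt k F z) (n : Fin p) :
    CylAt (k + 1) (totalDeriv n F) z := by
  obtain ⟨G, hG, hFG⟩ := hF
  exact ⟨_, contDiffAt_totalDeriv hG n, totalDeriv_eventually hG hFG n⟩

end CylAt

end Cylinder

/-! ## Prolongations -/

section Prolong

open Topology Filter

variable {p : ℕ} {ι : Type} [Fintype ι]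

/-- The infinite jet of `X` as a function of the coordinates `T`. -/
noncomputable def prolong (T : Fin p → (Fin p → ℝ) → ℝ) (X : ι → (Fin p → ℝ) → ℝ)
    (x : Fin p → ℝ) : InfJet p ι :=
  (fun w => T w x, fun α N => multiPow (nabla T) N (X α) x)

variable {T : Fin p → (Fin p → ℝ) → ℝ} {X : ι → (Fin p → ℝ) → ℝ} {x : Fin p → ℝ}

theorem IsCoordAt.contDiffAt_trunc_prolong (hT : IsCoordAt T x)
    (hX : ∀ α, ContDiffAt ℝ ∞ (X α) x) (k : ℕ) :
    ContDiffAt ℝ ∞ (fun y => (prolong T X y).trunc k) x :=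
  (contDiffAt_pi.2 hT.smooth).prodMk
    (contDiffAt_pi.2 fun α => contDiffAt_pi.2 fun N => hT.contDiffAt_multiPow N.1 (hX α))

theorem CylAt.eventually_prolong {V : Type*} [NormedAddCommGroup V] [NormedSpace ℝ V] {k : ℕ}
    {F : InfJet p ι → V} {G : JetSpace p ι k → V} (hT : IsCoordAt T x)
    (hX : ∀ α, ContDiffAt ℝ ∞ (X α) x)
    (hFG : ∀ᶠ y in 𝓝 ((prolong T X x).trunc k), ∀ z' : InfJet p ι, z'.trunc k = y → F z' = G y) :
    (fun y => F (prolong T X y)) =ᶠ[𝓝 x] fun y => G ((prolong T X y).trunc k) := by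
  filter_upwards [(hT.contDiffAt_trunc_prolong hX k).continuousAt.tendsto.eventually hFG]
    with y hy
  exact hy _ rfl

theorem CylAt.contDiffAt_prolong {V : Type*} [NormedAddCommGroup V] [NormedSpace ℝ V] {k : ℕ}
    {F : InfJet p ι → V} (hF : CylAt k F (prolong T X x)) (hT : IsCoordAt T x)
    (hX : ∀ α, ContDiffAt ℝ ∞ (X α) x) : ContDiffAt ℝ ∞ (fun y => F (prolong T X y)) x := by
  obtain ⟨G, hG, hFG⟩ := hF
  exact (ContDiffAt.comp x hG (hT.contDiffAt_trunc_prolong hX k)).congr_of_eventuallyEq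
    (CylAt.eventually_prolong hT hX hFG)

/-- The derivative of a prolongation with respect to the coordinate `T w`. -/
theorem IsCoordAt.eventually_sum_fderiv_prolong (hT : IsCoordAt T x)
    (hX : ∀ α, ContDiffAt ℝ ∞ (X α) x) (k : ℕ) (w : Fin p) :
    ∀ᶠ y in 𝓝 x, ∑ n, (jacobian T y)⁻¹ n w •
      fderiv ℝ (fun y => (prolong T X y).trunc k) y (Pi.single n 1)
        = ((prolong T X y).totalDir w).trunc k := by
  have h1 : ∀ᶠ y in 𝓝 x, ∀ w, DifferentiableAt ℝ (T w) y :=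
    eventually_all.2 fun w => (hT.smooth w).eventually_differentiableAt
  have h2 : ∀ᶠ y in 𝓝 x, ∀ α, ∀ N : MIdx p k,
      DifferentiableAt ℝ (multiPow (nabla T) N.1 (X α)) y :=
    eventually_all.2 fun α => eventually_all.2 fun N =>
      (hT.contDiffAt_multiPow N.1 (hX α)).eventually_differentiableAt
  have h3 : ∀ᶠ y in 𝓝 x, ∀ α, ∀ N : MIdx p k, multiPow (nabla T) (N.1 + Pi.single w 1) (X α) y
      = nabla T w (multiPow (nabla T) N.1 (X α)) y :=
    eventually_all.2 fun α => eventually_all.2 fun N => (multiPow_nabla_add_single hT N.1 w (hX α)).2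
  filter_upwards [h1, h2, h3, hT.eventually_det_ne] with y hy1 hy2 hy3 hy4
  have hd : HasFDerivAt (fun y => (prolong T X y).trunc k)
      ((ContinuousLinearMap.pi fun w => fderiv ℝ (T w) y).prod (ContinuousLinearMap.pi fun α =>
        ContinuousLinearMap.pi fun N : MIdx p k =>
          fderiv ℝ (multiPow (nabla T) N.1 (X α)) y)) y :=
    (hasFDerivAt_pi.2 fun w => (hy1 w).hasFDerivAt).prodMk
      (hasFDerivAt_pi.2 fun α => hasFDerivAt_pi.2 fun N => (hy2 α N).hasFDerivAt)
  rw [hd.fderiv]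
  -- In the base the claim is ∂T^{w'}/∂T^w = δ; in the fibre, ∇_w raises the multi-index by 1_w.
  refine Prod.ext ?_ ?_
  · funext w'
    have := nabla_coord hy4 w w'
    simp only [nabla, pderivAlong_eq_fderiv _ (hy1 w')] at this
    simpa [Prod.fst_sum, InfJet.trunc, InfJet.totalDir, Pi.single_apply] using this
  · funext α N
    have := hy3 α N
    simp only [nabla, pderivAlong_eq_fderiv _ (hy2 α N)] at this
    simpa [Prod.snd_sum, InfJet.trunc, InfJet.totalDir, prolong] using this.symm

theorem nabla_comp_eq_fderiv {E : Type*} [NormedAddCommGroup E] [NormedSpace ℝ E] {G : E → ℝ}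
    {c : (Fin p → ℝ) → E} (w : Fin p) (hG : DifferentiableAt ℝ G (c x))
    (hc : DifferentiableAt ℝ c x) :
    nabla T w (fun y => G (c y)) x
      = fderiv ℝ G (c x) (∑ n, (jacobian T x)⁻¹ n w • fderiv ℝ c x (Pi.single n 1)) := by
  rw [map_sum]
  refine Finset.sum_congr rfl fun n _ => ?_
  rw [pderivAlong_eq_fderiv n (g := fun y => G (c y)) (hG.comp x hc),
    show (fun y => G (c y)) = G ∘ c from rfl, fderiv_comp x hG hc]
  simp

/-- The chain rule for total derivatives. -/
theorem CylAt.totalDeriv_prolong {k : ℕ} {F : InfJet p ι → ℝ} (hF : CylAt k F (prolong T X x))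
    (hT : IsCoordAt T x) (hX : ∀ α, ContDiffAt ℝ ∞ (X α) x) (w : Fin p) :
    (fun y => _root_.totalDeriv w F (prolong T X y)) =ᶠ[𝓝 x]
      nabla T w fun y => F (prolong T X y) := by
  obtain ⟨G, hG, hFG⟩ := hF
  have h1 := hT.contDiffAt_trunc_prolong hX k
  refine (CylAt.eventually_prolong hT hX (CylAt.totalDeriv_eventually hG hFG w)).trans
    (EventuallyEq.trans ?_ ((CylAt.eventually_prolong hT hX hFG).nabla T w).symm)
  filter_upwards [h1.eventually_differentiableAt, hT.eventually_sum_fderiv_prolong hX k w,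
    h1.continuousAt.tendsto.eventually hG.eventually_differentiableAt] with y hy1 hy2 hy3
  rw [nabla_comp_eq_fderiv w hy3 hy1, hy2, JetSpace.res_trunc, ← JetSpace.shift_trunc]

theorem CylAt.multiPow_totalDeriv_prolong {k : ℕ} {F : InfJet p ι → ℝ}
    (hF : CylAt k F (prolong T X x)) (hT : IsCoordAt T x) (hX : ∀ α, ContDiffAt ℝ ∞ (X α) x)
    (N : Fin p → ℕ) :
    CylAt (k + ∑ n, N n) (multiPow _root_.totalDeriv N F) (prolong T X x) ∧
      (fun y => multiPow _root_.totalDeriv N F (prolong T X y)) =ᶠ[𝓝 x]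
        multiPow (nabla T) N fun y => F (prolong T X y) := by
  refine multiPow_simulation _root_.totalDeriv (nabla T) (fun k F g =>
    CylAt k F (prolong T X x) ∧ (fun y => F (prolong T X y)) =ᶠ[𝓝 x] g) ?_ N ⟨hF, EventuallyEq.rfl⟩
  rintro k n F g ⟨hF, hFg⟩
  exact ⟨hF.totalDeriv n, (hF.totalDeriv_prolong hT hX n).trans (hFg.nabla T n)⟩

theorem jetPartial_eq_fderiv [DecidableEq ι] {k : ℕ} {F : JetSpace p ι k → ℝ}
    {y : JetSpace p ι k} (hF : DifferentiableAt ℝ F y) (α : ι) (N : MIdx p k) :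
    jetPartial α N F y = fderiv ℝ F y (0, Pi.single α (Pi.single N 1)) :=
  hF.lineDeriv_eq_fderiv

theorem ContDiffAt.jetPartial [DecidableEq ι] {k : ℕ} {F : JetSpace p ι k → ℝ}
    {y : JetSpace p ι k} (hF : ContDiffAt ℝ ∞ F y) (α : ι) (N : MIdx p k) :
    ContDiffAt ℝ ∞ (jetPartial α N F) y := by
  refine (hF.smooth_fderiv.clm_apply
    (contDiffAt_const (c := (0, Pi.single α (Pi.single N 1))))).congr_of_eventuallyEq ?_
  filter_upwards [hF.eventually_differentiableAt] with y' hy'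
  exact jetPartial_eq_fderiv hy' α N

/-- The Euler–Lagrange expressions along a prolongation. -/
theorem eulerLagrange_prolong [DecidableEq ι] {r : ℕ} {F : JetSpace p ι r → ℝ}
    (hT : IsCoordAt T x) (hX : ∀ α, ContDiffAt ℝ ∞ (X α) x)
    (hF : ContDiffAt ℝ ∞ F ((prolong T X x).trunc r)) (α : ι) :
    eulerLagrange F ((prolong T X x).trunc (2 * r)) α
      = ∑ N : MIdx p r, (-1 : ℝ) ^ (∑ n, N.1 n) *
          multiPow (nabla T) N.1 (fun y => jetPartial α N F ((prolong T X y).trunc r)) x := by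
  refine Finset.sum_congr rfl fun N _ => ?_
  congr 1
  obtain ⟨h1, h2⟩ := CylAt.multiPow_totalDeriv_prolong
    (CylAt.comp_trunc (hF.jetPartial α N)) hT hX N.1
  -- D_N of a function of order r has order r + |N| ≤ 2r, hence does not see the zeros inserted by
  -- `toInf` above order 2r.
  have hle : r + ∑ n, N.1 n ≤ 2 * r := by have := N.2; omega
  rw [← h2.eq_of_nhds]
  exact (h1.apply_eq (InfJet.toInf_trunc hle _).symm).symm

theorem ContDiffAt.jetPartial_prolong [DecidableEq ι] {r : ℕ} {F : JetSpace p ι r → ℝ}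
    (hT : IsCoordAt T x) (hX : ∀ α, ContDiffAt ℝ ∞ (X α) x)
    (hF : ContDiffAt ℝ ∞ F ((prolong T X x).trunc r)) (α : ι) (N : MIdx p r) :
    ContDiffAt ℝ ∞ (fun y => _root_.jetPartial α N F ((prolong T X y).trunc r)) x :=
  ContDiffAt.comp (g := _root_.jetPartial α N F) x (hF.jetPartial α N)
    (hT.contDiffAt_trunc_prolong hX r)

end Prolong

/-! ## Coordinates of contact elements as functions of velocity coordinates -/

section ContactCoordinates

open Topology Filter

variable {p q : ℕ}

/-- The prolongation with respect to the standard coordinates of `ℝᵖ`, translated by `b`. -/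
noncomputable def velProlong {ι : Type} (b : Fin p → ℝ) (s : ι → (Fin p → ℝ) → ℝ)
    (x : Fin p → ℝ) : InfJet p ι :=
  prolong (fun w y => b w + y w) s x

theorem velProlong_snd {ι : Type} (b : Fin p → ℝ) (s : ι → (Fin p → ℝ) → ℝ) (x : Fin p → ℝ)
    (α : ι) (N : Fin p → ℕ) : (velProlong b s x).2 α N = multiDeriv N (s α) x := by
  rw [multiDeriv_eq_multiPow_nabla b]; rfl

/-- The matrix `U = (u^w_n)`. -/
def jetU (z : InfJet p (Fin p ⊕ Fin q)) : Matrix (Fin p) (Fin p) ℝ :=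
  Matrix.of fun w n => z.2 (Sum.inl w) (Pi.single n 1)

/-- The total derivative with respect to the function `t^w`. -/
noncomputable def jetNabla (w : Fin p) (F : InfJet p (Fin p ⊕ Fin q) → ℝ) :
    InfJet p (Fin p ⊕ Fin q) → ℝ :=
  fun z => ∑ n, (jetU z)⁻¹ n w * totalDeriv n F z

/-- The coordinates `v^i_N` of a contact element as functions of the velocity coordinates. -/
noncomputable def contactCoord (i : Fin q) (N : Fin p → ℕ) : InfJet p (Fin p ⊕ Fin q) → ℝ :=
  multiPow jetNabla N fun z => z.2 (Sum.inr i) 0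

variable {s : Fin p ⊕ Fin q → (Fin p → ℝ) → ℝ} {x b : Fin p → ℝ} {k : ℕ}

theorem multiDeriv_single (n : Fin p) {g : (Fin p → ℝ) → ℝ} (hg : ContDiffAt ℝ ∞ g x) :
    multiDeriv (Pi.single n 1) g x = pderivAlong n g x := by
  have h := (multiDeriv_add_single 0 n hg).1.eq_of_nhds
  rwa [zero_add, multiDeriv, multiDeriv, multiPow_zero] at h

theorem jetU_velProlong (hs : ∀ w, ContDiffAt ℝ ∞ (s (Sum.inl w)) x) :
    jetU (velProlong b s x) = jacobian (fun w => s (Sum.inl w)) x := by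
  ext w n
  simp only [jetU, Matrix.of_apply, velProlong_snd]
  exact multiDeriv_single n (hs w)

theorem cylAt_jetU {z : InfJet p (Fin p ⊕ Fin q)} (hk : 1 ≤ k) (w n : Fin p) :
    CylAt k (fun z : InfJet p (Fin p ⊕ Fin q) => jetU z w n) z :=
  CylAt.coord (Sum.inl w) (Pi.single n 1) (by simpa using hk)

theorem CylAt.jetNabla {F : InfJet p (Fin p ⊕ Fin q) → ℝ} {z : InfJet p (Fin p ⊕ Fin q)}
    (hF : CylAt k F z) (hz : (jetU z).det ≠ 0) (w : Fin p) : CylAt (k + 1) (jetNabla w F) z :=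
  CylAt.sum fun n => (CylAt.matrix_inv (cylAt_jetU (Nat.le_add_left 1 k)) hz n w).mul
    (hF.totalDeriv n)

/-- Each `jetNabla` raises the order by one only: its coefficients have order 1, which is within the
new bound. -/
theorem cylAt_contactCoord {z : InfJet p (Fin p ⊕ Fin q)} (hz : (jetU z).det ≠ 0) (i : Fin q)
    (N : Fin p → ℕ) : CylAt (∑ n, N n) (contactCoord i N) z := by
  have := multiPow_simulation jetNabla jetNabla (fun k F _ => CylAt k F z)
    (fun k n F _ hF => hF.jetNabla hz n) N (k := 0)
    (g := fun z : InfJet p (Fin p ⊕ Fin q) => z.2 (Sum.inr i) 0)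
    (h := fun z : InfJet p (Fin p ⊕ Fin q) => z.2 (Sum.inr i) 0)
    (CylAt.coord (Sum.inr i) 0 (by simp))
  rwa [zero_add] at this

theorem CylAt.jetNabla_velProlong {F : InfJet p (Fin p ⊕ Fin q) → ℝ}
    (hs : ∀ α, ContDiffAt ℝ ∞ (s α) x) (hF : CylAt k F (velProlong b s x)) (w : Fin p) :
    (fun y => _root_.jetNabla w F (velProlong b s y)) =ᶠ[𝓝 x]
      nabla (fun w => s (Sum.inl w)) w fun y => F (velProlong b s y) := by
  have h1 : ∀ᶠ y in 𝓝 x, ∀ n, _root_.totalDeriv n F (velProlong b s y)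
      = pderivAlong n (fun y => F (velProlong b s y)) y := by
    refine eventually_all.2 fun n => ?_
    have := hF.totalDeriv_prolong (isCoordAt_translate b x) hs n
    rwa [nabla_translate] at this
  have h2 : ∀ᶠ y in 𝓝 x, ∀ w n, multiDeriv (Pi.single n 1) (s (Sum.inl w)) y
      = pderivAlong n (s (Sum.inl w)) y := by
    refine eventually_all.2 fun w => eventually_all.2 fun n => ?_
    have h := (multiDeriv_add_single 0 n (hs (Sum.inl w))).1
    rwa [zero_add, show multiDeriv 0 (pderivAlong n (s (Sum.inl w)))
      = pderivAlong n (s (Sum.inl w)) from multiPow_zero _ _] at h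
  filter_upwards [h1, h2] with y hy1 hy2
  have hU : jetU (velProlong b s y) = jacobian (fun w => s (Sum.inl w)) y := by
    ext w n
    simp only [jetU, Matrix.of_apply, velProlong_snd, hy2]
    rfl
  simp only [_root_.jetNabla, nabla, hy1, hU]

theorem contactCoord_velProlong (hs : ∀ α, ContDiffAt ℝ ∞ (s α) x)
    (hdet : (jacobian (fun w => s (Sum.inl w)) x).det ≠ 0) (i : Fin q) (N : Fin p → ℕ) :
    (fun y => contactCoord i N (velProlong b s y)) =ᶠ[𝓝 x]
      multiPow (nabla fun w => s (Sum.inl w)) N (s (Sum.inr i)) := by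
  have hz : (jetU (velProlong b s x)).det ≠ 0 := by
    rwa [jetU_velProlong fun w => hs (Sum.inl w)]
  refine (multiPow_simulation jetNabla (nabla fun w => s (Sum.inl w)) (fun k F g =>
    CylAt k F (velProlong b s x) ∧ (fun y => F (velProlong b s y)) =ᶠ[𝓝 x] g) ?_ N (k := 0)
    ⟨CylAt.coord (Sum.inr i) 0 (by simp), ?_⟩).2
  · rintro k n F g ⟨hF, hFg⟩
    exact ⟨hF.jetNabla hz n, (hF.jetNabla_velProlong hs n).trans (hFg.nabla _ n)⟩
  · refine Eventually.of_forall fun y => ?_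
    simp only [velProlong_snd]
    exact congrFun (multiPow_zero pderivAlong (s (Sum.inr i))) y

/-- The jet of order `k` in `J^k(ℝᵖ, ℝ^q)` of the contact element of a velocity. -/
noncomputable def contactJet (k : ℕ) (z : InfJet p (Fin p ⊕ Fin q)) : JetSpace p (Fin q) k :=
  (fun w => z.2 (Sum.inl w) 0, fun i N => contactCoord i N.1 z)

/-- The parameter τ does not enter contact coordinates. This is needed because coordinates of
velocities are always completed by the parameter value 0. -/
theorem contactJet_congr {z z' : InfJet p (Fin p ⊕ Fin q)} (h : z.2 = z'.2) :
    contactJet k z = contactJet k z' := by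
  have key : ∀ (i : Fin q) (N : Fin p → ℕ) (z z' : InfJet p (Fin p ⊕ Fin q)), z.2 = z'.2 →
      contactCoord i N z = contactCoord i N z' := by
    intro i N
    refine multiPow_simulation' jetNabla jetNabla
      (fun F _ => ∀ z z' : InfJet p (Fin p ⊕ Fin q), z.2 = z'.2 → F z = F z') ?_ N
      (h := fun z : InfJet p (Fin p ⊕ Fin q) => z.2 (Sum.inr i) 0) ?_
    · intro n F _ hF z z' h
      have hU : jetU z = jetU z' := by simp only [jetU, h]
      -- The two lines have the same fibre component at each time, and F ignores the base.
      have hD : ∀ m, totalDeriv m F z = totalDeriv m F z' := fun m => by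
        unfold totalDeriv lineDeriv
        refine congrArg (fun f : ℝ → ℝ => deriv f 0) (funext fun t => hF _ _ ?_)
        simp only [Prod.snd_add, Prod.smul_snd, h]
      simp only [jetNabla, hU, hD]
    · intro z z' h
      rw [h]
  refine Prod.ext ?_ ?_
  · simp only [contactJet, h]
  · funext i N
    exact key i N.1 z z' h

theorem cylAt_contactJet {z : InfJet p (Fin p ⊕ Fin q)} (hz : (jetU z).det ≠ 0) :
    CylAt k (contactJet k) z :=
  (CylAt.pi fun w => CylAt.coord (Sum.inl w) 0 (by simp)).prodMk <|
    CylAt.pi fun i => CylAt.pi fun N => (cylAt_contactCoord hz i N.1).mono N.2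

/-- The curve in coordinates of contact elements defined by a parametrized submanifold is the
prolongation of its `x`-components with respect to its `t`-components. -/
theorem contactJet_velProlong (hs : ∀ α, ContDiffAt ℝ ∞ (s α) x)
    (hdet : (jacobian (fun w => s (Sum.inl w)) x).det ≠ 0) :
    (fun y => contactJet k (velProlong b s y)) =ᶠ[𝓝 x] fun y =>
      (prolong (fun w => s (Sum.inl w)) (fun i => s (Sum.inr i)) y).trunc k := by
  have h : ∀ᶠ y in 𝓝 x, ∀ i, ∀ N : MIdx p k, contactCoord i N.1 (velProlong b s y)
      = multiPow (nabla fun w => s (Sum.inl w)) N.1 (s (Sum.inr i)) y :=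
    eventually_all.2 fun i => eventually_all.2 fun N => contactCoord_velProlong hs hdet i N.1
  filter_upwards [h] with y hy
  refine Prod.ext ?_ ?_
  · funext w
    simp only [contactJet, velProlong_snd]
    exact congrFun (multiPow_zero pderivAlong (s (Sum.inl w))) y
  · funext i N
    exact hy i N

/-! ## Taylor polynomials -/

/-- The normalized monomial `∏ τₙ ^ Mₙ / Mₙ!`. -/
noncomputable def taylorMonomial (M : Fin p → ℕ) (y : Fin p → ℝ) : ℝ :=
  ∏ n, y n ^ M n / (M n).factorial

theorem contDiff_taylorMonomial (M : Fin p → ℕ) : ContDiff ℝ ∞ (taylorMonomial M) :=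
  contDiff_prod fun n _ => ((contDiff_apply ℝ ℝ n).pow _).div_const _

theorem pderivAlong_taylorMonomial (M : Fin p → ℕ) (n : Fin p) :
    pderivAlong n (taylorMonomial (M + Pi.single n 1)) = taylorMonomial M := by
  funext y
  have hd : HasDerivAt (fun t : ℝ => taylorMonomial (M + Pi.single n 1) (y + t • Pi.single n 1))
      (taylorMonomial M y) 0 := by
    have e : ∀ t : ℝ, taylorMonomial (M + Pi.single n 1) (y + t • Pi.single n 1)
        = (∏ m ∈ Finset.univ.erase n, y m ^ M m / (M m).factorial) *
          ((y n + t) ^ (M n + 1) / (M n + 1).factorial) := by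
      intro t
      rw [taylorMonomial, ← Finset.prod_erase_mul _ _ (Finset.mem_univ n)]
      congr 1
      · refine Finset.prod_congr rfl fun m hm => ?_
        simp [Finset.ne_of_mem_erase hm]
      · simp
    have e' : taylorMonomial M y = (∏ m ∈ Finset.univ.erase n, y m ^ M m / (M m).factorial) *
        (y n ^ M n / (M n).factorial) := by
      rw [taylorMonomial, ← Finset.prod_erase_mul _ _ (Finset.mem_univ n)]
    rw [e']
    simp only [e]
    refine HasDerivAt.const_mul _ ?_
    have h1 : HasDerivAt (fun t : ℝ => (y n + t) ^ (M n + 1))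
        (((M n + 1 : ℕ) : ℝ) * (y n + 0) ^ (M n + 1 - 1) * 1) 0 :=
      ((hasDerivAt_id (0 : ℝ)).const_add (y n)).pow (M n + 1)
    convert h1.div_const ((M n + 1).factorial : ℝ) using 1
    rw [Nat.factorial_succ]
    push_cast
    have : ((M n).factorial : ℝ) ≠ 0 := by positivity
    have : ((M n : ℝ) + 1) ≠ 0 := by positivity
    simp only [add_zero]
    field_simp
  exact hd.deriv

theorem pderivAlong_taylorMonomial_of_eq_zero (M : Fin p → ℕ) {n : Fin p} (hn : M n = 0) :
    pderivAlong n (taylorMonomial M) = fun _ => 0 := by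
  funext y
  have e : ∀ t : ℝ, taylorMonomial M (y + t • Pi.single n 1) = taylorMonomial M y := by
    intro t
    refine Finset.prod_congr rfl fun m _ => ?_
    by_cases hm : m = n
    · subst hm; simp [hn]
    · simp [hm]
  simp [pderivAlong, lineDeriv, e]

/-- A partial derivative lowers one exponent of the monomial, or kills it if that exponent is 0; M
therefore varies in the induction. -/
theorem multiDeriv_taylorMonomial (N M : Fin p → ℕ) :
    multiDeriv N (taylorMonomial M) 0 = if N = M then 1 else 0 := by
  induction N using multiIndex_induction generalizing M with
  | h0 =>
    rw [show multiDeriv 0 (taylorMonomial M) = taylorMonomial M from multiPow_zero _ _]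
    by_cases h : (0 : Fin p → ℕ) = M
    · subst h; simp [taylorMonomial]
    · rw [if_neg h]
      obtain ⟨n, hn⟩ : ∃ n, M n ≠ 0 := by
        by_contra! h'
        exact h (funext fun n => (h' n).symm)
      exact Finset.prod_eq_zero (Finset.mem_univ n) (by simp [hn])
  | hs N n ih =>
    rw [(multiDeriv_add_single N n (contDiff_taylorMonomial M).contDiffAt).1.eq_of_nhds]
    by_cases h : M n = 0
    · have hne : N + Pi.single n 1 ≠ M := by
        rintro rfl
        simp at h
      rw [pderivAlong_taylorMonomial_of_eq_zero M h, multiDeriv_const, if_neg hne, ite_self]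
    · obtain ⟨M', rfl⟩ : ∃ M' : Fin p → ℕ, M = M' + Pi.single n 1 := by
        refine ⟨fun m => M m - (Pi.single n 1 : Fin p → ℕ) m, ?_⟩
        funext m
        by_cases hm : m = n
        · subst hm; simp; omega
        · simp [hm]
      rw [pderivAlong_taylorMonomial, ih]
      simp

/-- A polynomial with prescribed partial derivatives at `0`. -/
theorem exists_contDiff_multiDeriv_eq (c : MIdx p k → ℝ) :
    ∃ g : (Fin p → ℝ) → ℝ, ContDiff ℝ ∞ g ∧ ∀ N : MIdx p k, multiDeriv N.1 g 0 = c N := by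
  refine ⟨fun y => ∑ M, c M * taylorMonomial M.1 y,
    ContDiff.sum fun M _ => contDiff_const.mul (contDiff_taylorMonomial M.1), fun N => ?_⟩
  have h : ∀ M : MIdx p k, ContDiffAt ℝ ∞ (taylorMonomial M.1) 0 := fun M =>
    (contDiff_taylorMonomial M.1).contDiffAt
  rw [(multiDeriv_sum Finset.univ N.1 fun M _ => contDiffAt_const.mul (h M)).eq_of_nhds]
  have e : ∀ M : MIdx p k, multiDeriv N.1 (fun y => c M * taylorMonomial M.1 y) 0
      = if M = N then c N else 0 := by
    intro M
    rw [(multiDeriv_const_mul N.1 (c M) (h M)).eq_of_nhds, multiDeriv_taylorMonomial]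
    by_cases hM : M = N
    · simp [hM]
    · rw [if_neg hM, if_neg fun h => hM (Subtype.ext h.symm), mul_zero]
  simp only [e]
  simp

end ContactCoordinates

/-! ## Velocities and contact elements in coordinates -/

/-! ### Jacobian matrices and injectivity of the derivative. -/

section Jacobian

open Topology Filter

variable {p : ℕ} {T : Fin p → (Fin p → ℝ) → ℝ} {x : Fin p → ℝ}

theorem jacobian_mulVec (hT : ∀ w, DifferentiableAt ℝ (T w) x) (v : Fin p → ℝ) (w : Fin p) :
    (jacobian T x).mulVec v w = fderiv ℝ (T w) x v := by
  have := map_eq_sum_single (fderiv ℝ (T w) x).toLinearMap v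
  rw [ContinuousLinearMap.coe_coe] at this
  rw [this]
  simp only [Matrix.mulVec, dotProduct]
  refine Finset.sum_congr rfl fun n _ => ?_
  simp [jacobian, pderivAlong_eq_fderiv n (hT w), mul_comm]

theorem jacobian_comp {f : (Fin p → ℝ) → Fin p → ℝ} (hT : ∀ w, DifferentiableAt ℝ (T w) (f x))
    (hf : DifferentiableAt ℝ f x) :
    jacobian (fun w y => T w (f y)) x = jacobian T (f x) * jacobian (fun m y => f y m) x := by
  ext w n
  rw [Matrix.mul_apply]
  exact pderivAlong_comp n (hT w) hf

theorem jacobian_det_ne_zero_of_injective {f : (Fin p → ℝ) → Fin p → ℝ}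
    (hf : DifferentiableAt ℝ f x) (hinj : Function.Injective (fderiv ℝ f x)) :
    (jacobian (fun m y => f y m) x).det ≠ 0 := by
  have hfm : ∀ m, DifferentiableAt ℝ (fun y => f y m) x := differentiableAt_pi.1 hf
  have h : Function.Injective (jacobian (fun m y => f y m) x).mulVec := by
    intro v v' hv
    apply hinj
    funext m
    have := congrFun hv m
    rw [jacobian_mulVec hfm, jacobian_mulVec hfm] at this
    rwa [fderiv_pi hfm]
  exact ((Matrix.isUnit_iff_isUnit_det _).1 (Matrix.mulVec_injective_iff_isUnit.1 h)).ne_zero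

theorem fderiv_injective_of_jacobian {f : (Fin p → ℝ) → Fin p → ℝ}
    (hf : DifferentiableAt ℝ f x) (hdet : (jacobian (fun m y => f y m) x).det ≠ 0) :
    Function.Injective (fderiv ℝ f x) := by
  have hfm : ∀ m, DifferentiableAt ℝ (fun y => f y m) x := differentiableAt_pi.1 hf
  intro v v' hv
  refine Matrix.mulVec_injective_of_isUnit
    ((Matrix.isUnit_iff_isUnit_det _).2 hdet.isUnit) ?_
  funext m
  rw [jacobian_mulVec hfm, jacobian_mulVec hfm]
  rw [fderiv_pi hfm] at hv
  exact congrFun hv m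

end Jacobian

/-! ### The maps φ_C and ℘_φ in velocity coordinates. -/

section Velocities

open Topology Filter

variable {p q k : ℕ} {M : Type*} [TopologicalSpace M] [ChartedSpace (ModelPQ p q) M]
  {φ : OpenPartialHomeomorph M (ModelPQ p q)}

/-- The components of a parametrized submanifold in a chart. -/
def chartComp (φ : OpenPartialHomeomorph M (ModelPQ p q)) (σ : (Fin p → ℝ) → M)
    (α : Fin p ⊕ Fin q) (τ : Fin p → ℝ) : ℝ :=
  φ (σ τ) α

theorem contMDiffAt_chart (hφ : φ ∈ IsManifold.maximalAtlas 𝓘(ℝ, ModelPQ p q) ∞ M) {m : M}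
    (hm : m ∈ φ.source) : ContMDiffAt 𝓘(ℝ, ModelPQ p q) 𝓘(ℝ, ModelPQ p q) ∞ φ m :=
  (contMDiffOn_of_mem_maximalAtlas hφ).contMDiffAt (φ.open_source.mem_nhds hm)

theorem contMDiffAt_chart_apply (hφ : φ ∈ IsManifold.maximalAtlas 𝓘(ℝ, ModelPQ p q) ∞ M) {m : M}
    (hm : m ∈ φ.source) (α : Fin p ⊕ Fin q) :
    ContMDiffAt 𝓘(ℝ, ModelPQ p q) 𝓘(ℝ, ℝ) ∞ (fun m => φ m α) m :=
  ((contDiff_apply ℝ ℝ α).contMDiff.contMDiffAt).comp m (contMDiffAt_chart hφ hm)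

theorem contDiffAt_chartComp (hφ : φ ∈ IsManifold.maximalAtlas 𝓘(ℝ, ModelPQ p q) ∞ M)
    {σ : (Fin p → ℝ) → M} {x : Fin p → ℝ}
    (hσ : ContMDiffAt 𝓘(ℝ, Fin p → ℝ) 𝓘(ℝ, ModelPQ p q) ∞ σ x) (hx : σ x ∈ φ.source)
    (α : Fin p ⊕ Fin q) : ContDiffAt ℝ ∞ (chartComp φ σ α) x :=
  ((contMDiffAt_chart_apply hφ hx α).comp x hσ).contDiffAt

/-- `Velocity.coord` is computed from a chosen representative. Chart components are among the test
functions of `velocitySetoid`, so the choice is immaterial. -/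
theorem coord_velocityMk (hφ : φ ∈ IsManifold.maximalAtlas 𝓘(ℝ, ModelPQ p q) ∞ M)
    (σ : GermRep p q M) (hσ : σ.1 0 ∈ φ.source) (α : Fin p ⊕ Fin q) (N : MIdx p k) :
    (velocityMk k σ).coord φ α N = multiDeriv N.1 (chartComp φ σ.1 α) 0 := by
  have h := Quotient.exact (s := velocitySetoid p q M k)
    (Quotient.out_eq (s := velocitySetoid p q M k) (velocityMk k σ))
  refine h.2 (fun m => φ m α) ?_ N
  rw [h.1]
  exact contMDiffAt_chart_apply hφ hσ α

/-- The coordinates of a velocity, completed by zeros. -/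
noncomputable def Velocity.infCoord (φ : OpenPartialHomeomorph M (ModelPQ p q))
    (ξ : Velocity p q M k) : InfJet p (Fin p ⊕ Fin q) :=
  JetSpace.toInf (k := k) (0, ξ.coord φ)

theorem trunc_infCoord (ξ : Velocity p q M k) : (ξ.infCoord φ).trunc k = (0, ξ.coord φ) :=
  InfJet.trunc_toInf _

theorem trunc_velProlong (hφ : φ ∈ IsManifold.maximalAtlas 𝓘(ℝ, ModelPQ p q) ∞ M)
    (σ : GermRep p q M) (hσ : σ.1 0 ∈ φ.source) :
    (velProlong 0 (chartComp φ σ.1) 0).trunc k = ((velocityMk k σ).infCoord φ).trunc k := by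
  rw [trunc_infCoord]
  refine Prod.ext (funext fun w => zero_add _) ?_
  funext α N
  exact (velProlong_snd _ _ _ _ _).trans (coord_velocityMk hφ σ hσ α N).symm

theorem jetU_congr (hk : 1 ≤ k) {z z' : InfJet p (Fin p ⊕ Fin q)}
    (h : z.trunc k = z'.trunc k) : jetU z = jetU z' := by
  ext w n
  exact congrFun (congrFun (congrArg Prod.snd h) (Sum.inl w)) (MIdx.one hk n)

theorem detU_eq (hk : 1 ≤ k) (ξ : Velocity p q M k) :
    ξ.detU hk φ = (jetU (ξ.infCoord φ)).det := by
  have h := trunc_infCoord (φ := φ) ξ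
  refine congrArg Matrix.det (Matrix.ext fun w n => ?_)
  exact (congrFun (congrFun (congrArg Prod.snd h) (Sum.inl w)) (MIdx.one hk n)).symm

theorem jetU_velocityMk (hk : 1 ≤ k) (hφ : φ ∈ IsManifold.maximalAtlas 𝓘(ℝ, ModelPQ p q) ∞ M)
    (σ : GermRep p q M) (hσ : σ.1 0 ∈ φ.source) :
    jetU ((velocityMk k σ).infCoord φ) = jacobian (fun w => chartComp φ σ.1 (Sum.inl w)) 0 := by
  rw [← jetU_congr hk (trunc_velProlong hφ σ hσ),
    jetU_velProlong fun w => contDiffAt_chartComp hφ σ.2 hσ _]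

theorem contactJet_velocityMk (hk : 1 ≤ k)
    (hφ : φ ∈ IsManifold.maximalAtlas 𝓘(ℝ, ModelPQ p q) ∞ M)
    (σ : GermRep p q M) (hσ : σ.1 0 ∈ φ.source)
    (hdet : (jacobian (fun w => chartComp φ σ.1 (Sum.inl w)) 0).det ≠ 0) :
    contactJet k ((velocityMk k σ).infCoord φ) =
      (prolong (fun w => chartComp φ σ.1 (Sum.inl w)) (fun i => chartComp φ σ.1 (Sum.inr i))
        0).trunc k := by
  have hs := contDiffAt_chartComp hφ σ.2 hσ
  rw [← (contactJet_velProlong (b := 0) hs hdet).eq_of_nhds]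
  refine (cylAt_contactJet ?_).apply_eq (trunc_velProlong hφ σ hσ).symm
  rwa [jetU_velocityMk hk hφ σ hσ]

/-- The t-components alone already have injective derivative, and their derivatives factor through
that of σ. -/
theorem isRegular_velocityMk (hφ : φ ∈ IsManifold.maximalAtlas 𝓘(ℝ, ModelPQ p q) ∞ M)
    (σ : GermRep p q M) (hσ : σ.1 0 ∈ φ.source)
    (hdet : (jacobian (fun w => chartComp φ σ.1 (Sum.inl w)) 0).det ≠ 0) :
    (velocityMk k σ).IsRegular := by
  refine ⟨σ, rfl, ?_⟩
  have hd : ∀ w, DifferentiableAt ℝ (chartComp φ σ.1 (Sum.inl w)) 0 := fun w =>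
    (contDiffAt_chartComp hφ σ.2 hσ _).smooth_differentiableAt
  have key : ∀ v v' : Fin p → ℝ, (∀ w, fderiv ℝ (chartComp φ σ.1 (Sum.inl w)) 0 v
      = fderiv ℝ (chartComp φ σ.1 (Sum.inl w)) 0 v') → v = v' := by
    intro v v' hv
    refine Matrix.mulVec_injective_of_isUnit
      ((Matrix.isUnit_iff_isUnit_det _).2 hdet.isUnit) ?_
    funext w
    rw [jacobian_mulVec hd, jacobian_mulVec hd, hv]
  intro v v' hv
  refine key v v' fun w => ?_
  have hc : mfderiv 𝓘(ℝ, Fin p → ℝ) 𝓘(ℝ, ℝ) (chartComp φ σ.1 (Sum.inl w)) 0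
      = (mfderiv 𝓘(ℝ, ModelPQ p q) 𝓘(ℝ, ℝ) (fun m => φ m (Sum.inl w)) (σ.1 0)).comp
        (mfderiv 𝓘(ℝ, Fin p → ℝ) 𝓘(ℝ, ModelPQ p q) σ.1 0) :=
    mfderiv_comp (0 : Fin p → ℝ) (g := fun m => φ m (Sum.inl w))
      ((contMDiffAt_chart_apply hφ hσ _).mdifferentiableAt (by simp))
      (σ.2.mdifferentiableAt (by simp))
  have h := congrArg (mfderiv 𝓘(ℝ, ModelPQ p q) 𝓘(ℝ, ℝ) (fun m => φ m (Sum.inl w)) (σ.1 0)) hv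
  rw [← mfderiv_eq_fderiv, hc]
  exact h

open Classical in
/-- The coordinates in `J^k(ℝᵖ, ℝ^q)` as an invariant of velocities. -/
noncomputable def contactInv (hk : 1 ≤ k) (φ : OpenPartialHomeomorph M (ModelPQ p q))
    (ξ : Velocity p q M k) : JetSpace p (Fin q) k :=
  if ξ.base ∈ φ.source ∧ ξ.detU hk φ ≠ 0 then contactJet k (ξ.infCoord φ) else 0

/-- A reparametrization f with f 0 = 0 multiplies det U by the nonzero det Df(0), so both velocities
fall in the same case of the definition. In the main case the values agree because iterated `nabla`
commutes with composition by f. -/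
theorem contactInv_eq_of_sameOrbit (hk : 1 ≤ k)
    (hφ : φ ∈ IsManifold.maximalAtlas 𝓘(ℝ, ModelPQ p q) ∞ M) {ξ ξ' : RegularVelocity p q M k}
    (h : SameOrbit ξ ξ') : contactInv hk φ ξ.1 = contactInv hk φ ξ'.1 := by
  obtain ⟨σ, σ', f, hf, hf0, hbij, hσσ', hξ, hξ'⟩ := h
  have h0 : σ'.1 0 = σ.1 0 := by rw [hσσ', hf0]
  rw [← hξ, ← hξ']
  by_cases hσ : σ.1 0 ∈ φ.source
  swap
  · have hσ' : σ'.1 0 ∉ φ.source := by rwa [h0]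
    rw [contactInv, contactInv, if_neg fun h => hσ h.1, if_neg fun h => hσ' h.1]
  have hσ' : σ'.1 0 ∈ φ.source := by rwa [h0]
  have hs := contDiffAt_chartComp hφ σ.2 hσ
  have hcomp : ∀ α, chartComp φ σ'.1 α = fun y => chartComp φ σ.1 α (f y) := fun α => by
    funext y; simp only [chartComp, hσσ']
  have hJ := jacobian_det_ne_zero_of_injective hf.smooth_differentiableAt hbij.1
  have hdet' : (jacobian (fun w => chartComp φ σ'.1 (Sum.inl w)) 0).det
      = (jacobian (fun w => chartComp φ σ.1 (Sum.inl w)) 0).det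
        * (jacobian (fun m y => f y m) 0).det := by
    simp only [hcomp]
    rw [jacobian_comp (T := fun w => chartComp φ σ.1 (Sum.inl w))
      (fun w => by rw [hf0]; exact (hs _).smooth_differentiableAt) hf.smooth_differentiableAt,
      Matrix.det_mul, hf0]
  have hU := detU_eq (φ := φ) hk (velocityMk k σ)
  have hU' := detU_eq (φ := φ) hk (velocityMk k σ')
  rw [jetU_velocityMk hk hφ σ hσ] at hU
  rw [jetU_velocityMk hk hφ σ' hσ'] at hU'
  by_cases hdet : (jacobian (fun w => chartComp φ σ.1 (Sum.inl w)) 0).det = 0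
  · rw [contactInv, contactInv, if_neg fun h => h.2 (hU.trans hdet),
      if_neg fun h => h.2 (hU'.trans (by rw [hdet', hdet, zero_mul]))]
  have hd' : (jacobian (fun w => chartComp φ σ'.1 (Sum.inl w)) 0).det ≠ 0 := by
    rw [hdet']
    exact mul_ne_zero hdet hJ
  rw [contactInv, contactInv, if_pos ⟨hσ, hU ▸ hdet⟩, if_pos ⟨hσ', hU' ▸ hd'⟩,
    contactJet_velocityMk hk hφ σ hσ hdet,
    contactJet_velocityMk hk hφ σ' hσ' hd']
  refine Prod.ext ?_ ?_
  · funext w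
    exact congrArg (fun m => φ m (Sum.inl w)) h0.symm
  · funext i N
    have hT : IsCoordAt (fun w => chartComp φ σ.1 (Sum.inl w)) (f 0) := by
      rw [hf0]; exact ⟨fun w => hs _, hdet⟩
    simp only [hcomp] at hd'
    have := (multiPow_nabla_comp hT hf hd' N.1
      (g := chartComp φ σ.1 (Sum.inr i)) (by rw [hf0]; exact hs _)).eq_of_nhds
    rw [hf0] at this
    simp only [prolong, InfJet.trunc, hcomp]
    exact this.symm

/-- The representative itself need not be a graph, but its k-jet is that of y ↦ (c + y, x(y)). The
invariant depends on the k-jet only, and for this map `nabla` is the ordinary partial derivative. -/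
theorem contactInv_of_isNormalized (hk : 1 ≤ k)
    (hφ : φ ∈ IsManifold.maximalAtlas 𝓘(ℝ, ModelPQ p q) ∞ M) {ξ : Velocity p q M k}
    (h : ξ.IsNormalized φ) :
    contactInv hk φ ξ = (fun w => ξ.coord φ (Sum.inl w) (MIdx.zero p k),
      fun i N => ξ.coord φ (Sum.inr i) N) := by
  obtain ⟨hb, hn⟩ := h
  obtain ⟨σ, rfl⟩ : ∃ σ, velocityMk k σ = ξ := Quotient.exists_rep ξ
  have hσ : σ.1 0 ∈ φ.source := hb
  have hs := contDiffAt_chartComp hφ σ.2 hσ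
  set c : Fin p → ℝ := fun w => chartComp φ σ.1 (Sum.inl w) 0
  set s : Fin p ⊕ Fin q → (Fin p → ℝ) → ℝ :=
    Sum.elim (fun w y => c w + y w) (fun i => chartComp φ σ.1 (Sum.inr i)) with hsdef
  have hs' : ∀ α, ContDiffAt ℝ ∞ (s α) 0 := by
    rintro (w | i)
    · exact (isCoordAt_translate c 0).smooth w
    · exact hs _
  have htr : (velProlong 0 s 0).trunc k = ((velocityMk k σ).infCoord φ).trunc k := by
    rw [trunc_infCoord]
    refine Prod.ext (funext fun w => zero_add _) ?_
    funext α N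
    refine (velProlong_snd _ _ _ _ _).trans ?_
    rcases α with w | i
    · by_cases hN : N.1 = 0
      · refine Eq.trans ?_ (coord_velocityMk hφ σ hσ _ N).symm
        simp [multiDeriv, hsdef, c, hN]
      · exact (multiDeriv_coord N.1 c w hN 0).trans (hn w N hN).symm
    · exact (coord_velocityMk hφ σ hσ _ N).symm
  have hU : jetU ((velocityMk k σ).infCoord φ) = 1 := by
    rw [← jetU_congr hk htr, jetU_velProlong fun w => hs' _]
    exact jacobian_translate c 0
  have hdet : (jacobian (fun w => s (Sum.inl w)) 0).det ≠ 0 := (isCoordAt_translate c 0).det_ne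
  have hval : contactJet k ((velocityMk k σ).infCoord φ)
      = (prolong (fun w => s (Sum.inl w)) (fun i => s (Sum.inr i)) 0).trunc k := by
    rw [← (contactJet_velProlong (b := 0) hs' hdet).eq_of_nhds]
    exact (cylAt_contactJet (by rw [hU]; simp)).apply_eq htr.symm
  rw [contactInv, if_pos ⟨hb, by rw [detU_eq, hU]; simp⟩, hval]
  refine Prod.ext ?_ ?_
  · funext w
    refine Eq.trans ?_ (coord_velocityMk hφ σ hσ _ _).symm
    simp [InfJet.trunc, prolong, MIdx.zero, multiDeriv, hsdef, c]
  · funext i N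
    refine Eq.trans ?_ (coord_velocityMk hφ σ hσ _ _).symm
    rw [multiDeriv_eq_multiPow_nabla c]
    rfl

/-- Near a point with `det U ≠ 0`, every parametrized submanifold can be reparametrized so as to
become normalized. -/
theorem exists_isNormalized (hφ : φ ∈ IsManifold.maximalAtlas 𝓘(ℝ, ModelPQ p q) ∞ M) (σ : GermRep p q M)
    (hσ : σ.1 0 ∈ φ.source)
    (hdet : (jacobian (fun w => chartComp φ σ.1 (Sum.inl w)) 0).det ≠ 0) :
    ∃ ξ' : RegularVelocity p q M k, ξ'.1.IsNormalized φ ∧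
      SameOrbit ⟨velocityMk k σ, isRegular_velocityMk hφ σ hσ hdet⟩ ξ' := by
  have hs := contDiffAt_chartComp hφ σ.2 hσ
  have hT : IsCoordAt (fun w => chartComp φ σ.1 (Sum.inl w)) 0 := ⟨fun w => hs _, hdet⟩
  obtain ⟨S, hS, hS0, hTS, -⟩ := hT.exists_inverse
  set c : Fin p → ℝ := fun w => chartComp φ σ.1 (Sum.inl w) 0 with hc
  -- The inverse of the t-components, translated so that f 0 = 0. Then t(f(y)) = c + y near 0, which
  -- is the normalization, and Df(0) is invertible because the product of the two Jacobians is 1.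
  set f : (Fin p → ℝ) → Fin p → ℝ := fun y => S (c + y) with hfdef
  have hadd : ContDiffAt ℝ ∞ (fun y : Fin p → ℝ => c + y) 0 := contDiffAt_const.add contDiffAt_id
  have hf : ContDiffAt ℝ ∞ f 0 := ContDiffAt.comp (0 : Fin p → ℝ) (by rwa [add_zero]) hadd
  have hf0 : f 0 = 0 := by simp [hfdef, hS0]
  have hTf : ∀ w, (fun y => chartComp φ σ.1 (Sum.inl w) (f y)) =ᶠ[𝓝 0] fun y => c w + y w := by
    intro w
    have ht : Tendsto (fun y : Fin p → ℝ => c + y) (𝓝 0) (𝓝 c) := by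
      simpa using hadd.continuousAt.tendsto
    filter_upwards [ht.eventually hTS] with y hy
    exact congrFun hy w
  have hJ : jacobian (fun w y => chartComp φ σ.1 (Sum.inl w) (f y)) 0 = 1 := by
    rw [(jacobian_congr hTf).eq_of_nhds, jacobian_translate]
  have hinj : Function.Injective (fderiv ℝ f 0) := by
    refine fderiv_injective_of_jacobian hf.smooth_differentiableAt fun h0 => ?_
    rw [jacobian_comp (T := fun w => chartComp φ σ.1 (Sum.inl w))
      (fun w => by rw [hf0]; exact (hs _).smooth_differentiableAt)
      hf.smooth_differentiableAt] at hJ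
    have := congrArg Matrix.det hJ
    rw [Matrix.det_mul, h0] at this
    simp at this
  have hbij : Function.Bijective (fderiv ℝ f 0) :=
    ⟨hinj, (LinearMap.injective_iff_surjective (f := (fderiv ℝ f 0).toLinearMap)).1 hinj⟩
  have hσf : ContMDiffAt 𝓘(ℝ, Fin p → ℝ) 𝓘(ℝ, ModelPQ p q) ∞ (fun y => σ.1 (f y)) 0 :=
    ContMDiffAt.comp (0 : Fin p → ℝ) (by rw [hf0]; exact σ.2) hf.contMDiffAt
  let σ' : GermRep p q M := ⟨fun y => σ.1 (f y), hσf⟩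
  have hσ' : σ'.1 0 ∈ φ.source := by simpa [σ', hf0] using hσ
  have hdet' : (jacobian (fun w => chartComp φ σ'.1 (Sum.inl w)) 0).det ≠ 0 := by
    have : (jacobian (fun w => chartComp φ σ'.1 (Sum.inl w)) 0) = 1 := hJ
    rw [this]; simp
  refine ⟨⟨velocityMk k σ', isRegular_velocityMk hφ σ' hσ' hdet'⟩, ⟨hσ', fun w N hN => ?_⟩,
    σ, σ', f, hf, hf0, hbij, fun _ => rfl, rfl, rfl⟩
  rw [coord_velocityMk hφ σ' hσ']
  have h : chartComp φ σ'.1 (Sum.inl w) =ᶠ[𝓝 0] fun y => c w + y w := hTf w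
  rw [(h.multiDeriv N.1).eq_of_nhds]
  exact multiDeriv_coord N.1 c w hN 0

/-- `Function.extend` picks some normalized representative of the contact element. Its coordinates
are values of `contactInv`, which is constant on orbits, so any other representative gives the same
result. -/
theorem contactChart_of_isNormalized (hk : 1 ≤ k)
    (hφ : φ ∈ IsManifold.maximalAtlas 𝓘(ℝ, ModelPQ p q) ∞ M) {ξ : RegularVelocity p q M k}
    (h : ξ.1.IsNormalized φ) : contactChart φ (contactProj ξ) = contactInv hk φ ξ.1 := by
  have hlift : ∀ {ξ ξ' : RegularVelocity p q M k}, contactProj ξ = contactProj ξ' →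
      contactInv hk φ ξ.1 = contactInv hk φ ξ'.1 := fun {ξ ξ'} h =>
    congrArg (Quot.lift (fun ξ : RegularVelocity p q M k => contactInv hk φ ξ.1)
      fun _ _ => contactInv_eq_of_sameOrbit hk hφ) h
  have hex : ∃ ζ : {ξ : RegularVelocity p q M k // ξ.1.IsNormalized φ},
      contactProj ζ.1 = contactProj ξ := ⟨⟨ξ, h⟩, rfl⟩
  classical
  rw [contactChart, Function.extend_def, dif_pos hex,
    ← contactInv_of_isNormalized hk hφ (Classical.choose hex).2]
  exact hlift (Classical.choose_spec hex)

/-- The map `℘_φ` in coordinates. -/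
theorem wpChart_eq (hk : 1 ≤ k) (hφ : φ ∈ IsManifold.maximalAtlas 𝓘(ℝ, ModelPQ p q) ∞ M)
    (ξ : Velocity p q M k) (hb : ξ.base ∈ φ.source) (hdet : ξ.detU hk φ ≠ 0) :
    wpChart φ ξ = contactJet k (ξ.infCoord φ) := by
  obtain ⟨σ, rfl⟩ : ∃ σ, velocityMk k σ = ξ := Quotient.exists_rep ξ
  have hσ : σ.1 0 ∈ φ.source := hb
  have hd := hdet
  rw [detU_eq, jetU_velocityMk hk hφ σ hσ] at hd
  obtain ⟨ξ', hn, ho⟩ := exists_isNormalized hφ σ hσ hd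
  rw [wpChart, dif_pos (isRegular_velocityMk hφ σ hσ hd),
    show contactProj ⟨velocityMk k σ, isRegular_velocityMk hφ σ hσ hd⟩ = contactProj ξ' from
      Quot.sound ho, contactChart_of_isNormalized hk hφ hn,
    ← contactInv_eq_of_sameOrbit hk hφ ho]
  exact if_pos ⟨hb, hdet⟩

/-- `localExpr` has its meaning only at coordinates of actual velocities and is 0 elsewhere. Taylor
polynomials, taken to M by φ⁻¹, realize all coordinates over the chart's target. -/
theorem exists_velocity_coord_eq (hφ : φ ∈ IsManifold.maximalAtlas 𝓘(ℝ, ModelPQ p q) ∞ M)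
    (c : JetCoord p (Fin p ⊕ Fin q) k) (hc : (fun α => c α (MIdx.zero p k)) ∈ φ.target) :
    ∃ ξ : Velocity p q M k, ξ.base ∈ φ.source ∧ ξ.coord φ = c := by
  choose g hg hgc using fun α => exists_contDiff_multiDeriv_eq (c α)
  have h0 : (fun α => g α 0) = fun α => c α (MIdx.zero p k) := by
    funext α
    rw [← hgc]
    simp [MIdx.zero, multiDeriv]
  have hgs : ContDiff ℝ ∞ fun y α => g α y := contDiff_pi.2 hg
  have hsymm : ContMDiffAt 𝓘(ℝ, ModelPQ p q) 𝓘(ℝ, ModelPQ p q) ∞ φ.symm (fun α => g α 0) := by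
    rw [h0]
    exact (contMDiffOn_symm_of_mem_maximalAtlas hφ).contMDiffAt (φ.open_target.mem_nhds hc)
  let σ : GermRep p q M := ⟨fun y => φ.symm fun α => g α y,
    ContMDiffAt.comp (0 : Fin p → ℝ) hsymm hgs.contMDiff.contMDiffAt⟩
  have hσ : σ.1 0 ∈ φ.source := φ.map_target (by rwa [h0])
  refine ⟨velocityMk k σ, hσ, ?_⟩
  funext α N
  rw [coord_velocityMk hφ σ hσ, ← hgc]
  -- The polynomial map may leave the target away from 0, but only its germ at 0 counts.
  have ht : ∀ᶠ y in 𝓝 (0 : Fin p → ℝ), (fun α => g α y) ∈ φ.target :=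
    hgs.continuous.continuousAt.eventually_mem (φ.open_target.mem_nhds (by rwa [h0]))
  have e : chartComp φ σ.1 α =ᶠ[𝓝 0] g α := by
    filter_upwards [ht] with y hy
    exact congrFun (φ.right_inv hy) α
  exact (e.multiDeriv N.1).eq_of_nhds

/-- The homogeneous Lagrange function in coordinates. -/
theorem localExpr_homogLagrange (hk : 1 ≤ k)
    (hφ : φ ∈ IsManifold.maximalAtlas 𝓘(ℝ, ModelPQ p q) ∞ M) (L : JetSpace p (Fin q) k → ℝ)
    (z : InfJet p (Fin p ⊕ Fin q)) (hz : (fun α => z.2 α 0) ∈ φ.target)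
    (hdet : (jetU z).det ≠ 0) :
    localExpr φ (homogLagrange hk φ L) (z.trunc k).2 = L (contactJet k z) * (jetU z).det := by
  obtain ⟨ξ, hξ, hξc⟩ := exists_velocity_coord_eq hφ (z.trunc k).2 hz
  have hex : ∃ ζ : {ξ : Velocity p q M k // ξ.base ∈ φ.source},
      ζ.1.coord φ = (z.trunc k).2 := ⟨⟨ξ, hξ⟩, hξc⟩
  classical
  rw [localExpr, Function.extend_def, dif_pos hex]
  obtain ⟨hζ, hζc⟩ := And.intro (Classical.choose hex).2 (Classical.choose_spec hex)
  set ζ := (Classical.choose hex).1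
  -- A velocity carries no parameter value, so the base of z is moved to 0 before jets are compared.
  let z₀ : InfJet p (Fin p ⊕ Fin q) := (0, z.2)
  have ht : (ζ.infCoord φ).trunc k = z₀.trunc k := by
    rw [trunc_infCoord, hζc]; rfl
  have hU : jetU (ζ.infCoord φ) = jetU z := (jetU_congr hk ht).trans rfl
  have hd : ζ.detU hk φ ≠ 0 := by rwa [detU_eq, hU]
  rw [homogLagrange, wpChart_eq hk hφ ζ hζ hd, detU_eq, hU,
    contactJet_congr (z := z) (z' := z₀) rfl]
  congr 2
  exact (cylAt_contactJet (by rwa [hU])).apply_eq ht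

end Velocities

/-! ## The derivative of the determinant and the Piola identity -/

section Determinant

open Topology Filter

/-- Jacobi's formula. -/
theorem hasDerivAt_matrix_det {κ : Type*} [Fintype κ] [DecidableEq κ] {A : ℝ → Matrix κ κ ℝ}
    {A' : Matrix κ κ ℝ} {t : ℝ} (hA : ∀ i j, HasDerivAt (fun t => A t i j) (A' i j) t)
    (hdet : (A t).det ≠ 0) :
    HasDerivAt (fun t => (A t).det) ((A t).det * ∑ j, ∑ i, (A t)⁻¹ j i * A' i j) t := by
  have h1 : HasDerivAt (fun t => (A t).det)
      (∑ σ : Equiv.Perm κ, (Equiv.Perm.sign σ : ℤ) •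
        ∑ j, (∏ i ∈ Finset.univ.erase j, A t (σ i) i) • A' (σ j) j) t := by
    simp only [Matrix.det_apply]
    refine HasDerivAt.fun_sum fun σ _ => ?_
    exact (HasDerivAt.fun_finsetProd fun i _ => hA (σ i) i).const_smul _
  convert h1 using 1
  -- By Cramer, each inner sum is the determinant with column j differentiated; these are the terms
  -- of the product rule in the Leibniz formula.
  have h2 : ∀ j, ∑ i, (A t).adjugate j i * A' i j
      = ((A t).updateCol j fun i => A' i j).det := by
    intro j
    rw [← Matrix.cramer_apply, Matrix.cramer_eq_adjugate_mulVec]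
    rfl
  have h3 : (A t).det * ∑ j, ∑ i, (A t)⁻¹ j i * A' i j
      = ∑ j, ∑ i, (A t).adjugate j i * A' i j := by
    rw [Finset.mul_sum]
    refine Finset.sum_congr rfl fun j _ => ?_
    rw [Finset.mul_sum]
    refine Finset.sum_congr rfl fun i _ => ?_
    rw [Matrix.inv_def, Matrix.smul_apply, Ring.inverse_eq_inv', smul_eq_mul]
    field_simp
  rw [h3]
  simp only [h2, Matrix.det_apply, Finset.smul_sum]
  rw [Finset.sum_comm]
  refine Finset.sum_congr rfl fun σ _ => Finset.sum_congr rfl fun j _ => ?_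
  rw [← Finset.prod_erase_mul _ _ (Finset.mem_univ j), Matrix.updateCol_self, smul_eq_mul]
  have : ∏ i ∈ Finset.univ.erase j, ((A t).updateCol j fun i => A' i j) (σ i) i
      = ∏ i ∈ Finset.univ.erase j, A t (σ i) i :=
    Finset.prod_congr rfl fun i hi => Matrix.updateCol_ne (Finset.ne_of_mem_erase hi)
  rw [this]
  rfl

variable {p : ℕ} {T : Fin p → (Fin p → ℝ) → ℝ} {f : (Fin p → ℝ) → ℝ} {x : Fin p → ℝ}

theorem IsCoordAt.pderivAlong_det (hT : IsCoordAt T x) (m : Fin p) :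
    pderivAlong m (fun y => (jacobian T y).det) x
      = (jacobian T x).det * ∑ n, ∑ w, (jacobian T x)⁻¹ n w *
          pderivAlong m (fun y => jacobian T y w n) x := by
  have h : ∀ w n, HasDerivAt (fun t : ℝ => jacobian T (x + t • Pi.single m 1) w n)
      (pderivAlong m (fun y => jacobian T y w n) x) 0 := fun w n =>
    (hT.contDiffAt_jacobian w n).smooth_differentiableAt.lineDifferentiableAt.hasLineDerivAt
  have := hasDerivAt_matrix_det (A := fun t : ℝ => jacobian T (x + t • Pi.single m 1))
    (A' := Matrix.of fun w n => pderivAlong m (fun y => jacobian T y w n) x) (t := 0) h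
    (by simpa using hT.det_ne)
  have h' := this.deriv
  simp only [zero_smul, add_zero] at h'
  exact h'

theorem IsCoordAt.nabla_det (hT : IsCoordAt T x) (w : Fin p) :
    nabla T w (fun y => (jacobian T y).det) x
      = (jacobian T x).det * ∑ n, ∑ a, (jacobian T x)⁻¹ n a *
          nabla T w (fun y => jacobian T y a n) x := by
  simp only [nabla, hT.pderivAlong_det, Finset.mul_sum]
  rw [Finset.sum_comm]
  refine Finset.sum_congr rfl fun n _ => ?_
  rw [Finset.sum_comm]
  exact Finset.sum_congr rfl fun a _ => Finset.sum_congr rfl fun m _ => by ring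

/-- Differentiate J J⁻¹ = 1 along τⁿ, use ∂_n ∂_m T^a = ∂_m ∂_n T^a to recognize `nabla T w` of an
entry of J, and contract with J⁻¹. -/
theorem IsCoordAt.sum_pderivAlong_inv (hT : IsCoordAt T x) (w : Fin p) :
    ∑ n, pderivAlong n (fun y => (jacobian T y)⁻¹ n w) x
      = -∑ n, ∑ a, (jacobian T x)⁻¹ n a * nabla T w (fun y => jacobian T y a n) x := by
  have hJ := fun a n => (hT.contDiffAt_jacobian a n).smooth_differentiableAt
  have hV := fun n a => (hT.contDiffAt_inv n a).smooth_differentiableAt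
  have h1 : ∀ n a, ∑ m, pderivAlong n (fun y => (jacobian T y)⁻¹ m w) x * jacobian T x a m
      = -nabla T w (fun y => jacobian T y a n) x := by
    intro n a
    have e : (fun y => ∑ m, (jacobian T y)⁻¹ m w * jacobian T y a m) =ᶠ[𝓝 x]
        fun _ => if a = w then 1 else 0 := by
      filter_upwards [hT.eventually_det_ne] with y hy
      exact nabla_coord hy w a
    have h := (e.pderivAlong n).eq_of_nhds
    rw [pderivAlong_const, pderivAlong_sum Finset.univ n fun m _ => (hV m w).fun_mul (hJ a m)] at h
    simp only [pderivAlong_mul n (hV _ w) (hJ a _), Finset.sum_add_distrib] at h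
    have hs : ∀ m, pderivAlong n (fun y => jacobian T y a m) x
        = pderivAlong m (fun y => jacobian T y a n) x := fun m =>
      (pderivAlong_comm n m (hT.smooth a)).eq_of_nhds
    simp only [hs] at h
    unfold nabla
    linarith
  have h2 : ∀ n m, ∑ a, (jacobian T x)⁻¹ n a * jacobian T x a m = if n = m then 1 else 0 := by
    intro n m
    have h := congrFun (congrFun (Matrix.nonsing_inv_mul (jacobian T x) hT.det_ne.isUnit) n) m
    rwa [Matrix.mul_apply, Matrix.one_apply] at h
  calc ∑ n, pderivAlong n (fun y => (jacobian T y)⁻¹ n w) x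
      = ∑ n, ∑ m, pderivAlong n (fun y => (jacobian T y)⁻¹ m w) x *
          ∑ a, (jacobian T x)⁻¹ n a * jacobian T x a m := by simp [h2]
    _ = ∑ n, ∑ a, (jacobian T x)⁻¹ n a *
          ∑ m, pderivAlong n (fun y => (jacobian T y)⁻¹ m w) x * jacobian T x a m := by
      refine Finset.sum_congr rfl fun n _ => ?_
      simp only [Finset.mul_sum]
      rw [Finset.sum_comm]
      exact Finset.sum_congr rfl fun a _ => Finset.sum_congr rfl fun m _ => by ring
    _ = _ := by simp only [h1, mul_neg, Finset.sum_neg_distrib]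

/-- The Piola identity: multiplied by the Jacobian determinant, the derivative with respect to a
coordinate is a divergence. -/
theorem IsCoordAt.sum_pderivAlong_det_inv_mul (hT : IsCoordAt T x) (w : Fin p)
    (hf : DifferentiableAt ℝ f x) :
    ∑ n, pderivAlong n (fun y => (jacobian T y).det * (jacobian T y)⁻¹ n w * f y) x
      = (jacobian T x).det * nabla T w f x := by
  have hD := hT.contDiffAt_det.smooth_differentiableAt
  have hV := fun n => (hT.contDiffAt_inv n w).smooth_differentiableAt
  have h1 := hT.sum_pderivAlong_inv w
  have h2 := hT.nabla_det w
  -- The columns of det J · J⁻¹ are divergence-free: Jacobi's formula and the derivative of the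
  -- inverse give opposite sums.
  have h3 : ∑ n, (pderivAlong n (fun y => (jacobian T y).det) x * (jacobian T x)⁻¹ n w
      + (jacobian T x).det * pderivAlong n (fun y => (jacobian T y)⁻¹ n w) x) = 0 := by
    rw [Finset.sum_add_distrib, ← Finset.mul_sum, h1, mul_neg, ← h2, nabla, ← sub_eq_add_neg,
      sub_eq_zero]
    exact Finset.sum_congr rfl fun n _ => mul_comm _ _
  have h4 : ∀ n, pderivAlong n (fun y => (jacobian T y).det * (jacobian T y)⁻¹ n w * f y) x
      = (pderivAlong n (fun y => (jacobian T y).det) x * (jacobian T x)⁻¹ n w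
      + (jacobian T x).det * pderivAlong n (fun y => (jacobian T y)⁻¹ n w) x) * f x
      + (jacobian T x).det * ((jacobian T x)⁻¹ n w * pderivAlong n f x) := by
    intro n
    rw [pderivAlong_mul n (g := fun y => (jacobian T y).det * (jacobian T y)⁻¹ n w)
      (hD.mul (hV n)) hf, pderivAlong_mul n hD (hV n)]
    ring
  simp only [h4]
  rw [Finset.sum_add_distrib, ← Finset.sum_mul, h3, zero_mul, zero_add, ← Finset.mul_sum]
  rfl

end Determinant

/-! ## Variations of velocities -/

section Variation

open Topology Filter

variable {p q : ℕ}

/-- The jet of a variation `η`. -/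
noncomputable def jetVar {ι : Type} (η : ι → (Fin p → ℝ) → ℝ) (x : Fin p → ℝ) : InfJet p ι :=
  (0, fun α N => multiDeriv N (η α) x)

/-- The linearization along `s` of a function of jets. -/
noncomputable def linVar {ι : Type} (b : Fin p → ℝ) (s η : ι → (Fin p → ℝ) → ℝ)
    (F : InfJet p ι → ℝ) (x : Fin p → ℝ) : ℝ :=
  lineDeriv ℝ F (velProlong b s x) (jetVar η x)

/-! ### Linearization of functions of jets. -/

section General

variable {ι : Type}

/-- The projection of jets that forgets the base point. -/
noncomputable def JetSpace.vert {k : ℕ} : JetSpace p ι k →L[ℝ] JetSpace p ι k :=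
  (ContinuousLinearMap.inr ℝ (Fin p → ℝ) (JetCoord p ι k)).comp
    (ContinuousLinearMap.snd ℝ (Fin p → ℝ) (JetCoord p ι k))

theorem trunc_jetVar (b x : Fin p → ℝ) (η : ι → (Fin p → ℝ) → ℝ) (k : ℕ) :
    (jetVar η x).trunc k = JetSpace.vert ((velProlong b η x).trunc k) := by
  refine Prod.ext rfl ?_
  funext α N
  exact (velProlong_snd b η x α N.1).symm

theorem linVar_coord (b : Fin p → ℝ) (s η : ι → (Fin p → ℝ) → ℝ) (x : Fin p → ℝ) (α : ι)
    (N : Fin p → ℕ) : linVar b s η (fun z => z.2 α N) x = multiDeriv N (η α) x := by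
  have : HasDerivAt (fun t : ℝ => (velProlong b s x).2 α N + t * multiDeriv N (η α) x)
      (1 * multiDeriv N (η α) x) 0 := ((hasDerivAt_id (0 : ℝ)).mul_const _).const_add _
  rw [one_mul] at this
  exact this.deriv

variable [Fintype ι] {b : Fin p → ℝ} {s η : ι → (Fin p → ℝ) → ℝ} {x : Fin p → ℝ}
  {k : ℕ} {F F' : InfJet p ι → ℝ}

theorem CylAt.lineDifferentiableAt {V : Type*} [NormedAddCommGroup V] [NormedSpace ℝ V]
    {F : InfJet p ι → V} {z : InfJet p ι} (hF : CylAt k F z) (v : InfJet p ι) :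
    LineDifferentiableAt ℝ F z v := by
  obtain ⟨G, hG, hFG⟩ := hF
  exact (hasLineDerivAt_of_cyl v hFG hG.smooth_differentiableAt).lineDifferentiableAt

theorem CylAt.hasLineDerivAt_linVar (hF : CylAt k F (velProlong b s x)) :
    HasLineDerivAt ℝ F (linVar b s η F x) (velProlong b s x) (jetVar η x) :=
  (hF.lineDifferentiableAt _).hasLineDerivAt

theorem contDiffAt_trunc_velProlong (b : Fin p → ℝ) (hs : ∀ α, ContDiffAt ℝ ∞ (s α) x) (k : ℕ) :
    ContDiffAt ℝ ∞ (fun y => (velProlong b s y).trunc k) x :=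
  (isCoordAt_translate b x).contDiffAt_trunc_prolong hs k

theorem fderiv_trunc_velProlong (b : Fin p → ℝ) (hs : ∀ α, ContDiffAt ℝ ∞ (s α) x) (k : ℕ)
    (n : Fin p) : fderiv ℝ (fun y => (velProlong b s y).trunc k) x (Pi.single n 1)
      = ((velProlong b s x).totalDir n).trunc k := by
  have h := ((isCoordAt_translate b x).eventually_sum_fderiv_prolong hs k n).self_of_nhds
  rw [jacobian_translate] at h
  simp only [inv_one, Matrix.one_apply, ite_smul, one_smul, zero_smul, Finset.sum_ite_eq',
    Finset.mem_univ, if_true] at h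
  exact h

theorem contDiffAt_trunc_jetVar (hη : ∀ α, ContDiffAt ℝ ∞ (η α) x) (k : ℕ) :
    ContDiffAt ℝ ∞ (fun y => (jetVar η y).trunc k) x := by
  simp only [trunc_jetVar 0]
  exact (JetSpace.vert (p := p) (ι := ι) (k := k)).contDiff.contDiffAt.comp x
    (contDiffAt_trunc_velProlong 0 hη k)

theorem fderiv_trunc_jetVar (hη : ∀ α, ContDiffAt ℝ ∞ (η α) x) (k : ℕ) (n : Fin p) :
    fderiv ℝ (fun y => (jetVar η y).trunc k) x (Pi.single n 1)
      = JetSpace.shift n ((jetVar η x).trunc (k + 1)) := by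
  have hd := (contDiffAt_trunc_velProlong 0 hη k).smooth_differentiableAt.hasFDerivAt
  have h := ((JetSpace.vert (p := p) (ι := ι) (k := k)).hasFDerivAt.comp x hd).fderiv
  have e : (fun y => (jetVar η y).trunc k)
      = JetSpace.vert ∘ fun y => (velProlong 0 η y).trunc k := by
    funext y
    exact trunc_jetVar 0 y η k
  rw [e, h, ContinuousLinearMap.comp_apply, fderiv_trunc_velProlong 0 hη k n, trunc_jetVar 0,
    JetSpace.shift_trunc]
  refine Prod.ext rfl ?_
  simp [JetSpace.vert, JetSpace.shift]

theorem linVar_eventuallyEq {G : JetSpace p ι k → ℝ} (hs : ∀ α, ContDiffAt ℝ ∞ (s α) x)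
    (hG : ContDiffAt ℝ ∞ G ((velProlong b s x).trunc k))
    (hFG : ∀ᶠ y in 𝓝 ((velProlong b s x).trunc k), ∀ z' : InfJet p ι, z'.trunc k = y →
      F z' = G y) :
    linVar b s η F =ᶠ[𝓝 x] fun y =>
      fderiv ℝ G ((velProlong b s y).trunc k) ((jetVar η y).trunc k) := by
  have hc := (contDiffAt_trunc_velProlong b hs k).continuousAt.tendsto
  filter_upwards [hc.eventually hFG.eventually_nhds,
    hc.eventually hG.eventually_differentiableAt] with y hy hy'
  exact (hasLineDerivAt_of_cyl (jetVar η y) hy hy').lineDeriv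

theorem CylAt.contDiffAt_linVar (hs : ∀ α, ContDiffAt ℝ ∞ (s α) x)
    (hη : ∀ α, ContDiffAt ℝ ∞ (η α) x) (hF : CylAt k F (velProlong b s x)) :
    ContDiffAt ℝ ∞ (linVar b s η F) x := by
  obtain ⟨G, hG, hFG⟩ := hF
  refine ContDiffAt.congr_of_eventuallyEq ?_ (linVar_eventuallyEq hs hG hFG)
  exact (ContDiffAt.comp (g := fderiv ℝ G) x hG.smooth_fderiv
    (contDiffAt_trunc_velProlong b hs k)).clm_apply (contDiffAt_trunc_jetVar hη k)

/-- Linearization commutes with total derivatives. -/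
theorem CylAt.linVar_totalDeriv (hs : ∀ α, ContDiffAt ℝ ∞ (s α) x)
    (hη : ∀ α, ContDiffAt ℝ ∞ (η α) x) (hF : CylAt k F (velProlong b s x)) (n : Fin p) :
    linVar b s η (_root_.totalDeriv n F) x = pderivAlong n (linVar b s η F) x := by
  obtain ⟨G, hG, hFG⟩ := hF
  have hG2 : DifferentiableAt ℝ (fderiv ℝ G) ((velProlong b s x).trunc k) :=
    hG.smooth_fderiv.smooth_differentiableAt
  have hc := (contDiffAt_trunc_velProlong b hs k).smooth_differentiableAt
  have hd := (contDiffAt_trunc_jetVar hη k).smooth_differentiableAt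
  rw [((linVar_eventuallyEq hs hG hFG).pderivAlong n).eq_of_nhds]
  have h1 : HasFDerivAt (fun y => fderiv ℝ G ((velProlong b s y).trunc k)) _ x :=
    hG2.hasFDerivAt.comp x hc.hasFDerivAt
  have h2 := h1.clm_apply hd.hasFDerivAt
  rw [pderivAlong_eq_fderiv n h2.differentiableAt, h2.fderiv]
  have h3 : linVar b s η (_root_.totalDeriv n F) x = _ :=
    (hasLineDerivAt_of_cyl (jetVar η x) (CylAt.totalDeriv_eventually hG hFG n)
      (CylAt.contDiffAt_totalDeriv hG n).smooth_differentiableAt).lineDeriv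
  rw [h3]
  have h4 : HasFDerivAt (fun y : JetSpace p ι (k + 1) => fderiv ℝ G (JetSpace.res k.le_succ y)) _
      ((velProlong b s x).trunc (k + 1)) :=
    HasFDerivAt.comp _ (g := fderiv ℝ G) hG2.hasFDerivAt
      (JetSpace.res (p := p) (ι := ι) k.le_succ).hasFDerivAt
  have h5 : HasFDerivAt (fun y : JetSpace p ι (k + 1) =>
      ((Pi.single n 1, 0) + JetSpace.shift n y : JetSpace p ι k)) _
      ((velProlong b s x).trunc (k + 1)) :=
    (JetSpace.shift (p := p) (ι := ι) n).hasFDerivAt.const_add _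
  rw [(h4.clm_apply h5).fderiv]
  -- The two expressions differ only in the order in which the total direction and the variation
  -- enter the second derivative of G.
  have hsymm : IsSymmSndFDerivAt ℝ G ((velProlong b s x).trunc k) :=
    hG.isSymmSndFDerivAt (by simpa using (WithTop.coe_le_coe.2 (le_top : (2 : ℕ∞) ≤ ⊤)))
  simp only [add_apply, ContinuousLinearMap.comp_apply,
    ContinuousLinearMap.flip_apply, fderiv_trunc_velProlong b hs, fderiv_trunc_jetVar hη,
    JetSpace.res_trunc, ← JetSpace.shift_trunc]
  congr 1
  exact hsymm _ _

theorem CylAt.linVar_mul (hF : CylAt k F (velProlong b s x))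
    (hF' : CylAt k F' (velProlong b s x)) :
    linVar b s η (fun z => F z * F' z) x = linVar b s η F x * F' (velProlong b s x)
      + F (velProlong b s x) * linVar b s η F' x := by
  have h1 : HasDerivAt _ _ (0 : ℝ) := hF.hasLineDerivAt_linVar (η := η)
  have h2 : HasDerivAt _ _ (0 : ℝ) := hF'.hasLineDerivAt_linVar (η := η)
  have h := (h1.fun_mul h2).deriv
  simp only [zero_smul, add_zero] at h
  exact h

theorem linVar_sum {κ : Type*} [Fintype κ] {F : κ → InfJet p ι → ℝ}
    (hF : ∀ i, CylAt k (F i) (velProlong b s x)) :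
    linVar b s η (fun z => ∑ i, F i z) x = ∑ i, linVar b s η (F i) x :=
  HasDerivAt.deriv (HasDerivAt.fun_sum fun i _ => (hF i).hasLineDerivAt_linVar (η := η))

end General

/-! ### Variations of U, of derivatives with respect to t^w, and of contact coordinates. -/

variable {b : Fin p → ℝ} {s η : Fin p ⊕ Fin q → (Fin p → ℝ) → ℝ} {x : Fin p → ℝ} {k : ℕ}
  {F : InfJet p (Fin p ⊕ Fin q) → ℝ}

/-- The variation of the matrix `U`. -/
theorem linVar_jetU (hη : ∀ α, ContDiffAt ℝ ∞ (η α) x) (w n : Fin p) :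
    linVar b s η (fun z => jetU z w n) x = pderivAlong n (η (Sum.inl w)) x :=
  (linVar_coord b s η x (Sum.inl w) (Pi.single n 1)).trans (multiDeriv_single n (hη _))

/-- The variation of `det U`. -/
theorem linVar_det_jetU (hs : ∀ α, ContDiffAt ℝ ∞ (s α) x) (hη : ∀ α, ContDiffAt ℝ ∞ (η α) x)
    (hdet : (jacobian (fun w => s (Sum.inl w)) x).det ≠ 0) :
    linVar b s η (fun z => (jetU z).det) x = (jacobian (fun w => s (Sum.inl w)) x).det *
      ∑ w, nabla (fun w => s (Sum.inl w)) w (η (Sum.inl w)) x := by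
  have hU : jetU (velProlong b s x) = jacobian (fun w => s (Sum.inl w)) x :=
    jetU_velProlong fun w => hs _
  have hA : ∀ w n, HasDerivAt (fun t : ℝ => jetU (velProlong b s x + t • jetVar η x) w n)
      (Matrix.of (fun w n => pderivAlong n (η (Sum.inl w)) x) w n) 0 := by
    intro w n
    rw [Matrix.of_apply, ← linVar_jetU (b := b) (s := s) hη w n]
    exact (cylAt_jetU le_rfl w n).hasLineDerivAt_linVar
  have h := (hasDerivAt_matrix_det (A := fun t : ℝ => jetU (velProlong b s x + t • jetVar η x)) hA
    (by simpa [hU] using hdet)).deriv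
  simp only [zero_smul, add_zero, hU, Matrix.of_apply] at h
  refine Eq.trans h ?_
  rw [Finset.sum_comm]
  rfl

/-- The variation of a derivative with respect to `t^w`. -/
theorem CylAt.linVar_jetNabla (hs : ∀ α, ContDiffAt ℝ ∞ (s α) x)
    (hη : ∀ α, ContDiffAt ℝ ∞ (η α) x) (hdet : (jacobian (fun w => s (Sum.inl w)) x).det ≠ 0)
    (hF : CylAt k F (velProlong b s x)) (w : Fin p) :
    linVar b s η (_root_.jetNabla w F) x
      = nabla (fun w => s (Sum.inl w)) w (linVar b s η F) x
        - ∑ a, nabla (fun w => s (Sum.inl w)) w (η (Sum.inl a)) x *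
            nabla (fun w => s (Sum.inl w)) a (fun y => F (velProlong b s y)) x := by
  set T : Fin p → (Fin p → ℝ) → ℝ := fun w => s (Sum.inl w) with hTdef
  have hU : jetU (velProlong b s x) = jacobian T x := jetU_velProlong fun w => hs _
  have hdetU : (jetU (velProlong b s x)).det ≠ 0 := by rwa [hU]
  have hval : ∀ a, _root_.jetNabla a F (velProlong b s x)
      = nabla T a (fun y => F (velProlong b s y)) x := fun a =>
    (hF.jetNabla_velProlong hs a).eq_of_nhds
  have hUc : ∀ a n, CylAt (k + 1) (fun z : InfJet p (Fin p ⊕ Fin q) => jetU z a n)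
      (velProlong b s x) := fun a n => cylAt_jetU (Nat.le_add_left 1 k) a n
  -- To avoid varying U⁻¹, the relation D_n F = Σ_a U^a_n ∇_a F is varied and then solved for the
  -- variation of ∇_w F.
  have h1 : ∀ n, pderivAlong n (linVar b s η F) x
      = ∑ a, (pderivAlong n (η (Sum.inl a)) x * nabla T a (fun y => F (velProlong b s y)) x
        + jacobian T x a n * linVar b s η (_root_.jetNabla a F) x) := by
    intro n
    rw [← hF.linVar_totalDeriv hs hη n]
    have e : linVar b s η (_root_.totalDeriv n F) x
        = linVar b s η (fun z => ∑ a, jetU z a n * _root_.jetNabla a F z) x := by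
      -- That relation needs U invertible; this persists for small t on the line, which is all that
      -- the derivative sees.
      have hcont : ∀ᶠ t : ℝ in 𝓝 0, (jetU (velProlong b s x + t • jetVar η x)).det ≠ 0 := by
        have hd := (CylAt.matrix_det (A := jetU) (z := velProlong b s x)
          fun a n => cylAt_jetU (p := p) (q := q) le_rfl a n).hasLineDerivAt_linVar (η := η)
        have hd' : HasDerivAt _ _ (0 : ℝ) := hd
        exact hd'.continuousAt.eventually_ne (by simpa using hdetU)
      unfold linVar lineDeriv
      refine EventuallyEq.deriv_eq ?_
      filter_upwards [hcont] with t ht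
      set z := velProlong b s x + t • jetVar η x
      have h : ∀ m, ∑ a, (jetU z)⁻¹ m a * jetU z a n = if m = n then 1 else 0 := by
        intro m
        have h := congrFun (congrFun (Matrix.nonsing_inv_mul (jetU z) ht.isUnit) m) n
        rwa [Matrix.mul_apply, Matrix.one_apply] at h
      calc _root_.totalDeriv n F z
          = ∑ m, (∑ a, (jetU z)⁻¹ m a * jetU z a n) * _root_.totalDeriv m F z := by simp [h]
        _ = _ := by
          simp only [_root_.jetNabla, Finset.mul_sum, Finset.sum_mul]
          rw [Finset.sum_comm]
          exact Finset.sum_congr rfl fun a _ => Finset.sum_congr rfl fun m _ => by ring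
    rw [e, linVar_sum fun a => (hUc a n).mul (hF.jetNabla hdetU a)]
    refine Finset.sum_congr rfl fun a _ => ?_
    rw [CylAt.linVar_mul (hUc a n) (hF.jetNabla hdetU a), linVar_jetU hη, hval, hU]
  have h2 : ∀ a, ∑ n, (jacobian T x)⁻¹ n w * jacobian T x a n = if a = w then 1 else 0 :=
    fun a => nabla_coord hdet w a
  have h3 : nabla T w (linVar b s η F) x
      = ∑ a, nabla T w (η (Sum.inl a)) x * nabla T a (fun y => F (velProlong b s y)) x
        + ∑ a, (∑ n, (jacobian T x)⁻¹ n w * jacobian T x a n) *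
            linVar b s η (_root_.jetNabla a F) x := by
    rw [show nabla T w (linVar b s η F) x
      = ∑ n, (jacobian T x)⁻¹ n w * pderivAlong n (linVar b s η F) x from rfl]
    simp only [h1, Finset.mul_sum]
    rw [Finset.sum_comm, ← Finset.sum_add_distrib]
    refine Finset.sum_congr rfl fun a _ => ?_
    rw [show nabla T w (η (Sum.inl a)) x
      = ∑ n, (jacobian T x)⁻¹ n w * pderivAlong n (η (Sum.inl a)) x from rfl,
      Finset.sum_mul, Finset.sum_mul, ← Finset.sum_add_distrib]
    exact Finset.sum_congr rfl fun n _ => by ring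
  rw [h3]
  simp [h2]

/-- The variation of a function of jets, corrected by the transport along the submanifold. -/
noncomputable def charVar (b : Fin p → ℝ) (s η : Fin p ⊕ Fin q → (Fin p → ℝ) → ℝ)
    (F : InfJet p (Fin p ⊕ Fin q) → ℝ) (x : Fin p → ℝ) : ℝ :=
  linVar b s η F x - ∑ a, η (Sum.inl a) x *
    nabla (fun w => s (Sum.inl w)) a (fun y => F (velProlong b s y)) x

/-- The variation of ∇_w F has the extra term −Σ_a ∇_w η^a · ∇_a F. The product rule applied to the
transport term of `charVar` yields the same term, and the ∇'s commute, so the corrected variation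
commutes with ∇_w exactly. -/
theorem CylAt.charVar_jetNabla (hs : ∀ α, ContDiffAt ℝ ∞ (s α) x)
    (hη : ∀ α, ContDiffAt ℝ ∞ (η α) x) (hdet : (jacobian (fun w => s (Sum.inl w)) x).det ≠ 0)
    (hF : CylAt k F (velProlong b s x)) (w : Fin p) :
    charVar b s η (_root_.jetNabla w F) x
      = nabla (fun w => s (Sum.inl w)) w (charVar b s η F) x := by
  set T : Fin p → (Fin p → ℝ) → ℝ := fun w => s (Sum.inl w) with hTdef
  have hT : IsCoordAt T x := ⟨fun w => hs _, hdet⟩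
  have hFs : ContDiffAt ℝ ∞ (fun y => F (velProlong b s y)) x :=
    hF.contDiffAt_prolong (isCoordAt_translate b x) hs
  have hd1 := (hF.contDiffAt_linVar hs hη).smooth_differentiableAt
  have hd2 := fun a => (hη (Sum.inl a)).smooth_differentiableAt
  have hd3 := fun a => (hT.contDiffAt_nabla a hFs).smooth_differentiableAt
  have hN : ∀ a, nabla T a (fun y => _root_.jetNabla w F (velProlong b s y)) x
      = nabla T w (nabla T a fun y => F (velProlong b s y)) x := fun a =>
    (((hF.jetNabla_velProlong hs w).nabla T a).trans (nabla_comm hT a w hFs)).eq_of_nhds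
  have e : nabla T w (charVar b s η F) x = nabla T w (linVar b s η F) x
      - ∑ a, (nabla T w (η (Sum.inl a)) x * nabla T a (fun y => F (velProlong b s y)) x
        + η (Sum.inl a) x * nabla T w (nabla T a fun y => F (velProlong b s y)) x) := by
    have := nabla_sub (T := T) w hd1 (h := fun y => ∑ a, η (Sum.inl a) y *
      nabla T a (fun y => F (velProlong b s y)) y)
      (DifferentiableAt.fun_sum fun a _ => (hd2 a).fun_mul (hd3 a))
    rw [nabla_sum Finset.univ w fun a _ => (hd2 a).fun_mul (hd3 a)] at this
    simp only [nabla_mul w (hd2 _) (hd3 _)] at this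
    exact this
  rw [e, charVar, hF.linVar_jetNabla hs hη hdet w]
  simp only [← hTdef, hN, Finset.sum_add_distrib]
  ring

/-- The characteristic of a variation. -/
noncomputable def characteristic (s η : Fin p ⊕ Fin q → (Fin p → ℝ) → ℝ) (i : Fin q)
    (x : Fin p → ℝ) : ℝ :=
  η (Sum.inr i) x - ∑ a, η (Sum.inl a) x * nabla (fun w => s (Sum.inl w)) a (s (Sum.inr i)) x

/-- The prolongation formula for variations. -/
theorem charVar_contactCoord {W : Set (Fin p → ℝ)} (hW : IsOpen W)
    (hs : ∀ x ∈ W, ∀ α, ContDiffAt ℝ ∞ (s α) x) (hη : ∀ x ∈ W, ∀ α, ContDiffAt ℝ ∞ (η α) x)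
    (hdet : ∀ x ∈ W, (jacobian (fun w => s (Sum.inl w)) x).det ≠ 0) (i : Fin q) (N : Fin p → ℕ)
    (hx : x ∈ W) : charVar b s η (contactCoord i N) x
      = multiPow (nabla fun w => s (Sum.inl w)) N (characteristic s η i) x := by
  -- The relation is imposed on all of the open set W, since the next ∇ needs the germ of the
  -- previous equality.
  refine (multiPow_simulation jetNabla (nabla fun w => s (Sum.inl w)) (fun k F g =>
    (∀ x ∈ W, CylAt k F (velProlong b s x)) ∧ ∀ x ∈ W, charVar b s η F x = g x) ?_ N (k := 0)
    ⟨fun x hx => CylAt.coord (Sum.inr i) 0 (by simp), ?_⟩).2 x hx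
  · rintro k n F g ⟨hF, hFg⟩
    refine ⟨fun x hx => (hF x hx).jetNabla ?_ n, fun x hx => ?_⟩
    · rw [jetU_velProlong fun w => hs x hx _]
      exact hdet x hx
    · rw [(hF x hx).charVar_jetNabla (hs x hx) (hη x hx) (hdet x hx)]
      have : charVar b s η F =ᶠ[𝓝 x] g := by
        filter_upwards [hW.mem_nhds hx] with y hy
        exact hFg y hy
      exact (this.nabla _ n).eq_of_nhds
  · intro x _
    have h0 : ∀ g : (Fin p → ℝ) → ℝ, multiDeriv 0 g = g := fun g => multiPow_zero _ _
    simp only [charVar, linVar_coord, velProlong_snd, h0]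
    rfl

theorem fderiv_vert_eq_sum_jetPartial {ι : Type} [Fintype ι] [DecidableEq ι] {r : ℕ}
    {L : JetSpace p ι r → ℝ} {y : JetSpace p ι r} (hL : DifferentiableAt ℝ L y)
    (u : JetCoord p ι r) :
    fderiv ℝ L y (0, u) = ∑ α, ∑ N, jetPartial α N L y * u α N := by
  have e : ((0, u) : JetSpace p ι r)
      = ∑ α, ∑ N, u α N • ((0, Pi.single α (Pi.single N 1)) : JetSpace p ι r) := by
    refine Prod.ext ?_ ?_
    · simp [Prod.fst_sum]
    · funext β P
      have h : ∀ α N, (u α N • ((0, Pi.single α (Pi.single N 1)) : JetSpace p ι r)).2 β P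
          = if N = P then (if α = β then u α N else 0) else 0 := by
        intro α N
        by_cases hα : α = β
        · subst hα
          by_cases hN : N = P
          · subst hN; simp
          · simp [hN]
        · simp [hα]
      simp only [Prod.snd_sum, Finset.sum_apply, h]
      simp
  rw [e, map_sum]
  refine Finset.sum_congr rfl fun α _ => ?_
  rw [map_sum]
  refine Finset.sum_congr rfl fun N _ => ?_
  rw [map_smul, jetPartial_eq_fderiv hL, smul_eq_mul, mul_comm]

end Variation

/-! ## Integration by parts -/

section TestFunctions

open Topology Filter MeasureTheory

variable {p : ℕ} {W : Set (Fin p → ℝ)} {f g h : (Fin p → ℝ) → ℝ}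
  {T : Fin p → (Fin p → ℝ) → ℝ}

/-- Smooth functions with compact support contained in `W`. -/
structure IsTestOn (W : Set (Fin p → ℝ)) (f : (Fin p → ℝ) → ℝ) : Prop where
  smooth : ∀ x, ContDiffAt ℝ ∞ f x
  compact : HasCompactSupport f
  subset : tsupport f ⊆ W

namespace IsTestOn

/-- The coefficients of f may be singular off W; there f vanishes locally, together with g. -/
theorem of_support (hg : IsTestOn W g) (hf : ∀ x ∈ W, ContDiffAt ℝ ∞ f x)
    (hfg : ∀ x, g =ᶠ[𝓝 x] 0 → f x = 0) : IsTestOn W f := by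
  have hsub : tsupport f ⊆ tsupport g := by
    refine closure_minimal (fun x hx => ?_) (isClosed_tsupport g)
    by_contra hx'
    exact hx (hfg x (notMem_tsupport_iff_eventuallyEq.1 hx'))
  refine ⟨fun x => ?_, hg.compact.of_isClosed_subset (isClosed_tsupport f) hsub,
    hsub.trans hg.subset⟩
  by_cases hx : x ∈ W
  · exact hf x hx
  · have : f =ᶠ[𝓝 x] 0 :=
      notMem_tsupport_iff_eventuallyEq.1 fun hx' => hx (hg.subset (hsub hx'))
    exact contDiffAt_const.congr_of_eventuallyEq this

theorem eq_zero (hf : IsTestOn W f) {x : Fin p → ℝ} (hx : x ∉ W) : f x = 0 :=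
  image_eq_zero_of_notMem_tsupport fun h => hx (hf.subset h)

theorem ext (hf : IsTestOn W f) (hg : IsTestOn W g) (hfg : ∀ x ∈ W, f x = g x) : f = g := by
  funext x
  by_cases hx : x ∈ W
  · exact hfg x hx
  · rw [hf.eq_zero hx, hg.eq_zero hx]

theorem integrable (hf : IsTestOn W f) : Integrable f :=
  (contDiff_iff_contDiffAt.2 hf.smooth).continuous.integrable_of_hasCompactSupport hf.compact

theorem mul_left (hf : IsTestOn W f) (hh : ∀ x ∈ W, ContDiffAt ℝ ∞ h x) :
    IsTestOn W fun x => h x * f x :=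
  hf.of_support (fun x hx => (hh x hx).mul (hf.smooth x)) fun x hx => by
    rw [hx.eq_of_nhds]; simp

theorem sum {κ : Type*} [Fintype κ] {f : κ → (Fin p → ℝ) → ℝ} (hf : ∀ i, IsTestOn W (f i)) :
    IsTestOn W fun x => ∑ i, f i x := by
  classical
  have key : ∀ s : Finset κ, IsTestOn W fun x => ∑ i ∈ s, f i x := by
    intro s
    induction s using Finset.induction_on with
    | empty =>
      simp only [Finset.sum_empty]
      exact ⟨fun _ => contDiffAt_const, HasCompactSupport.zero, by simp [tsupport]⟩
    | insert a s ha ih =>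
      simp only [Finset.sum_insert ha]
      refine ⟨fun x => ((hf a).smooth x).add (ih.smooth x), (hf a).compact.add ih.compact, ?_⟩
      exact (tsupport_add _ _).trans (Set.union_subset (hf a).subset ih.subset)
  exact key Finset.univ

theorem nabla (hf : IsTestOn W f) (hT : ∀ x ∈ W, IsCoordAt T x) (w : Fin p) :
    IsTestOn W (nabla T w f) :=
  hf.of_support (fun x hx => (hT x hx).contDiffAt_nabla w (hf.smooth x)) fun x hx => by
    have hx' : f =ᶠ[𝓝 x] fun _ => 0 := hx
    rw [(hx'.nabla T w).eq_of_nhds]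
    simp [_root_.nabla]

theorem multiPow_nabla (hf : IsTestOn W f) (hT : ∀ x ∈ W, IsCoordAt T x) (N : Fin p → ℕ) :
    IsTestOn W (multiPow (_root_.nabla T) N f) :=
  multiPow_simulation' (_root_.nabla T) (_root_.nabla T) (fun g _ => IsTestOn W g)
    (fun n _ _ h => h.nabla hT n) N (h := f) hf

/-- Integration by parts against the constant 1. -/
theorem integral_pderivAlong (hf : IsTestOn W f) (n : Fin p) :
    ∫ x, pderivAlong n f x = 0 := by
  have hd : Differentiable ℝ f := fun x => (hf.smooth x).smooth_differentiableAt
  have hf' : IsTestOn Set.univ (pderivAlong n f) := by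
    rw [← nabla_translate 0]
    exact nabla ⟨hf.smooth, hf.compact, Set.subset_univ _⟩
      (fun x _ => isCoordAt_translate 0 x) n
  have e : ∀ x, pderivAlong n f x = fderiv ℝ f x (Pi.single n 1) := fun x =>
    pderivAlong_eq_fderiv n (hd x)
  have := integral_mul_fderiv_eq_neg_fderiv_mul_of_integrable (μ := volume)
    (f := fun _ : Fin p → ℝ => (1 : ℝ)) (g := f) (v := Pi.single n 1) (by simp)
    (by simpa [← e] using hf'.integrable) (by simpa using hf.integrable)
    (fun x _ => differentiableAt_const _) (fun x _ => hd x)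
  simpa [← e] using this

/-- By the Piola identity the integrand is a sum of partial derivatives of test functions. -/
theorem integral_det_mul_nabla (hf : IsTestOn W f) (hT : ∀ x ∈ W, IsCoordAt T x) (w : Fin p) :
    ∫ x, (jacobian T x).det * _root_.nabla T w f x = 0 := by
  have h1 : ∀ n, IsTestOn W fun x => (jacobian T x).det * (jacobian T x)⁻¹ n w * f x := fun n =>
    hf.mul_left fun x hx => (hT x hx).contDiffAt_det.mul ((hT x hx).contDiffAt_inv n w)
  have h2 : ∀ n, IsTestOn W (pderivAlong n fun x =>
      (jacobian T x).det * (jacobian T x)⁻¹ n w * f x) := fun n => by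
    rw [← nabla_translate 0]
    exact (h1 n).nabla (fun x _ => isCoordAt_translate 0 x) n
  have e : (fun x => (jacobian T x).det * _root_.nabla T w f x) = fun x => ∑ n,
      pderivAlong n (fun x => (jacobian T x).det * (jacobian T x)⁻¹ n w * f x) x :=
    ((hf.nabla hT w).mul_left fun x hx => (hT x hx).contDiffAt_det).ext (IsTestOn.sum h2)
      fun x hx =>
        ((hT x hx).sum_pderivAlong_det_inv_mul w (hf.smooth x).smooth_differentiableAt).symm
  rw [e, integral_finsetSum _ fun n _ => (h2 n).integrable]
  exact Finset.sum_eq_zero fun n _ => (h1 n).integral_pderivAlong n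

theorem integral_mul_nabla (hf : IsTestOn W f) (hT : ∀ x ∈ W, IsCoordAt T x)
    (hh : ∀ x ∈ W, ContDiffAt ℝ ∞ h x) (w : Fin p) :
    ∫ x, (jacobian T x).det * (h x * _root_.nabla T w f x)
      = -∫ x, (jacobian T x).det * (_root_.nabla T w h x * f x) := by
  have hdet : ∀ x ∈ W, ContDiffAt ℝ ∞ (fun x => (jacobian T x).det) x := fun x hx =>
    (hT x hx).contDiffAt_det
  have h1 := ((hf.nabla hT w).mul_left hh).mul_left hdet
  have h2 := (hf.mul_left fun x hx => (hT x hx).contDiffAt_nabla w (hh x hx)).mul_left hdet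
  have h3 := (hf.mul_left hh).integral_det_mul_nabla hT w
  -- The two terms of the product rule, indexed by `Fin 2` so that `IsTestOn.sum` applies.
  have e : (fun x => (jacobian T x).det * _root_.nabla T w (fun x => h x * f x) x)
      = fun x => ∑ i : Fin 2, (![fun x => (jacobian T x).det * (h x * _root_.nabla T w f x),
        fun x => (jacobian T x).det * (_root_.nabla T w h x * f x)] : Fin 2 → _) i x := by
    refine (((hf.mul_left hh).nabla hT w).mul_left hdet).ext (IsTestOn.sum fun i => ?_)
      fun x hx => ?_
    · fin_cases i
      · exact h1
      · exact h2
    · rw [nabla_mul w (hh x hx).smooth_differentiableAt (hf.smooth x).smooth_differentiableAt]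
      simp only [Fin.sum_univ_two, Matrix.cons_val_zero, Matrix.cons_val_one]
      ring
  rw [e] at h3
  simp only [Fin.sum_univ_two, Matrix.cons_val_zero, Matrix.cons_val_one] at h3
  rw [integral_add h1.integrable h2.integrable] at h3
  linarith

/-- Iterated integration by parts in coordinates. -/
theorem integral_mul_multiPow_nabla (hf : IsTestOn W f) (hT : ∀ x ∈ W, IsCoordAt T x)
    (hh : ∀ x ∈ W, ContDiffAt ℝ ∞ h x) (N : Fin p → ℕ) :
    ∫ x, (jacobian T x).det * (h x * multiPow (_root_.nabla T) N f x)
      = ∫ x, (jacobian T x).det *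
          ((-1 : ℝ) ^ (∑ n, N n) * multiPow (_root_.nabla T) N h x * f x) := by
  induction N using multiIndex_induction generalizing f with
  | h0 => simp
  | hs N n ih =>
    -- On f the extra ∇_n is split off innermost, while on h it arrives outermost; both agree with N
    -- + 1_n because the ∇'s commute.
    have e1 : multiPow (_root_.nabla T) (N + Pi.single n 1) f
        = multiPow (_root_.nabla T) N (_root_.nabla T n f) :=
      (hf.multiPow_nabla hT _).ext ((hf.nabla hT n).multiPow_nabla hT N) fun x hx =>
        (multiPow_nabla_add_single (hT x hx) N n (hf.smooth x)).1.eq_of_nhds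
    have hN : ∀ x ∈ W, ContDiffAt ℝ ∞
        (fun y => (-1 : ℝ) ^ (∑ n, N n) * multiPow (_root_.nabla T) N h y) x := fun x hx =>
      contDiffAt_const.mul ((hT x hx).contDiffAt_multiPow N (hh x hx))
    rw [e1, ih (hf.nabla hT n), hf.integral_mul_nabla hT hN n, ← integral_neg]
    congr 1
    funext x
    by_cases hx : x ∈ W
    · have e2 := (multiPow_nabla_add_single (hT x hx) N n (hh x hx)).2.eq_of_nhds
      have hs : ∑ m, (N + Pi.single n 1 : Fin p → ℕ) m = (∑ m, N m) + 1 := by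
        simp [Finset.sum_add_distrib]
      rw [nabla_mul n (differentiableAt_const _)
        ((hT x hx).contDiffAt_multiPow N (hh x hx)).smooth_differentiableAt, hs, e2, pow_succ]
      simp only [_root_.nabla, pderivAlong_const, mul_zero, Finset.sum_const_zero, zero_mul]
      ring
    · rw [hf.eq_zero hx]
      ring

end IsTestOn

/-- The fundamental lemma of the calculus of variations. -/
theorem eq_zero_of_forall_integral_eq_zero (hW : IsOpen W) (hf : ∀ x ∈ W, ContDiffAt ℝ ∞ f x)
    (h : ∀ g, IsTestOn W g → ∫ x, f x * g x = 0) : ∀ x ∈ W, f x = 0 := by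
  have hc : ContinuousOn f W := fun x hx => (hf x hx).continuousAt.continuousWithinAt
  have hae : ∀ᵐ x, x ∈ W → f x = 0 := by
    refine hW.ae_eq_zero_of_integral_contDiff_smul_eq_zero
      (hc.locallyIntegrableOn hW.measurableSet) fun g hg hgc hgW => ?_
    rw [← h g ⟨fun x => hg.contDiffAt, hgc, hgW⟩]
    simp only [smul_eq_mul, mul_comm]
  exact Measure.eqOn_open_of_ae_eq (g := fun _ => (0 : ℝ))
    ((ae_restrict_iff' hW.measurableSet).2 hae) hW hc continuousOn_const

end TestFunctions

/-! ## The Euler–Lagrange expressions of the homogeneous Lagrange function -/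

section EulerLagrange

open Topology Filter MeasureTheory

variable {p q r : ℕ} {b : Fin p → ℝ} {s η : Fin p ⊕ Fin q → (Fin p → ℝ) → ℝ}
  {W : Set (Fin p → ℝ)} {L : JetSpace p (Fin q) r → ℝ} {x : Fin p → ℝ}

/-- The Lagrange function `(L ∘ ℘_φ) · det U` on infinite jets. -/
noncomputable def homogLift (L : JetSpace p (Fin q) r → ℝ) (z : InfJet p (Fin p ⊕ Fin q)) : ℝ :=
  L (contactJet r z) * (jetU z).det

theorem contactJet_velProlong_self (hs : ∀ α, ContDiffAt ℝ ∞ (s α) x)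
    (hdet : (jacobian (fun w => s (Sum.inl w)) x).det ≠ 0) :
    contactJet r (velProlong b s x)
      = (prolong (fun w => s (Sum.inl w)) (fun i => s (Sum.inr i)) x).trunc r :=
  (contactJet_velProlong hs hdet).eq_of_nhds

theorem cylAt_homogLift (hr : 1 ≤ r) {z : InfJet p (Fin p ⊕ Fin q)} (hdet : (jetU z).det ≠ 0)
    (hL : ContDiffAt ℝ ∞ L (contactJet r z)) : CylAt r (homogLift L) z :=
  ((cylAt_contactJet hdet).comp hL).mul (CylAt.matrix_det fun w n => cylAt_jetU hr w n)

/-- The first variation of the homogeneous Lagrange function. -/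
theorem linVar_homogLift (hW : IsOpen W)
    (hs : ∀ x ∈ W, ∀ α, ContDiffAt ℝ ∞ (s α) x) (hη : ∀ x ∈ W, ∀ α, ContDiffAt ℝ ∞ (η α) x)
    (hdet : ∀ x ∈ W, (jacobian (fun w => s (Sum.inl w)) x).det ≠ 0)
    (hL : ∀ x ∈ W, ContDiffAt ℝ ∞ L
      ((prolong (fun w => s (Sum.inl w)) (fun i => s (Sum.inr i)) x).trunc r)) (hx : x ∈ W) :
    linVar b s η (homogLift L) x = (jacobian (fun w => s (Sum.inl w)) x).det *
      (∑ i, ∑ N : MIdx p r, jetPartial i N L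
          ((prolong (fun w => s (Sum.inl w)) (fun i => s (Sum.inr i)) x).trunc r) *
            multiPow (nabla fun w => s (Sum.inl w)) N.1 (characteristic s η i) x
        + ∑ a, nabla (fun w => s (Sum.inl w)) a (fun y => η (Sum.inl a) y *
            L ((prolong (fun w => s (Sum.inl w)) (fun i => s (Sum.inr i)) y).trunc r)) x) := by
  set T : Fin p → (Fin p → ℝ) → ℝ := fun w => s (Sum.inl w) with hTdef
  set X : Fin q → (Fin p → ℝ) → ℝ := fun i => s (Sum.inr i) with hXdef
  have hT : IsCoordAt T x := ⟨fun w => hs x hx _, hdet x hx⟩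
  have hX : ∀ i, ContDiffAt ℝ ∞ (X i) x := fun i => hs x hx _
  have hU : jetU (velProlong b s x) = jacobian T x := jetU_velProlong fun w => hs x hx _
  have hdetU : (jetU (velProlong b s x)).det ≠ 0 := by rw [hU]; exact hdet x hx
  have hwp : contactJet r (velProlong b s x) = (prolong T X x).trunc r :=
    contactJet_velProlong_self (hs x hx) (hdet x hx)
  have hLx := hL x hx
  have hcyl : CylAt (r + 1) (fun z => L (contactJet r z)) (velProlong b s x) :=
    ((cylAt_contactJet hdetU).comp (by rwa [hwp])).mono r.le_succ
  have hcylU : CylAt (r + 1) (fun z : InfJet p (Fin p ⊕ Fin q) => (jetU z).det)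
      (velProlong b s x) := CylAt.matrix_det fun w n => cylAt_jetU (Nat.le_add_left 1 r) w n
  have hcurve := hT.contDiffAt_trunc_prolong hX r
  have hLc : ContDiffAt ℝ ∞ (fun y => L ((prolong T X y).trunc r)) x :=
    ContDiffAt.comp (g := L) x hLx hcurve
  -- the variation of the contact element
  set v : JetSpace p (Fin q) r := (fun w => η (Sum.inl w) x,
    fun i N => linVar b s η (contactCoord i N.1) x) with hv
  have hcj : HasLineDerivAt ℝ (contactJet r) v (velProlong b s x) (jetVar η x) := by
    have h1 : ∀ w, HasDerivAt (fun t : ℝ =>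
        (velProlong b s x + t • jetVar η x).2 (Sum.inl w) 0) (η (Sum.inl w) x) 0 := by
      intro w
      have := (CylAt.coord (k := 0) (z := velProlong b s x) (Sum.inl w) 0
        (by simp)).hasLineDerivAt_linVar (η := η)
      rw [linVar_coord, show multiDeriv 0 (η (Sum.inl w)) = η (Sum.inl w) from
        multiPow_zero _ _] at this
      exact this
    have h2 : ∀ i, ∀ N : MIdx p r, HasDerivAt (fun t : ℝ =>
        contactCoord i N.1 (velProlong b s x + t • jetVar η x))
        (linVar b s η (contactCoord i N.1) x) 0 := fun i N =>
      (cylAt_contactCoord hdetU i N.1).hasLineDerivAt_linVar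
    exact (hasDerivAt_pi.2 h1).prodMk (hasDerivAt_pi.2 fun i => hasDerivAt_pi.2 (h2 i))
  have hlinL : linVar b s η (fun z => L (contactJet r z)) x
      = fderiv ℝ L ((prolong T X x).trunc r) v := by
    have h1 : HasFDerivAt L (fderiv ℝ L ((prolong T X x).trunc r))
        (contactJet r (velProlong b s x + (0 : ℝ) • jetVar η x)) := by
      rw [zero_smul, add_zero, hwp]
      exact hLx.smooth_differentiableAt.hasFDerivAt
    exact (HasFDerivAt.comp_hasDerivAt (0 : ℝ) h1 hcj).deriv
  have hnabla : ∀ a, nabla T a (fun y => L ((prolong T X y).trunc r)) x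
      = fderiv ℝ L ((prolong T X x).trunc r) (((prolong T X x).totalDir a).trunc r) := by
    intro a
    rw [nabla_comp_eq_fderiv a hLx.smooth_differentiableAt hcurve.smooth_differentiableAt,
      (hT.eventually_sum_fderiv_prolong hX r a).self_of_nhds]
  -- The variation is the prolonged characteristic plus a motion along the submanifold. The latter
  -- contributes Σ η^a ∇_a L, which joins the term L · Σ ∇_a η^a from det U to form Σ ∇_a(η^a L).
  have hvdec : v = (0, fun i N => multiPow (nabla T) N.1 (characteristic s η i) x)
      + ∑ a, η (Sum.inl a) x • ((prolong T X x).totalDir a).trunc r := by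
    refine Prod.ext ?_ ?_
    · funext w
      simp [hv, Prod.fst_sum, InfJet.trunc, InfJet.totalDir, Pi.single_apply]
    · funext i N
      have h1 := charVar_contactCoord (b := b) hW hs hη hdet i N.1 hx
      have h2 : ∀ a, nabla T a (fun y => contactCoord i N.1 (velProlong b s y)) x
          = multiPow (nabla T) (N.1 + Pi.single a 1) (X i) x := fun a =>
        (((contactCoord_velProlong (hs x hx) (hdet x hx) i N.1).nabla T a).trans
          (multiPow_nabla_add_single hT N.1 a (hX i)).2.symm).eq_of_nhds
      rw [charVar] at h1
      simp only [← hTdef, h2] at h1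
      simp only [hv, Prod.snd_add, Prod.snd_sum, Pi.add_apply, Finset.sum_apply, Prod.smul_snd,
        Pi.smul_apply, smul_eq_mul]
      rw [← h1]
      exact (sub_add_cancel _ _).symm
  rw [show homogLift L = fun z : InfJet p (Fin p ⊕ Fin q) =>
    L (contactJet r z) * (jetU z).det from rfl, hcyl.linVar_mul hcylU, hlinL, hU, hwp,
    linVar_det_jetU (hs x hx) (hη x hx) (hdet x hx), hvdec, map_add,
    fderiv_vert_eq_sum_jetPartial hLx.smooth_differentiableAt, map_sum]
  simp only [map_smul, ← hnabla, smul_eq_mul, ← hTdef,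
    nabla_mul _ (hη x hx (Sum.inl _)).smooth_differentiableAt hLc.smooth_differentiableAt,
    Finset.sum_add_distrib]
  rw [← Finset.sum_mul]
  ring

/-- The components of the Euler–Lagrange covector of the homogeneous Lagrange function are linear
combinations of the Euler–Lagrange expressions of `L`; these are the coefficients. -/
noncomputable def transferCoeff (s : Fin p ⊕ Fin q → (Fin p → ℝ) → ℝ) (α : Fin p ⊕ Fin q)
    (i : Fin q) (x : Fin p → ℝ) : ℝ :=
  Sum.elim (fun w => -nabla (fun w => s (Sum.inl w)) w (s (Sum.inr i)) x)
    (fun j => if i = j then 1 else 0) α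

theorem characteristic_single (s : Fin p ⊕ Fin q → (Fin p → ℝ) → ℝ) (α : Fin p ⊕ Fin q)
    (ψ : (Fin p → ℝ) → ℝ) (i : Fin q) :
    characteristic s (Pi.single α ψ) i = fun x => transferCoeff s α i x * ψ x := by
  funext x
  rcases α with w | j
  · have h : ∀ a, (Pi.single (Sum.inl w) ψ : Fin p ⊕ Fin q → (Fin p → ℝ) → ℝ) (Sum.inl a) x
        = if a = w then ψ x else 0 := by
      intro a
      by_cases ha : a = w
      · subst ha; simp
      · simp [ha]
    simp [characteristic, transferCoeff, h, mul_comm]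
  · have h : (Pi.single (Sum.inr j) ψ : Fin p ⊕ Fin q → (Fin p → ℝ) → ℝ) (Sum.inr i) x
        = if i = j then ψ x else 0 := by
      by_cases ha : i = j
      · subst ha; simp
      · simp [ha]
    simp [characteristic, transferCoeff, h]

/-- For a test function ψ, the variation ψ of component α alone is integrated in two ways: by parts
in τ, giving the left side times ψ, and by parts in the coordinates T, where its characteristic is
`transferCoeff` times ψ, giving the right side times ψ. The fundamental lemma removes ψ. -/
theorem eulerLagrange_homogLift (hr : 1 ≤ r) (hW : IsOpen W)
    (hs : ∀ x ∈ W, ∀ α, ContDiffAt ℝ ∞ (s α) x)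
    (hdet : ∀ x ∈ W, (jacobian (fun w => s (Sum.inl w)) x).det ≠ 0)
    (hL : ∀ x ∈ W, ContDiffAt ℝ ∞ L
      ((prolong (fun w => s (Sum.inl w)) (fun i => s (Sum.inr i)) x).trunc r))
    {F : JetSpace p (Fin p ⊕ Fin q) r → ℝ}
    (hF : ∀ x ∈ W, ∀ᶠ y in 𝓝 ((velProlong b s x).trunc r), ∀ z : InfJet p (Fin p ⊕ Fin q),
      z.trunc r = y → F y = homogLift L z) (α : Fin p ⊕ Fin q) (hx : x ∈ W) :
    eulerLagrange F ((velProlong b s x).trunc (2 * r)) α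
      = (jacobian (fun w => s (Sum.inl w)) x).det * ∑ i, eulerLagrange L
          ((prolong (fun w => s (Sum.inl w)) (fun i => s (Sum.inr i)) x).trunc (2 * r)) i *
            transferCoeff s α i x := by
  set T : Fin p → (Fin p → ℝ) → ℝ := fun w => s (Sum.inl w) with hTdef
  set X : Fin q → (Fin p → ℝ) → ℝ := fun i => s (Sum.inr i) with hXdef
  set B : Fin p → (Fin p → ℝ) → ℝ := fun w y => b w + y w with hBdef
  have hT : ∀ x ∈ W, IsCoordAt T x := fun x hx => ⟨fun w => hs x hx _, hdet x hx⟩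
  have hB : ∀ x ∈ W, IsCoordAt B x := fun x _ => isCoordAt_translate b x
  have hX : ∀ x ∈ W, ∀ i, ContDiffAt ℝ ∞ (X i) x := fun x hx i => hs x hx _
  have hFs : ∀ x ∈ W, ContDiffAt ℝ ∞ F ((velProlong b s x).trunc r) := by
    intro x hx
    obtain ⟨G, hG, hFG⟩ := cylAt_homogLift (L := L) hr (z := velProlong b s x)
      (by rw [jetU_velProlong fun w => hs x hx _]; exact hdet x hx)
      (by rw [contactJet_velProlong_self (hs x hx) (hdet x hx)]; exact hL x hx)
    refine hG.congr_of_eventuallyEq ?_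
    filter_upwards [hF x hx, hFG] with y hy hy'
    rw [hy _ (InfJet.trunc_toInf y), hy' _ (InfJet.trunc_toInf y)]
  have hE : ∀ x ∈ W, ∀ α, eulerLagrange F ((velProlong b s x).trunc (2 * r)) α
      = ∑ N : MIdx p r, (-1 : ℝ) ^ (∑ n, N.1 n) *
          multiPow (nabla B) N.1 (fun y => jetPartial α N F ((velProlong b s y).trunc r)) x :=
    fun x hx α => eulerLagrange_prolong (hB x hx) (hs x hx) (hFs x hx) α
  have he : ∀ x ∈ W, ∀ i, eulerLagrange L ((prolong T X x).trunc (2 * r)) i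
      = ∑ N : MIdx p r, (-1 : ℝ) ^ (∑ n, N.1 n) *
          multiPow (nabla T) N.1 (fun y => jetPartial i N L ((prolong T X y).trunc r)) x :=
    fun x hx i => eulerLagrange_prolong (hT x hx) (hX x hx) (hL x hx) i
  have hP : ∀ N : MIdx p r, ∀ x ∈ W,
      ContDiffAt ℝ ∞ (fun y => jetPartial α N F ((velProlong b s y).trunc r)) x :=
    fun N x hx => ContDiffAt.jetPartial_prolong (hB x hx) (hs x hx) (hFs x hx) α N
  have hl : ∀ (i : Fin q) (N : MIdx p r), ∀ x ∈ W,
      ContDiffAt ℝ ∞ (fun y => jetPartial i N L ((prolong T X y).trunc r)) x :=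
    fun i N x hx => ContDiffAt.jetPartial_prolong (hT x hx) (hX x hx) (hL x hx) i N
  have hc : ∀ i, ∀ x ∈ W, ContDiffAt ℝ ∞ (transferCoeff s α i) x := by
    intro i x hx
    rcases α with w | j
    · exact ((hT x hx).contDiffAt_nabla w (hX x hx i)).neg
    · exact contDiffAt_const
  have hΛ : ∀ x ∈ W, ContDiffAt ℝ ∞ (fun y => L ((prolong T X y).trunc r)) x := fun x hx =>
    ContDiffAt.comp (g := L) x (hL x hx) ((hT x hx).contDiffAt_trunc_prolong (hX x hx) r)
  have hdetc : ∀ x ∈ W, ContDiffAt ℝ ∞ (fun y => (jacobian T y).det) x := fun x hx =>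
    (hT x hx).contDiffAt_det
  set P := fun (N : MIdx p r) y => jetPartial α N F ((velProlong b s y).trunc r) with hPdef
  set ℓ := fun (i : Fin q) (N : MIdx p r) y => jetPartial i N L ((prolong T X y).trunc r)
    with hldef
  set E := fun y => ∑ N : MIdx p r, (-1 : ℝ) ^ (∑ n, N.1 n) * multiPow (nabla B) N.1 (P N) y
    with hEdef
  set e := fun (i : Fin q) y => ∑ N : MIdx p r, (-1 : ℝ) ^ (∑ n, N.1 n) *
    multiPow (nabla T) N.1 (ℓ i N) y with hedef
  have hEs : ∀ x ∈ W, ContDiffAt ℝ ∞ E x := fun x hx => ContDiffAt.sum fun N _ =>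
    contDiffAt_const.mul ((hB x hx).contDiffAt_multiPow N.1 (hP N x hx))
  have hes : ∀ i, ∀ x ∈ W, ContDiffAt ℝ ∞ (e i) x := fun i x hx => ContDiffAt.sum fun N _ =>
    contDiffAt_const.mul ((hT x hx).contDiffAt_multiPow N.1 (hl i N x hx))
  suffices h : ∀ x ∈ W, E x - (jacobian T x).det * ∑ i, e i x * transferCoeff s α i x = 0 by
    rw [hE x hx]
    simp only [he x hx]
    exact sub_eq_zero.1 (h x hx)
  refine eq_zero_of_forall_integral_eq_zero hW (fun x hx => (hEs x hx).sub
    ((hdetc x hx).mul (ContDiffAt.sum fun i _ => (hes i x hx).mul (hc i x hx)))) fun ψ hψ => ?_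
  -- the variation of the action, in two ways
  have hη : ∀ x ∈ W, ∀ β, ContDiffAt ℝ ∞
      ((Pi.single α ψ : Fin p ⊕ Fin q → (Fin p → ℝ) → ℝ) β) x := by
    intro x _ β
    by_cases hβ : β = α
    · subst hβ; simpa using hψ.smooth x
    · rw [Pi.single_eq_of_ne hβ]; exact contDiffAt_const
  have hη' : ∀ a, IsTestOn W fun y =>
      (Pi.single α ψ : Fin p ⊕ Fin q → (Fin p → ℝ) → ℝ) (Sum.inl a) y *
        L ((prolong T X y).trunc r) := by
    intro a
    refine hψ.of_support (fun x hx => (hη x hx _).mul (hΛ x hx)) fun x hx => ?_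
    by_cases ha : Sum.inl a = α
    · subst ha; simp [hx.eq_of_nhds]
    · simp [Pi.single_eq_of_ne ha]
  have hQ : ∀ i, IsTestOn W (characteristic s (Pi.single α ψ) i) := fun i => by
    rw [characteristic_single]
    exact hψ.mul_left (hc i)
  have t1 : ∀ N : MIdx p r, IsTestOn W fun y =>
      (jacobian B y).det * (P N y * multiPow (nabla B) N.1 ψ y) := fun N =>
    ((hψ.multiPow_nabla hB N.1).mul_left (hP N)).mul_left fun x hx => (hB x hx).contDiffAt_det
  have t2 : ∀ i, ∀ N : MIdx p r, IsTestOn W fun y => (jacobian T y).det *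
      (ℓ i N y * multiPow (nabla T) N.1 (characteristic s (Pi.single α ψ) i) y) := fun i N =>
    (((hQ i).multiPow_nabla hT N.1).mul_left (hl i N)).mul_left hdetc
  have t3 : ∀ a, IsTestOn W fun y => (jacobian T y).det * nabla T a (fun y =>
      (Pi.single α ψ : Fin p ⊕ Fin q → (Fin p → ℝ) → ℝ) (Sum.inl a) y *
        L ((prolong T X y).trunc r)) y := fun a => ((hη' a).nabla hT a).mul_left hdetc
  have t1' : ∀ N : MIdx p r, IsTestOn W fun y => (jacobian B y).det *
      ((-1 : ℝ) ^ (∑ n, N.1 n) * multiPow (nabla B) N.1 (P N) y * ψ y) := fun N =>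
    (hψ.mul_left fun x hx => contDiffAt_const.mul
      ((hB x hx).contDiffAt_multiPow N.1 (hP N x hx))).mul_left fun x hx =>
        (hB x hx).contDiffAt_det
  have t2' : ∀ i, ∀ N : MIdx p r, IsTestOn W fun y => (jacobian T y).det *
      ((-1 : ℝ) ^ (∑ n, N.1 n) * multiPow (nabla T) N.1 (ℓ i N) y *
        characteristic s (Pi.single α ψ) i y) := fun i N =>
    ((hQ i).mul_left fun x hx => contDiffAt_const.mul
      ((hT x hx).contDiffAt_multiPow N.1 (hl i N x hx))).mul_left hdetc
  have hsum : (fun y => ∑ N : MIdx p r, (jacobian B y).det *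
        (P N y * multiPow (nabla B) N.1 ψ y))
      = fun y => ∑ β : Fin q ⊕ Fin p, Sum.elim
        (fun i y => ∑ N : MIdx p r, (jacobian T y).det *
          (ℓ i N y * multiPow (nabla T) N.1 (characteristic s (Pi.single α ψ) i) y))
        (fun a y => (jacobian T y).det * nabla T a (fun y =>
          (Pi.single α ψ : Fin p ⊕ Fin q → (Fin p → ℝ) → ℝ) (Sum.inl a) y *
            L ((prolong T X y).trunc r)) y) β y := by
    refine (IsTestOn.sum t1).ext (IsTestOn.sum fun β => ?_) fun x hx => ?_
    · rcases β with i | a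
      · exact IsTestOn.sum (t2 i)
      · exact t3 a
    · have h1 := linVar_homogLift (b := b) hW hs hη hdet hL hx
      -- F represents the lift near the jet, so its partial derivatives express the variation; only
      -- those in direction α survive.
      have h2 : linVar b s (Pi.single α ψ) (homogLift L) x
          = ∑ N : MIdx p r, P N x * multiPow (nabla B) N.1 ψ x := by
        have h3 := (hasLineDerivAt_of_cyl (F := homogLift L) (G := F)
          (jetVar (Pi.single α ψ) x) ((hF x hx).mono fun y hy z hz => (hy z hz).symm)
          (hFs x hx).smooth_differentiableAt).lineDeriv
        refine h3.trans ((fderiv_vert_eq_sum_jetPartial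
          (hFs x hx).smooth_differentiableAt _).trans ?_)
        rw [Finset.sum_eq_single α]
        · refine Finset.sum_congr rfl fun N _ => ?_
          simp only [jetVar, Pi.single_eq_same, multiDeriv_eq_multiPow_nabla b, hPdef, hBdef]
        · intro β _ hβ
          refine Finset.sum_eq_zero fun N _ => ?_
          have h0 : (Pi.single α ψ : Fin p ⊕ Fin q → (Fin p → ℝ) → ℝ) β = fun _ => 0 := by
            rw [Pi.single_eq_of_ne hβ]; rfl
          simp only [jetVar, h0, multiDeriv_const, ite_self, mul_zero]
        · intro h
          exact absurd (Finset.mem_univ α) h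
      have hBdet : (jacobian B x).det = 1 := by rw [hBdef, jacobian_translate, Matrix.det_one]
      rw [Fintype.sum_sum_type]
      simp only [Sum.elim_inl, Sum.elim_inr, hBdet, one_mul, ← Finset.mul_sum]
      rw [← h2, h1, mul_add]
  have hI := congrArg (fun f : (Fin p → ℝ) → ℝ => ∫ y, f y) hsum
  simp only [Fintype.sum_sum_type, Sum.elim_inl, Sum.elim_inr] at hI
  -- The integrals are split into terms, and the divergences ∇_a(η^a L) drop out.
  rw [integral_finsetSum _ fun N _ => (t1 N).integrable,
    integral_add (IsTestOn.sum fun i => IsTestOn.sum (t2 i)).integrable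
      (IsTestOn.sum t3).integrable,
    integral_finsetSum _ fun i _ => (IsTestOn.sum (t2 i)).integrable,
    integral_finsetSum _ fun a _ => (t3 a).integrable,
    Finset.sum_eq_zero fun a _ => (hη' a).integral_det_mul_nabla hT a, add_zero] at hI
  simp only [integral_finsetSum _ fun N _ => (t2 _ N).integrable] at hI
  rw [Finset.sum_congr rfl fun N _ => hψ.integral_mul_multiPow_nabla hB (hP N) N.1,
    Finset.sum_congr rfl fun i _ => Finset.sum_congr rfl fun N _ =>
      (hQ i).integral_mul_multiPow_nabla hT (hl i N) N.1] at hI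
  rw [← integral_finsetSum _ fun N _ => (t1' N).integrable,
    Finset.sum_congr rfl fun i _ =>
      (integral_finsetSum Finset.univ fun N _ => (t2' i N).integrable).symm,
    ← integral_finsetSum _ fun i _ => (IsTestOn.sum (t2' i)).integrable] at hI
  have hE' : ∀ y, ∑ N : MIdx p r, (jacobian B y).det *
      ((-1 : ℝ) ^ (∑ n, N.1 n) * multiPow (nabla B) N.1 (P N) y * ψ y) = E y * ψ y := by
    intro y
    rw [hBdef, jacobian_translate, Matrix.det_one, hEdef, Finset.sum_mul]
    simp only [one_mul, hBdef]
  have he' : ∀ y, ∑ i, ∑ N : MIdx p r, (jacobian T y).det *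
      ((-1 : ℝ) ^ (∑ n, N.1 n) * multiPow (nabla T) N.1 (ℓ i N) y *
        characteristic s (Pi.single α ψ) i y)
      = (jacobian T y).det * (∑ i, e i y * transferCoeff s α i y) * ψ y := by
    intro y
    simp only [characteristic_single, hedef, Finset.mul_sum, Finset.sum_mul]
    exact Finset.sum_congr rfl fun i _ => Finset.sum_congr rfl fun N _ => by ring
  simp only [hE', he'] at hI
  simp only [sub_mul]
  rw [integral_sub (hψ.mul_left hEs).integrable
    (hψ.mul_left fun x hx => (hdetc x hx).mul
      (ContDiffAt.sum fun i _ => (hes i x hx).mul (hc i x hx))).integrable, hI, sub_self]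

end EulerLagrange

/-! ## The equivalence of the Euler–Lagrange equations -/

section Equivalence

open Topology Filter

variable {p q : ℕ} {M : Type*} [TopologicalSpace M] [ChartedSpace (ModelPQ p q) M]
  {φ : OpenPartialHomeomorph M (ModelPQ p q)}

/-- The translation by −τ puts the base coordinate at τ equal to 0, the parameter value at which
`velocityEulerLagrange` is evaluated. -/
theorem trunc_infCoord_velocityAt (hφ : φ ∈ IsManifold.maximalAtlas 𝓘(ℝ, ModelPQ p q) ∞ M)
    {k : ℕ} {σ : (Fin p → ℝ) → M} {τ : Fin p → ℝ}
    (hσ : ContMDiffAt 𝓘(ℝ, Fin p → ℝ) 𝓘(ℝ, ModelPQ p q) ∞ σ τ) (hτ : σ τ ∈ φ.source) :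
    (velProlong (-τ) (chartComp φ σ) τ).trunc k = (0, (velocityAt k σ τ hσ).coord φ) := by
  refine Prod.ext (funext fun w => neg_add_cancel _) ?_
  funext α N
  refine (velProlong_snd _ _ _ _ _).trans ((coord_velocityMk hφ _ ?_ α N).trans ?_).symm
  · simpa using hτ
  · have := congrFun (multiDeriv_translate N.1 τ (chartComp φ σ α)) 0
    simp only [add_zero] at this
    exact this

theorem jetU_velocityAt (hφ : φ ∈ IsManifold.maximalAtlas 𝓘(ℝ, ModelPQ p q) ∞ M)
    {k : ℕ} (hk : 1 ≤ k) {σ : (Fin p → ℝ) → M} {τ : Fin p → ℝ}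
    (hσ : ContMDiffAt 𝓘(ℝ, Fin p → ℝ) 𝓘(ℝ, ModelPQ p q) ∞ σ τ) (hτ : σ τ ∈ φ.source) :
    jetU ((velocityAt k σ τ hσ).infCoord φ) = jacobian (fun w => chartComp φ σ (Sum.inl w)) τ := by
  have h := trunc_infCoord (φ := φ) (velocityAt k σ τ hσ)
  rw [← trunc_infCoord_velocityAt hφ hσ hτ] at h
  rw [jetU_congr hk h, jetU_velProlong fun w => contDiffAt_chartComp hφ hσ hτ _]

theorem wpChart_velocityAt (hφ : φ ∈ IsManifold.maximalAtlas 𝓘(ℝ, ModelPQ p q) ∞ M)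
    {k : ℕ} (hk : 1 ≤ k) {σ : (Fin p → ℝ) → M} {τ : Fin p → ℝ}
    (hσ : ContMDiffAt 𝓘(ℝ, Fin p → ℝ) 𝓘(ℝ, ModelPQ p q) ∞ σ τ) (hτ : σ τ ∈ φ.source)
    (hdet : (jacobian (fun w => chartComp φ σ (Sum.inl w)) τ).det ≠ 0) :
    wpChart φ (velocityAt k σ τ hσ) = (prolong (fun w => chartComp φ σ (Sum.inl w))
      (fun i => chartComp φ σ (Sum.inr i)) τ).trunc k := by
  have hU := jetU_velocityAt hφ hk hσ hτ
  have h := trunc_infCoord (φ := φ) (velocityAt k σ τ hσ)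
  rw [← trunc_infCoord_velocityAt hφ hσ hτ] at h
  rw [wpChart_eq hk hφ _ (by simpa [velocityAt, velocityMk, Velocity.base] using hτ)
    (by rwa [detU_eq, hU]),
    ← contactJet_velProlong_self (b := -τ) (contDiffAt_chartComp hφ hσ hτ) hdet]
  exact (cylAt_contactJet (by rwa [hU])).apply_eq h

end Equivalence

theorem proposition1 {p q r : ℕ} (hr : 1 ≤ r)
    {M : Type*} [TopologicalSpace M] [ChartedSpace (ModelPQ p q) M]
    [IsManifold 𝓘(ℝ, ModelPQ p q) ∞ M]
    (φ : OpenPartialHomeomorph M (ModelPQ p q))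
    (hφ : φ ∈ IsManifold.maximalAtlas 𝓘(ℝ, ModelPQ p q) ∞ M)
    (O : Set (JetSpace p (Fin q) r)) (hO : IsOpen O)
    (L : JetSpace p (Fin q) r → ℝ) (hL : ContDiffOn ℝ ∞ L O)
    (W : Set (Fin p → ℝ)) (hW : IsOpen W) (σ : (Fin p → ℝ) → M)
    (hσ : ∀ τ ∈ W, ContMDiffAt 𝓘(ℝ, Fin p → ℝ) 𝓘(ℝ, ModelPQ p q) ∞ σ τ)
    (hsource : ∀ τ ∈ W, σ τ ∈ φ.source)
    (hdet : ∀ (τ : Fin p → ℝ) (hτ : τ ∈ W), (velocityAt r σ τ (hσ τ hτ)).detU hr φ ≠ 0)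
    (hdom : ∀ (τ : Fin p → ℝ) (hτ : τ ∈ W), wpChart φ (velocityAt r σ τ (hσ τ hτ)) ∈ O) :
    ∀ (τ : Fin p → ℝ) (hτ : τ ∈ W),
      eulerLagrange L (wpChart φ (velocityAt (2 * r) σ τ (hσ τ hτ))) = 0 ↔
        velocityEulerLagrange φ (homogLagrange hr φ L) (velocityAt (2 * r) σ τ (hσ τ hτ)) = 0 := by
  intro τ hτ
  set s := chartComp φ σ with hsdef
  have hs : ∀ x ∈ W, ∀ α, ContDiffAt ℝ ∞ (s α) x := fun x hx =>
    contDiffAt_chartComp hφ (hσ x hx) (hsource x hx)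
  have hd : ∀ x ∈ W, (jacobian (fun w => s (Sum.inl w)) x).det ≠ 0 := fun x hx => by
    rw [← jetU_velocityAt hφ hr (hσ x hx) (hsource x hx), ← detU_eq]
    exact hdet x hx
  have hLs : ∀ x ∈ W, ContDiffAt ℝ ∞ L
      ((prolong (fun w => s (Sum.inl w)) (fun i => s (Sum.inr i)) x).trunc r) := fun x hx => by
    have h := hdom x hx
    rw [wpChart_velocityAt hφ hr (hσ x hx) (hsource x hx) (hd x hx)] at h
    exact hL.contDiffAt (hO.mem_nhds h)
  -- Both requirements of `localExpr_homogLagrange`, det U ≠ 0 and a base point in the chart's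
  -- target, are open conditions on the r-jet.
  have hF : ∀ x ∈ W, ∀ᶠ y in nhds ((velProlong (-τ) s x).trunc r),
      ∀ z : InfJet p (Fin p ⊕ Fin q), z.trunc r = y →
        localExpr φ (homogLagrange hr φ L) y.2 = homogLift L z := by
    intro x hx
    have hU : jetU (velProlong (-τ) s x) = jacobian (fun w => s (Sum.inl w)) x :=
      jetU_velProlong fun w => hs x hx _
    obtain ⟨G, hG, hGd⟩ := CylAt.matrix_det (A := jetU) (z := velProlong (-τ) s x)
      fun w n => cylAt_jetU (p := p) (q := q) hr w n
    have hG0 : G ((velProlong (-τ) s x).trunc r) ≠ 0 := by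
      rw [← hGd.self_of_nhds _ rfl]
      simpa only [hU] using hd x hx
    have hcont : Continuous fun y : JetSpace p (Fin p ⊕ Fin q) r =>
        fun α => y.2 α (MIdx.zero p r) := by fun_prop
    have htar : ∀ᶠ y in nhds ((velProlong (-τ) s x).trunc r),
        (fun α => y.2 α (MIdx.zero p r)) ∈ φ.target := by
      refine hcont.continuousAt.eventually_mem (φ.open_target.mem_nhds ?_)
      have : (fun α => ((velProlong (-τ) s x).trunc r).2 α (MIdx.zero p r)) = φ (σ x) := by
        funext α
        exact (velProlong_snd _ _ _ _ _).trans
          (congrFun (multiPow_zero pderivAlong (s α)) x)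
      rw [this]
      exact φ.map_source (hsource x hx)
    filter_upwards [hGd, hG.continuousAt.eventually_ne hG0, htar] with y h1 h2 h3 z hz
    subst hz
    exact localExpr_homogLagrange hr hφ L z h3 (by rwa [h1 z rfl])
  have key := fun α => eulerLagrange_homogLift hr hW hs hd hLs hF α hτ
  have h1 : wpChart φ (velocityAt (2 * r) σ τ (hσ τ hτ))
      = (prolong (fun w => s (Sum.inl w)) (fun i => s (Sum.inr i)) τ).trunc (2 * r) :=
    wpChart_velocityAt hφ (by omega) (hσ τ hτ) (hsource τ hτ) (hd τ hτ)
  rw [velocityEulerLagrange, ← trunc_infCoord_velocityAt hφ (hσ τ hτ) (hsource τ hτ), h1]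
  constructor
  · intro h
    funext α
    rw [key α, h]
    simp
  · intro h
    funext j
    -- For α = x^j the coefficients are Kronecker deltas, so this component is det U times the j-th
    -- Euler–Lagrange expression of L.
    have hj := key (Sum.inr j)
    rw [h] at hj
    simp only [transferCoeff, Sum.elim_inr, mul_ite, mul_one, mul_zero, Finset.sum_ite_eq',
      Finset.mem_univ, if_true, Pi.zero_apply] at hj
    exact (mul_eq_zero.1 hj.symm).resolve_left (hd τ hτ)
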